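/- **Setting.** Let $Q$ be a smooth $n$-manifold, $(E,[\![\cdot,\cdot]\!]_E,\rho)$ a Lie algebroid over $Q$, $\mathcal G$ a nondegenerate bundle metric on $E$, $V\in C^\infty(Q)$, and $\mathcal D\subset E$ a vector subbundle with $E=\mathcal D\oplus\mathcal D^\perp$ and orthogonal projector $\mathcal P:E\to\mathcal D$. Let $\mathcal D_{(c)}\subset\mathcal D$ be a control subbundle of rank $k<\operatorname{rank}\mathcal D$. Fix a chart $(q^i)$ of $Q$ and sections $\{e_A\}=\{e_a,e_\alpha\}$ of $\mathcal D$ which over the chart domain form a basis of $\mathcal D$ with $\mathcal D_{(c)}=\operatorname{span}\{e_a\}$; write $y^A$ for the induced fibre coordinates, $\rho(e_A)=\rho^i_A\,\partial/\partial q^i$, $\mathcal G_{AB}=\mathcal G(e_A,e_B)$ with inverse $\mathcal G^{AB}$, and $\nabla_{e_A}e_B=\Gamma^C_{AB}e_C$, where $\nabla$ is the Levi-Civita connection on $\mathcal D$ given by the Koszul formula for $\mathcal G|_{\mathcal D}$ and the bracket $\mathcal P[\![\cdot,\cdot]\!]_E$. Set $$F^C(q,y,\dot y)=\dot y^C+\Gamma^C_{AB}y^Ay^B+\mathcal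 G^{CB}\rho^i_B\frac{\partial V}{\partial q^i},\qquad \Phi^\alpha=F^\alpha .$$ A *solution* on $[0,T]$, $T>0$, is a triple $(q,y,u)$ with $(q,y)$ of class $C^N$ ($1\le N\le\infty$) in the chart domain, $u$ valued in an open set $\mathcal U\subset\mathbb R^k$, such that $\gamma=y^Ae_A$ is admissible, $\dot q^i=\rho^i_Ay^A$, and $\nabla_\gamma\gamma+\operatorname{grad}V=u^ae_a$, i.e. $F^a=u^a$ and $\Phi^\alpha=0$. Let $C:\mathcal D\times\mathcal U\to\mathbb R$ be a smooth cost and $\mathcal J=\int_0^TC(\gamma,u)\,dt$. Put $\mathcal L(q,y,\dot y)=C\big(q,y,(F^a(q,y,\dot y))_a\big)$ and $$\widetilde{\mathcal L}=\mathcal L+\lambda_i(\dot q^i-\rho^i_Ay^A)+\bar\lambda_\alpha\Phi^\alpha .$$ Consider on $[0,T]$, for $C^1$ multipliers $\lambda_i,\bar\lambda_\alpha$, the system $$\begin{aligned} 0&=\dot\lambda_i+\lambda_j\frac{\partial\rho^j_A}{\partial q^i}y^A-\frac{\partial\mathcal L}{\partial q^i}-\bar\lambda_\alpha\frac{\partial\Phi^\alpha}{\partial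 q^i},\\ 0&=\frac{d}{dt}\Big(\frac{\partial\mathcal L}{\partial\dot y^a}\Big)+\rho^i_a\lambda_i-\frac{\partial\mathcal L}{\partial y^a}-\bar\lambda_\alpha(\Gamma^\alpha_{aB}+\Gamma^\alpha_{Ba})y^B,\\ 0&=\dot{\bar\lambda}_\alpha+\frac{d}{dt}\Big(\frac{\partial\mathcal L}{\partial\dot y^\alpha}\Big)+\lambda_i\rho^i_\alpha-\frac{\partial\mathcal L}{\partial y^\alpha}-\bar\lambda_\beta(\Gamma^\beta_{\alpha B}+\Gamma^\beta_{B\alpha})y^B,\\ 0&=\dot q^i-\rho^i_Ay^A,\qquad 0=\Phi^\alpha . \end{aligned}\tag{$*$}$$ A curve $(q,y)$ is *abnormal* if $(*)$ with $\mathcal L$ replaced by $0$ holds for some $(\lambda,\bar\lambda)\not\equiv0$. **Theorem.** (1) Let $(q,y,u)$ be a solution that minimizes, or maximizes, $\mathcal J$ among all solutions of class $C^N$ with the same values of $(q,y)$ at $0$ and $T$ that are uniformly $\varepsilon$-close to it, controls included, for some $\varepsilon>0$. If $(q,y)$ is not abnormal, there are $C^1$ multipliers $\lambda_i,\bar\lambda_\alpha$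 such that $(*)$ holds on $[0,T]$. (2) Let $q,y,\lambda,\bar\lambda$ be $C^1$ on $[0,T]$, with $q$ in the chart domain and $(F^a(q,y,\dot y))_a\in\mathcal U$. Then $(*)$ holds if and only if $(q,y,\lambda,\bar\lambda)$ satisfies the Euler–Lagrange equations of $\widetilde{\mathcal L}$, i.e. those for $\mathcal L$ with the constraints $\dot q^i=\rho^i_Ay^A$ and $\Phi^\alpha=0$; and if and only if $\int_0^T\widetilde{\mathcal L}\,dt$ is stationary at $(q,y,\lambda,\bar\lambda)$ under all smooth variations vanishing at $0$ and $T$. -/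

import Mathlib

open Set Bundle
open scoped Manifold ContDiff

noncomputable section

namespace NonholonomicControl

section Geometry

variable {n : ℕ} {Q : Type*} [TopologicalSpace Q] [ChartedSpace (EuclideanSpace ℝ (Fin n)) Q]
  [IsManifold (𝓡 n) ∞ Q]
  {F : Type*} [NormedAddCommGroup F] [NormedSpace ℝ F]
  {E : Q → Type*} [TopologicalSpace (TotalSpace F E)] [∀ q, TopologicalSpace (E q)]
  [FiberBundle F E] [∀ q, AddCommGroup (E q)] [∀ q, Module ℝ (E q)] [VectorBundle ℝ F E]

/-- The derivative `v(f)` of a function along a tangent vector. -/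
def dirDeriv {n : ℕ} {Q : Type*} [TopologicalSpace Q]
    [ChartedSpace (EuclideanSpace ℝ (Fin n)) Q] (f : Q → ℝ) (q : Q)
    (v : TangentSpace (𝓡 n) q) : ℝ :=
  mfderiv (𝓡 n) 𝓘(ℝ, ℝ) f q v

/-- A Lie algebroid structure on the vector bundle `E → Q`: a Lie bracket on the smooth sections
and a smooth anchor `ρ : E → TQ` related by the Leibniz rule
`[X, f Y] = f [X, Y] + ρ(X)(f) Y`. -/
structure LieAlgebroid (n : ℕ) {Q : Type*} [TopologicalSpace Q]
    [ChartedSpace (EuclideanSpace ℝ (Fin n)) Q] [IsManifold (𝓡 n) ∞ Q]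
    (F : Type*) [NormedAddCommGroup F] [NormedSpace ℝ F]
    (E : Q → Type*) [TopologicalSpace (TotalSpace F E)] [∀ q, TopologicalSpace (E q)]
    [FiberBundle F E] [∀ q, AddCommGroup (E q)] [∀ q, Module ℝ (E q)] [VectorBundle ℝ F E] where
  bracket : Cₛ^∞⟮𝓡 n; F, E⟯ →ₗ[ℝ] Cₛ^∞⟮𝓡 n; F, E⟯ →ₗ[ℝ] Cₛ^∞⟮𝓡 n; F, E⟯
  anchor : ∀ q : Q, E q →ₗ[ℝ] TangentSpace (𝓡 n) q
  anchor_smooth : ∀ X : Cₛ^∞⟮𝓡 n; F, E⟯,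
    ContMDiff (𝓡 n) (𝓡 n).tangent ∞
      (fun q : Q => (⟨q, anchor q (X q)⟩ : TangentBundle (𝓡 n) Q))
  bracket_self : ∀ X, bracket X X = 0
  jacobi : ∀ X Y Z,
    bracket X (bracket Y Z) + bracket Y (bracket Z X) + bracket Z (bracket X Y) = 0
  leibniz : ∀ (X Y Z : Cₛ^∞⟮𝓡 n; F, E⟯) (f : Q → ℝ), ContMDiff (𝓡 n) 𝓘(ℝ, ℝ) ∞ f →
    (∀ q, Z q = f q • Y q) →
    ∀ q, bracket X Z q
      = f q • bracket X Y q + dirDeriv f q (anchor q (X q)) • Y q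

/-- A family of subspaces of the fibres of `E` is a smooth vector subbundle of rank `m` if near
every point it has a basis consisting of `m` smooth sections. -/
def IsSubbundle (n : ℕ) {Q : Type*} [TopologicalSpace Q]
    [ChartedSpace (EuclideanSpace ℝ (Fin n)) Q] [IsManifold (𝓡 n) ∞ Q]
    (F : Type*) [NormedAddCommGroup F] [NormedSpace ℝ F]
    {E : Q → Type*} [TopologicalSpace (TotalSpace F E)] [∀ q, TopologicalSpace (E q)]
    [FiberBundle F E] [∀ q, AddCommGroup (E q)] [∀ q, Module ℝ (E q)] [VectorBundle ℝ F E]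
    (D : ∀ q, Submodule ℝ (E q)) (m : ℕ) : Prop :=
  ∀ q₀ : Q, ∃ W : Set Q, IsOpen W ∧ q₀ ∈ W ∧ ∃ s : Fin m → Cₛ^∞⟮𝓡 n; F, E⟯,
    ∀ q ∈ W, LinearIndependent ℝ (fun A => s A q) ∧
      Submodule.span ℝ (range fun A => s A q) = D q

/-- A nonholonomic system `(D, G, V)` on a Lie algebroid: a vector subbundle `D ⊂ E` of rank `m`,
a nondegenerate bundle metric `G` on `E` for which `E = D ⊕ D^⊥`, and a smooth potential `V`. -/
structure NonholonomicSystem (𝒜 : LieAlgebroid n F E) (m : ℕ) where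
  D : ∀ q : Q, Submodule ℝ (E q)
  subbundle : IsSubbundle n F D m
  G : ∀ q : Q, LinearMap.BilinForm ℝ (E q)
  G_symm : ∀ q, (G q).IsSymm
  G_nondegenerate : ∀ q, (G q).Nondegenerate
  G_smooth : ∀ X Y : Cₛ^∞⟮𝓡 n; F, E⟯,
    ContMDiff (𝓡 n) 𝓘(ℝ, ℝ) ∞ (fun q => G q (X q) (Y q))
  orthogonal_decomposition : ∀ q, IsCompl (D q) ((G q).orthogonal (D q))
  V : Q → ℝ
  V_smooth : ContMDiff (𝓡 n) 𝓘(ℝ, ℝ) ∞ V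

/-- The derivative `ρ(v)(f)` of a function along the anchor of `v ∈ E_q`. -/
def LieAlgebroid.lieDeriv (𝒜 : LieAlgebroid n F E) (f : Q → ℝ) (q : Q) (v : E q) : ℝ :=
  dirDeriv f q (𝒜.anchor q v)

namespace NonholonomicSystem

variable {𝒜 : LieAlgebroid n F E} {m : ℕ} (S : NonholonomicSystem 𝒜 m)

/-- The orthogonal projector `E → D`. -/
def proj (q : Q) : E q →ₗ[ℝ] S.D q :=
  Submodule.projectionOnto (S.D q) ((S.G q).orthogonal (S.D q)) (S.orthogonal_decomposition q)

/-- The projected bracket `[[X, Y]]_D = P [[X, Y]]_E`. -/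
def bracketD (X Y : Cₛ^∞⟮𝓡 n; F, E⟯) (q : Q) : E q :=
  S.proj q (𝒜.bracket X Y q)

/-- The right-hand side of the Koszul formula, i.e. `2 G(∇_X Y, Z)` for the Levi-Civita
connection `∇` of the restricted metric on `D`, for sections `X, Y, Z` of `D`. -/
def koszul (X Y Z : Cₛ^∞⟮𝓡 n; F, E⟯) (q : Q) : ℝ :=
  𝒜.lieDeriv (fun p => S.G p (Y p) (Z p)) q (X q)
    + 𝒜.lieDeriv (fun p => S.G p (X p) (Z p)) q (Y q)
    - 𝒜.lieDeriv (fun p => S.G p (X p) (Y p)) q (Z q)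
    + S.G q (X q) (S.bracketD Z Y q)
    + S.G q (Y q) (S.bracketD Z X q)
    - S.G q (Z q) (S.bracketD Y X q)

end NonholonomicSystem

/-- Local coordinates adapted to an underactuated system: a chart of `Q` and sections
`e_a` (`a : Fin k`), `e_α` (`α : Fin r`) of `D` which over the chart domain form a basis of `D`,
the `e_a` spanning the control subbundle `Dc`. -/
structure AdaptedFrame {𝒜 : LieAlgebroid n F E} {m : ℕ} (S : NonholonomicSystem 𝒜 m)
    (Dc : ∀ q : Q, Submodule ℝ (E q)) (k r : ℕ) where
  chart : OpenPartialHomeomorph Q (EuclideanSpace ℝ (Fin n))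
  chart_mem : chart ∈ IsManifold.maximalAtlas (𝓡 n) ∞ Q
  e : Fin k ⊕ Fin r → Cₛ^∞⟮𝓡 n; F, E⟯
  e_mem : ∀ A q, e A q ∈ S.D q
  linearIndependent : ∀ q ∈ chart.source, LinearIndependent ℝ (fun A => e A q)
  span_eq : ∀ q ∈ chart.source, Submodule.span ℝ (range fun A => e A q) = S.D q
  span_control : ∀ q ∈ chart.source,
    Submodule.span ℝ (range fun a : Fin k => e (Sum.inl a) q) = Dc q

namespace AdaptedFrame

variable {𝒜 : LieAlgebroid n F E} {m : ℕ} {S : NonholonomicSystem 𝒜 m}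
  {Dc : ∀ q : Q, Submodule ℝ (E q)} {k r : ℕ} (fr : AdaptedFrame S Dc k r)

/-- The element `y^A e_A(q)` of `D_q`. -/
def vec (q : Q) (y : Fin k ⊕ Fin r → ℝ) : S.D q :=
  ∑ A, y A • (⟨fr.e A q, fr.e_mem A q⟩ : S.D q)

/-- The matrix `G_{AB}` of the restricted metric. -/
def gram (q : Q) : Matrix (Fin k ⊕ Fin r) (Fin k ⊕ Fin r) ℝ :=
  Matrix.of fun A B => S.G q (fr.e A q) (fr.e B q)

/-- The Christoffel symbols `Γ^C_{AB}`, `∇_{e_A} e_B = Γ^C_{AB} e_C`: solving the Koszul formula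
`2 G(∇_{e_A} e_B, e_K) = koszul e_A e_B e_K` for the components of `∇_{e_A} e_B`. -/
def christoffel (q : Q) (C A B : Fin k ⊕ Fin r) : ℝ :=
  ∑ K, (fr.gram q)⁻¹ C K * (S.koszul (fr.e A) (fr.e B) (fr.e K) q / 2)

/-- The components `G^{CB} ρ_B^i ∂V/∂q^i` of the gradient of the potential. -/
def gradV (q : Q) (C : Fin k ⊕ Fin r) : ℝ :=
  ∑ B, (fr.gram q)⁻¹ C B * 𝒜.lieDeriv S.V q (fr.e B q)

/-- The coordinate velocity `q̇^i = dq^i(ρ(v))` prescribed by `v ∈ E_q`. -/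
def anchorCoord (q : Q) (v : E q) : EuclideanSpace ℝ (Fin n) :=
  mfderiv (𝓡 n) (𝓡 n) fr.chart q (𝒜.anchor q v)

/-- The anchor components `ρ^i_A` in the chart. -/
def rho (x : EuclideanSpace ℝ (Fin n)) (i : Fin n) (A : Fin k ⊕ Fin r) : ℝ :=
  fr.anchorCoord (fr.chart.symm x) (fr.e A (fr.chart.symm x)) i

/-- `ẏ^C + Γ^C_{AB} y^A y^B + G^{CB} ρ_B^i ∂V/∂q^i`: the components of
`∇_γ γ + grad V` along an admissible curve `γ = (x, y)`, where `yd` is the velocity of `y`. -/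
def force (x : EuclideanSpace ℝ (Fin n)) (y yd : Fin k ⊕ Fin r → ℝ) (C : Fin k ⊕ Fin r) : ℝ :=
  yd C + ∑ A, ∑ B, fr.christoffel (fr.chart.symm x) C A B * y A * y B
    + fr.gradV (fr.chart.symm x) C

/-- The constraint functions `Φ^α`, the unactuated part of the dynamics. -/
def Phi (α : Fin r) (x : EuclideanSpace ℝ (Fin n)) (y yd : Fin k ⊕ Fin r → ℝ) : ℝ :=
  fr.force x y yd (Sum.inr α)

/-- The cost `C : D × 𝒰 → ℝ` in local coordinates. -/
def localCost (cost : (q : Q) → S.D q → (Fin k → ℝ) → ℝ)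
    (x : EuclideanSpace ℝ (Fin n)) (y : Fin k ⊕ Fin r → ℝ) (u : Fin k → ℝ) : ℝ :=
  cost (fr.chart.symm x) (fr.vec (fr.chart.symm x) y) u

/-- The cost is smooth on `D × 𝒰` over the chart domain. -/
def SmoothCost (𝒰 : Set (Fin k → ℝ)) (cost : (q : Q) → S.D q → (Fin k → ℝ) → ℝ) : Prop :=
  ContDiffOn ℝ ∞
    (fun p : EuclideanSpace ℝ (Fin n) × (Fin k ⊕ Fin r → ℝ) × (Fin k → ℝ) =>
      fr.localCost cost p.1 p.2.1 p.2.2)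
    (fr.chart.target ×ˢ univ ×ˢ 𝒰)

/-- The Lagrangian `𝓛(q, y, ẏ)` obtained by substituting the actuated equations for the
controls in the cost. -/
def lagrangian (cost : (q : Q) → S.D q → (Fin k → ℝ) → ℝ)
    (x : EuclideanSpace ℝ (Fin n)) (y yd : Fin k ⊕ Fin r → ℝ) : ℝ :=
  fr.localCost cost x y (fun c => fr.force x y yd (Sum.inl c))

/-- `(x, y, u)` is a solution, of class `C^N` on `[0, T]`, of the underactuated controlled
nonholonomic problem with control values in `𝒰`: the curve `γ = y^A e_A` over the base curve with
coordinates `x` is admissible and `∇_γ γ + grad V = u^a e_a`. -/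
structure IsSolution (𝒰 : Set (Fin k → ℝ)) (N : ℕ∞) (T : ℝ)
    (x : ℝ → EuclideanSpace ℝ (Fin n)) (y : ℝ → Fin k ⊕ Fin r → ℝ) (u : ℝ → Fin k → ℝ) :
    Prop where
  x_regular : ContDiffOn ℝ N x (Icc 0 T)
  y_regular : ContDiffOn ℝ N y (Icc 0 T)
  x_mem : ∀ t ∈ Icc 0 T, x t ∈ fr.chart.target
  u_mem : ∀ t ∈ Icc 0 T, u t ∈ 𝒰
  admissible : ∀ t ∈ Icc 0 T, derivWithin x (Icc 0 T) t =
    fr.anchorCoord (fr.chart.symm (x t)) (fr.vec (fr.chart.symm (x t)) (y t))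
  dynamics : ∀ t ∈ Icc 0 T,
    ∑ C, fr.force (x t) (y t) (derivWithin y (Icc 0 T) t) C • fr.e C (fr.chart.symm (x t))
      = ∑ a, u t a • fr.e (Sum.inl a) (fr.chart.symm (x t))

/-- The cost functional `𝒥 = ∫₀ᵀ C(γ(t), u(t)) dt`. -/
def totalCost (cost : (q : Q) → S.D q → (Fin k → ℝ) → ℝ) (T : ℝ)
    (x : ℝ → EuclideanSpace ℝ (Fin n)) (y : ℝ → Fin k ⊕ Fin r → ℝ) (u : ℝ → Fin k → ℝ) : ℝ :=
  ∫ t in (0 : ℝ)..T, fr.localCost cost (x t) (y t) (u t)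

/-- `(x', y', u')` is a competitor of `(x, y, u)` in the optimal control problem: a solution with
the same end points in `D`, uniformly `ε`-close together with its controls. -/
def IsCompetitor (𝒰 : Set (Fin k → ℝ)) (N : ℕ∞) (T ε : ℝ)
    (x : ℝ → EuclideanSpace ℝ (Fin n)) (y : ℝ → Fin k ⊕ Fin r → ℝ) (u : ℝ → Fin k → ℝ)
    (x' : ℝ → EuclideanSpace ℝ (Fin n)) (y' : ℝ → Fin k ⊕ Fin r → ℝ) (u' : ℝ → Fin k → ℝ) :
    Prop :=
  fr.IsSolution 𝒰 N T x' y' u' ∧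
    x' 0 = x 0 ∧ y' 0 = y 0 ∧ x' T = x T ∧ y' T = y T ∧
    ∀ t ∈ Icc 0 T, ‖x' t - x t‖ < ε ∧ ‖y' t - y t‖ < ε ∧ ‖u' t - u t‖ < ε

/-- `(x, y, u)` locally extremizes the cost functional among the solutions with the same
end points. -/
def IsLocallyOptimal (𝒰 : Set (Fin k → ℝ)) (cost : (q : Q) → S.D q → (Fin k → ℝ) → ℝ)
    (N : ℕ∞) (T : ℝ)
    (x : ℝ → EuclideanSpace ℝ (Fin n)) (y : ℝ → Fin k ⊕ Fin r → ℝ) (u : ℝ → Fin k → ℝ) :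
    Prop :=
  fr.IsSolution 𝒰 N T x y u ∧ ∃ ε > 0,
    (∀ x' y' u', fr.IsCompetitor 𝒰 N T ε x y u x' y' u' →
      fr.totalCost cost T x y u ≤ fr.totalCost cost T x' y' u') ∨
    (∀ x' y' u', fr.IsCompetitor 𝒰 N T ε x y u x' y' u' →
      fr.totalCost cost T x' y' u' ≤ fr.totalCost cost T x y u)

/-- The system of necessary conditions on `[0, T]` for a Lagrangian `ℒ(q, y, ẏ)`, a curve
`(x, y)` and multipliers `λ_i`, `λ̄_α`. -/
structure NecessaryConditions
    (ℒ : EuclideanSpace ℝ (Fin n) → (Fin k ⊕ Fin r → ℝ) → (Fin k ⊕ Fin r → ℝ) → ℝ) (T : ℝ)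
    (x : ℝ → EuclideanSpace ℝ (Fin n)) (y : ℝ → Fin k ⊕ Fin r → ℝ)
    (lam : ℝ → Fin n → ℝ) (lamBar : ℝ → Fin r → ℝ) : Prop where
  lam_regular : ContDiffOn ℝ 1 lam (Icc 0 T)
  lamBar_regular : ContDiffOn ℝ 1 lamBar (Icc 0 T)
  momentum_regular : ∀ A, DifferentiableOn ℝ
    (fun t => fderiv ℝ (fun v => ℒ (x t) (y t) v) (derivWithin y (Icc 0 T) t) (Pi.single A 1))
    (Icc 0 T)
  base_eq : ∀ t ∈ Icc 0 T, ∀ i : Fin n,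
    0 = derivWithin (fun s => lam s i) (Icc 0 T) t
      + ∑ j, ∑ A, lam t j
          * fderiv ℝ (fun z => fr.rho z j A) (x t) (EuclideanSpace.single i 1) * y t A
      - fderiv ℝ (fun z => ℒ z (y t) (derivWithin y (Icc 0 T) t)) (x t)
          (EuclideanSpace.single i 1)
      - ∑ α, lamBar t α
          * fderiv ℝ (fun z => fr.Phi α z (y t) (derivWithin y (Icc 0 T) t)) (x t)
              (EuclideanSpace.single i 1)
  actuated_eq : ∀ t ∈ Icc 0 T, ∀ a : Fin k,
    0 = derivWithin (fun s => fderiv ℝ (fun v => ℒ (x s) (y s) v) (derivWithin y (Icc 0 T) s)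
          (Pi.single (Sum.inl a) 1)) (Icc 0 T) t
      + ∑ i, fr.rho (x t) i (Sum.inl a) * lam t i
      - fderiv ℝ (fun w => ℒ (x t) w (derivWithin y (Icc 0 T) t)) (y t)
          (Pi.single (Sum.inl a) 1)
      - ∑ α, lamBar t α * ∑ B,
          (fr.christoffel (fr.chart.symm (x t)) (Sum.inr α) (Sum.inl a) B
            + fr.christoffel (fr.chart.symm (x t)) (Sum.inr α) B (Sum.inl a)) * y t B
  unactuated_eq : ∀ t ∈ Icc 0 T, ∀ α : Fin r,
    0 = derivWithin (fun s => lamBar s α) (Icc 0 T) t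
      + derivWithin (fun s => fderiv ℝ (fun v => ℒ (x s) (y s) v) (derivWithin y (Icc 0 T) s)
          (Pi.single (Sum.inr α) 1)) (Icc 0 T) t
      + ∑ i, lam t i * fr.rho (x t) i (Sum.inr α)
      - fderiv ℝ (fun w => ℒ (x t) w (derivWithin y (Icc 0 T) t)) (y t)
          (Pi.single (Sum.inr α) 1)
      - ∑ β, lamBar t β * ∑ B,
          (fr.christoffel (fr.chart.symm (x t)) (Sum.inr β) (Sum.inr α) B
            + fr.christoffel (fr.chart.symm (x t)) (Sum.inr β) B (Sum.inr α)) * y t B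
  admissible : ∀ t ∈ Icc 0 T, ∀ i : Fin n,
    0 = derivWithin x (Icc 0 T) t i - ∑ A, fr.rho (x t) i A * y t A
  constraint : ∀ t ∈ Icc 0 T, ∀ α : Fin r,
    0 = fr.Phi α (x t) (y t) (derivWithin y (Icc 0 T) t)

/-- The curve is abnormal if the system with the Lagrangian dropped has a multiplier that is
not identically zero. -/
def IsAbnormal (T : ℝ) (x : ℝ → EuclideanSpace ℝ (Fin n)) (y : ℝ → Fin k ⊕ Fin r → ℝ) : Prop :=
  ∃ (lam : ℝ → Fin n → ℝ) (lamBar : ℝ → Fin r → ℝ),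
    fr.NecessaryConditions (fun _ _ _ => 0) T x y lam lamBar ∧
    ∃ t ∈ Icc 0 T, lam t ≠ 0 ∨ lamBar t ≠ 0

/-- The extended Lagrangian
`𝓛 + λ_i (q̇^i - ρ^i_A y^A) + λ̄_α Φ^α`, as a function of `w = (q, y, λ, λ̄)` and its velocity. -/
def extendedLagrangian (cost : (q : Q) → S.D q → (Fin k → ℝ) → ℝ)
    (w wd : EuclideanSpace ℝ (Fin n) × (Fin k ⊕ Fin r → ℝ) × (Fin n → ℝ) × (Fin r → ℝ)) : ℝ :=
  fr.lagrangian cost w.1 w.2.1 wd.2.1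
    + ∑ i, w.2.2.1 i * (wd.1 i - ∑ A, fr.rho w.1 i A * w.2.1 A)
    + ∑ α, w.2.2.2 α * fr.Phi α w.1 w.2.1 wd.2.1

end AdaptedFrame

end Geometry

section Variational

variable {W : Type*} [NormedAddCommGroup W] [NormedSpace ℝ W]

/-- The Euler-Lagrange equations `d/dt (∂Λ/∂ẇ) = ∂Λ/∂w` on `[0, T]`. -/
def EulerLagrange (Λ : W → W → ℝ) (T : ℝ) (w : ℝ → W) : Prop :=
  ∀ t ∈ Icc 0 T, HasDerivWithinAt
    (fun s => fderiv ℝ (fun v => Λ (w s) v) (derivWithin w (Icc 0 T) s))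
    (fderiv ℝ (fun z => Λ z (derivWithin w (Icc 0 T) t)) (w t)) (Icc 0 T) t

/-- The action `∫₀ᵀ Λ(w, ẇ) dt` is stationary at `w` under smooth variations vanishing at the
end points. -/
def IsStationary (Λ : W → W → ℝ) (T : ℝ) (w : ℝ → W) : Prop :=
  ∀ δ : ℝ → W, ContDiff ℝ ∞ δ → δ 0 = 0 → δ T = 0 →
    HasDerivAt (fun s : ℝ => ∫ t in (0 : ℝ)..T,
      Λ (w t + s • δ t) (derivWithin (fun τ => w τ + s • δ τ) (Icc 0 T) t)) 0 0

end Variational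

end NonholonomicControl

end

/-! Part (1) is the multiplier rule for a smooth optimal control problem with fixed end points. In
the chart the mechanics is a control system z' = f(z, u) with state z = (q, y), in which u^a enters
ẏ^a additively and ẏ^α is uncontrolled. Linearise the map that sends a control variation to the
final state and the cost of the perturbed trajectory. If this linear map were onto already on smooth
variations, an open mapping argument would produce nearby trajectories with the same end points and
a strictly better cost (`eventually_exists_solution_cost_eq`). At an optimum its image is therefore
a proper subspace of a finite-dimensional space, and some nonzero (p, p₀) annihilates it.
Transporting p backwards along the linearised system gives an adjoint curve ξ with ξ' = -∂_z(ξ f +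
p₀ C) and ∂_u(ξ f + p₀ C) = 0 (`exists_adjoint_curve`, `exists_multiplier_of_locally_optimal`).

No flow of the nonlinear system is needed. The state curve and finitely many control parameters are
both treated as unknowns, and the integral equation is one component of the map to be inverted. Its
linearisation in the state is the identity minus a Volterra operator, which is invertible
(`isUnit_one_sub_volterra`).

If p₀ ≠ 0, normalise p₀ = -1. Stationarity in u then says ξ_a = ∂C/∂u^a = ∂𝓛/∂ẏ^a, so the actuated
components of ξ are momenta of 𝓛. The remaining components serve as λ_i and λ̄_α, and the adjoint
equation becomes the required system (`necessaryConditions_of_adjoint`). If p₀ = 0, the same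
translation with zero cost shows that the curve is abnormal.

For part (2), λ̇ and the velocity of λ̄ do not occur in the extended Lagrangian, so its
Euler-Lagrange equations in these directions are the constraints. Those in the directions q, y^a and
y^α are the other three families (`necessaryConditions_iff_eulerLagrange`). The equivalence with
stationarity follows from the first variation formula and du Bois-Reymond's lemma
(`eulerLagrange_iff_isStationary`). -/

noncomputable section

namespace NonholonomicControl

/-! ### Superposition operators on spaces of continuous curves -/

section Superposition

open Filter Topology Metric

variable {V W : Type*} [NormedAddCommGroup V] [NormedSpace ℝ V]
  [NormedAddCommGroup W] [NormedSpace ℝ W]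

/-- A function smooth on an open set agrees, near a given compact subset, with a function smooth
on the whole space. -/
theorem exists_contDiff_eq_on_thickening [FiniteDimensional ℝ V] {Ω K : Set V} (hΩ : IsOpen Ω)
    (hK : IsCompact K) (hKΩ : K ⊆ Ω) {g : V → W} (hg : ContDiffOn ℝ ∞ g Ω) :
    ∃ g' : V → W, ContDiff ℝ ∞ g' ∧ ∃ ε > 0, thickening ε K ⊆ Ω ∧
      ∀ x ∈ thickening ε K, g' x = g x := by
  -- The cutoff vanishes on a whole neighbourhood of the complement of `Ω`, so `χ • g` is smooth
  -- there however `g` behaves outside `Ω`.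
  obtain ⟨χ, h0, h1, -⟩ := exists_contMDiffMap_zero_one_nhds_of_isClosed 𝓘(ℝ, V) (n := ⊤)
    hΩ.isClosed_compl hK.isClosed (disjoint_compl_left_iff_subset.mpr hKΩ)
  have hχ : ContDiff ℝ ∞ χ := χ.contMDiff.contDiff
  refine ⟨fun x => χ x • g x, contDiff_iff_contDiffAt.mpr fun x => ?_, ?_⟩
  · by_cases hx : x ∈ Ω
    · exact hχ.contDiffAt.smul (hg.contDiffAt (hΩ.mem_nhds hx))
    · have : (fun x => χ x • g x) =ᶠ[𝓝 x] fun _ => 0 := by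
        filter_upwards [h0.filter_mono (nhds_le_nhdsSet (show x ∈ Ωᶜ from hx))] with y hy
        simp [hy]
      exact contDiffAt_const.congr_of_eventuallyEq this
  · obtain ⟨O, hO, hKO, hO1⟩ := eventually_nhdsSet_iff_exists.mp h1
    obtain ⟨ε, hε, hsub⟩ := hK.exists_thickening_subset_open (hO.inter hΩ)
      (subset_inter hKO hKΩ)
    exact ⟨ε, hε, hsub.trans inter_subset_right, fun x hx => by simp [hO1 x (hsub hx).1]⟩

variable {K : Type*} [TopologicalSpace K] [CompactSpace K]

/-- The continuous linear map `h ↦ (t ↦ A t (h t))` on spaces of continuous functions. -/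
def pointwiseCLM (A : C(K, V →L[ℝ] W)) : C(K, V) →L[ℝ] C(K, W) :=
  LinearMap.mkContinuous
    { toFun := fun h => ⟨fun t => A t (h t), A.continuous.clm_apply h.continuous⟩
      map_add' := fun h h' => by ext t; simp
      map_smul' := fun c h => by ext t; simp } ‖A‖ fun h => by
    refine (ContinuousMap.norm_le _ (by positivity)).mpr fun t => ?_
    exact (A t).le_of_opNorm_le_of_le (A.norm_coe_le_norm t) (h.norm_coe_le_norm t)

@[simp] theorem pointwiseCLM_apply (A : C(K, V →L[ℝ] W)) (h : C(K, V)) (t : K) :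
    pointwiseCLM A h t = A t (h t) := rfl

/-- The superposition operator `c ↦ g ∘ c` of a `C^1` map is strictly differentiable for the
uniform norm. -/
theorem hasStrictFDerivAt_superposition {g : V → W} (hg : ContDiff ℝ 1 g) (c : C(K, V)) :
    HasStrictFDerivAt (fun c : C(K, V) => (⟨g, hg.continuous⟩ : C(V, W)).comp c)
      (pointwiseCLM ⟨fun t => fderiv ℝ g (c t),
        (hg.continuous_fderiv one_ne_zero).comp c.continuous⟩) c := by
  rw [hasStrictFDerivAt_iff_isLittleO, Asymptotics.isLittleO_iff]
  intro ε hε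
  -- Only one of the two compared points need lie in the compact range of `c`, so a single `δ`
  -- serves for all times and for all curves uniformly near `c`.
  have hunif := (isCompact_range c.continuous).uniformContinuousAt_of_continuousAt (fderiv ℝ g)
    (fun v _ => (hg.continuous_fderiv one_ne_zero).continuousAt) (dist_mem_uniformity hε)
  obtain ⟨δ, hδ, H⟩ := mem_uniformity_dist.mp hunif
  have hev : ∀ᶠ p : C(K, V) × C(K, V) in 𝓝 (c, c), dist p.1 c < δ ∧ dist p.2 c < δ := by
    rw [nhds_prod_eq]
    exact prod_mem_prod (ball_mem_nhds c hδ) (ball_mem_nhds c hδ)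
  filter_upwards [hev] with p hp
  refine (ContinuousMap.norm_le _ (by positivity)).mpr fun t => ?_
  have hball : ∀ v ∈ ball (c t) δ, ‖fderiv ℝ g v - fderiv ℝ g (c t)‖ ≤ ε := fun v hv => by
    have := @H (c t) v (by rwa [dist_comm]) (mem_range_self t)
    rw [← dist_eq_norm, dist_comm]
    exact le_of_lt this
  -- Mean value inequality for `g` minus its linearisation at `c t`, applied at each time
  -- separately; the bound does not depend on `t`.
  have key := (convex_ball (c t) δ).norm_image_sub_le_of_norm_hasFDerivWithin_le'
    (fun v _ => ((hg.differentiable one_ne_zero) v).hasFDerivAt.hasFDerivWithinAt) hball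
    (x := p.2 t) (y := p.1 t) ((ContinuousMap.dist_apply_le_dist t).trans_lt hp.2)
    ((ContinuousMap.dist_apply_le_dist t).trans_lt hp.1)
  refine key.trans ?_
  gcongr
  exact (p.1 - p.2).norm_coe_le_norm t

end Superposition

/-! ### Volterra operators and linear differential equations -/

section Volterra

open Filter Topology MeasureTheory intervalIntegral

variable {V W : Type*} [NormedAddCommGroup V] [NormedSpace ℝ V] [CompleteSpace V] {T : ℝ}

theorem hasDerivAt_integral_IccExtend (hT : 0 ≤ T) (h : C(Icc (0 : ℝ) T, V)) (t : ℝ) :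
    HasDerivAt (fun t => ∫ s in (0 : ℝ)..t, IccExtend hT h s) (IccExtend hT h t) t :=
  integral_hasDerivAt_right (h.continuous.Icc_extend'.intervalIntegrable _ _)
    (h.continuous.Icc_extend'.stronglyMeasurableAtFilter _ _) h.continuous.Icc_extend'.continuousAt

theorem norm_IccExtend_le {V : Type*} [NormedAddCommGroup V] {T : ℝ} (hT : 0 ≤ T)
    (h : C(Icc (0 : ℝ) T, V)) (t : ℝ) :
    ‖IccExtend hT h t‖ ≤ ‖h‖ := h.norm_coe_le_norm _

/-- The integration operator `h ↦ (t ↦ ∫₀ᵗ h)` on continuous functions. -/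
def primitiveCLM (hT : 0 ≤ T) : C(Icc (0 : ℝ) T, V) →L[ℝ] C(Icc (0 : ℝ) T, V) :=
  LinearMap.mkContinuous
    { toFun := fun h => ⟨fun t => ∫ s in (0 : ℝ)..t, IccExtend hT h s,
        (continuous_iff_continuousAt.mpr fun t =>
          (hasDerivAt_integral_IccExtend hT h t).continuousAt).comp continuous_subtype_val⟩
      map_add' := fun h h' => by
        ext t
        simpa [IccExtend] using integral_add (h.continuous.Icc_extend'.intervalIntegrable 0 t)
          (h'.continuous.Icc_extend'.intervalIntegrable 0 t)
      map_smul' := fun c h => by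
        ext t
        simp [IccExtend] } T fun h => by
    refine (ContinuousMap.norm_le _ (by positivity)).mpr fun t => ?_
    have := norm_integral_le_of_norm_le_const (a := 0) (b := t) (f := IccExtend hT h)
      (fun s _ => norm_IccExtend_le hT h s)
    refine this.trans ?_
    rw [sub_zero, abs_of_nonneg t.2.1, mul_comm]
    exact mul_le_mul_of_nonneg_right t.2.2 (norm_nonneg _)

/-- A Volterra operator is quasinilpotent, so that subtracting it from the identity leaves an
invertible operator. -/
theorem isUnit_one_sub_volterra (hT : 0 ≤ T) (A : C(Icc (0 : ℝ) T, V →L[ℝ] V)) :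
    IsUnit (1 - primitiveCLM hT ∘L pointwiseCLM A) := by
  set B := primitiveCLM hT ∘L pointwiseCLM A with hB
  -- Each iteration integrates the previous power of `t` once more, which produces the factorial.
  -- The induction has to keep the dependence on `t`, since the sup norm alone would give only a
  -- geometric bound.
  have hbound : ∀ (j : ℕ) (h : C(Icc (0 : ℝ) T, V)) (t : Icc (0 : ℝ) T),
      ‖(B ^ j) h t‖ ≤ ‖A‖ ^ j * (t : ℝ) ^ j / j.factorial * ‖h‖ := by
    intro j
    induction j with
    | zero => intro h t; simpa using h.norm_coe_le_norm t
    | succ j ih =>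
      intro h t
      rw [pow_succ' B j]
      change ‖∫ s in (0 : ℝ)..t, IccExtend hT (pointwiseCLM A ((B ^ j) h)) s‖ ≤ _
      have hle : ∀ s ∈ Ioc (0 : ℝ) t, ‖IccExtend hT (pointwiseCLM A ((B ^ j) h)) s‖ ≤
          ‖A‖ ^ (j + 1) / j.factorial * ‖h‖ * s ^ j := by
        intro s hs
        have hsT : s ∈ Icc 0 T := ⟨hs.1.le, hs.2.trans t.2.2⟩
        rw [IccExtend_of_mem hT _ hsT, pointwiseCLM_apply]
        refine ((A _).le_of_opNorm_le_of_le (A.norm_coe_le_norm _) (ih h _)).trans_eq ?_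
        simp only
        ring
      refine (norm_integral_le_of_norm_le t.2.1 (ae_of_all _ hle)
        (Continuous.intervalIntegrable (by fun_prop) _ _)).trans_eq ?_
      rw [intervalIntegral.integral_const_mul, integral_pow, Nat.factorial_succ]
      push_cast
      field_simp
      simp
  have hnorm : ∀ j : ℕ, ‖B ^ j‖ ≤ (‖A‖ * T) ^ j / j.factorial := fun j => by
    refine ContinuousLinearMap.opNorm_le_bound _ (by positivity) fun h => ?_
    refine (ContinuousMap.norm_le _ (by positivity)).mpr fun t => (hbound j h t).trans ?_
    rw [mul_pow]
    have := t.2.1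
    have := t.2.2
    gcongr
  obtain ⟨j, hj⟩ := ((FloorSemiring.tendsto_pow_div_factorial_atTop (‖A‖ * T)).eventually
    (gt_mem_nhds zero_lt_one)).exists
  have hu : IsUnit (1 - B ^ j) := isUnit_one_sub_of_norm_lt_one
    (R := C(Icc (0 : ℝ) T, V) →L[ℝ] C(Icc (0 : ℝ) T, V)) ((hnorm j).trans_lt hj)
  -- `1 - B ^ j` is the product of `1 - B` and a geometric sum. The factors commute, so
  -- invertibility of the product passes to each of them.
  have hcomm : Commute (1 - B) (∑ i ∈ Finset.range j, B ^ i) :=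
    (Commute.one_left _).sub_left (Commute.sum_right _ _ _ fun i _ => Commute.self_pow B i)
  rw [← mul_neg_geom_sum, hcomm.isUnit_mul_iff] at hu
  exact hu.1

/-- Global solvability of linear initial value problems. -/
theorem exists_linear_ode_solution (hT : 0 ≤ T) {A : ℝ → V →L[ℝ] V} {b : ℝ → V}
    (hA : ContinuousOn A (Icc 0 T)) (hb : ContinuousOn b (Icc 0 T)) (v₀ : V) :
    ∃ z : ℝ → V, z 0 = v₀ ∧ ∀ t ∈ Icc 0 T,
      HasDerivWithinAt z (A t (z t) + b t) (Icc 0 T) t := by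
  let A' : C(Icc (0 : ℝ) T, V →L[ℝ] V) := ⟨fun t => A t, hA.domRestrict⟩
  let b' : C(Icc (0 : ℝ) T, V) := ⟨fun t => b t, hb.domRestrict⟩
  obtain ⟨w, hw⟩ := (isUnit_one_sub_volterra hT A')
  -- The initial value problem in integral form: `(1 - ∫A) h = v₀ + ∫b`.
  let h : C(Icc (0 : ℝ) T, V) := (↑w⁻¹ : C(Icc (0 : ℝ) T, V) →L[ℝ] C(Icc (0 : ℝ) T, V))
    (ContinuousMap.const _ v₀ + primitiveCLM hT b')
  have hh : h - primitiveCLM hT (pointwiseCLM A' h) =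
      ContinuousMap.const _ v₀ + primitiveCLM hT b' := by
    change (1 - primitiveCLM hT ∘L pointwiseCLM A') h = _
    rw [← hw]
    change ((w : C(Icc (0 : ℝ) T, V) →L[ℝ] C(Icc (0 : ℝ) T, V)) * ↑w⁻¹) _ = _
    simp
  have hh' : h = ContinuousMap.const _ v₀ + primitiveCLM hT (pointwiseCLM A' h + b') := by
    rw [map_add, add_comm (primitiveCLM hT (pointwiseCLM A' h)), ← add_assoc, ← hh,
      sub_add_cancel]
  have hval : ∀ t ∈ Icc 0 T, IccExtend hT h t =
      v₀ + ∫ s in (0 : ℝ)..t, IccExtend hT (pointwiseCLM A' h + b') s := by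
    intro t ht
    rw [IccExtend_of_mem hT _ ht]
    nth_rewrite 1 [hh']
    rfl
  refine ⟨IccExtend hT h, (hval 0 ⟨le_rfl, hT⟩).trans (by rw [integral_same, add_zero]), fun t ht => ?_⟩
  have hd := ((hasDerivAt_integral_IccExtend hT (pointwiseCLM A' h + b') t).const_add
    v₀).hasDerivWithinAt (s := Icc 0 T)
  refine (hd.congr hval (hval t ht)).congr_deriv ?_
  simp only [IccExtend_of_mem hT _ ht]
  rfl

end Volterra

/-! ### The fundamental lemma of the calculus of variations -/

section FundamentalLemma

open Filter Topology MeasureTheory intervalIntegral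

variable {T : ℝ}

/-- The fundamental lemma of the calculus of variations on `[0, T]`. -/
theorem eq_zero_of_integral_contDiff_mul_eq_zero (hT : 0 < T) {g : ℝ → ℝ}
    (hg : ContinuousOn g (Icc 0 T))
    (h : ∀ ψ : ℝ → ℝ, ContDiff ℝ ∞ ψ → ψ 0 = 0 → ψ T = 0 → ∫ t in (0 : ℝ)..T, ψ t * g t = 0) :
    ∀ t ∈ Icc 0 T, g t = 0 := by
  -- Test functions supported in the open interval vanish at both ends and hence are admitted by
  -- `h`. Continuity of `g` then removes the null set and adds the end points.
  have hae : ∀ᵐ t, t ∈ Ioo 0 T → g t = 0 := by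
    refine isOpen_Ioo.ae_eq_zero_of_integral_contDiff_smul_eq_zero
      ((hg.mono Ioo_subset_Icc_self).locallyIntegrableOn measurableSet_Ioo)
      fun ψ hψ _ hsupp => ?_
    have hz : ∀ t, t ∉ Ioo 0 T → ψ t = 0 := fun t ht =>
      image_eq_zero_of_notMem_tsupport fun h => ht (hsupp h)
    rw [← h ψ hψ (hz 0 (by simp)) (hz T (by simp)), integral_of_le hT.le]
    refine (setIntegral_eq_integral_of_forall_compl_eq_zero fun t ht => ?_).symm
    rw [hz t fun h => ht ⟨h.1, h.2.le⟩, zero_smul]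
  have hIoo : EqOn g (fun _ => 0) (Ioo 0 T) := by
    refine Measure.eqOn_Ioo_of_ae_eq (μ := volume) ?_ (hg.mono Ioo_subset_Icc_self)
      continuousOn_const
    rw [EventuallyEq, ae_restrict_iff' measurableSet_Ioo]
    exact hae
  refine hIoo.of_subset_closure hg continuousOn_const Ioo_subset_Icc_self ?_
  rw [closure_Ioo hT.ne]

end FundamentalLemma

/-! ### First variation, du Bois-Reymond's lemma and the Euler-Lagrange equations -/

section EulerLagrange

open Filter Topology MeasureTheory intervalIntegral

variable {T : ℝ}

/-- Integration over `[0, T]` as a continuous linear functional on continuous functions. -/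
def integralCLM (hT : 0 ≤ T) : C(Icc (0 : ℝ) T, ℝ) →L[ℝ] ℝ :=
  ContinuousMap.evalCLM ℝ (⟨T, hT, le_rfl⟩ : Icc (0 : ℝ) T) ∘L primitiveCLM hT

theorem integralCLM_apply (hT : 0 ≤ T) (h : C(Icc (0 : ℝ) T, ℝ)) :
    integralCLM hT h = ∫ s in (0 : ℝ)..T, IccExtend hT h s := rfl

theorem integralCLM_eq (hT : 0 ≤ T) (h : C(Icc (0 : ℝ) T, ℝ)) {g : ℝ → ℝ}
    (hg : ∀ t : Icc (0 : ℝ) T, h t = g t) : integralCLM hT h = ∫ s in (0 : ℝ)..T, g s := by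
  rw [integralCLM_apply]
  refine integral_congr fun t ht => ?_
  rw [uIcc_of_le hT] at ht
  rw [IccExtend_of_mem hT _ ht, hg]

theorem contDiff_integral {η : ℝ → ℝ} (hη : ContDiff ℝ ∞ η) :
    ContDiff ℝ ∞ (fun t => ∫ s in (0 : ℝ)..t, η s) := by
  have hd : ∀ t, HasDerivAt (fun t => ∫ s in (0 : ℝ)..t, η s) (η t) t := fun t =>
    integral_hasDerivAt_right (hη.continuous.intervalIntegrable _ _)
      (hη.continuous.stronglyMeasurableAtFilter _ _) hη.continuous.continuousAt
  refine contDiff_infty_iff_deriv.mpr ⟨fun t => (hd t).differentiableAt, ?_⟩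
  rwa [show deriv (fun t => ∫ s in (0 : ℝ)..t, η s) = η from funext fun t => (hd t).deriv]

/-- The fundamental theorem of calculus for functions differentiable within `[0, T]`. -/
theorem integral_eq_sub_of_hasDerivWithinAt_Icc (hT : 0 ≤ T) {g g' : ℝ → ℝ}
    (hg : ∀ t ∈ Icc 0 T, HasDerivWithinAt g (g' t) (Icc 0 T) t)
    (hg' : ContinuousOn g' (Icc 0 T)) : ∫ t in (0 : ℝ)..T, g' t = g T - g 0 :=
  integral_eq_sub_of_hasDerivAt_of_le hT (fun t ht => (hg t ht).continuousWithinAt)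
    (fun t ht => (hg t (Ioo_subset_Icc_self ht)).hasDerivAt (Icc_mem_nhds ht.1 ht.2))
    ((uIcc_of_le hT ▸ hg').intervalIntegrable)

/-- The lemma of du Bois-Reymond. -/
theorem hasDerivWithinAt_of_integral_eq_zero (hT : 0 < T) {p ρ : ℝ → ℝ}
    (hp : ContinuousOn p (Icc 0 T)) (hρ : ContinuousOn ρ (Icc 0 T))
    (h : ∀ ψ : ℝ → ℝ, ContDiff ℝ ∞ ψ → ψ 0 = 0 → ψ T = 0 →
      ∫ t in (0 : ℝ)..T, (ψ t * ρ t + deriv ψ t * p t) = 0) :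
    ∀ t ∈ Icc 0 T, HasDerivWithinAt p (ρ t) (Icc 0 T) t := by
  let ρ' : C(Icc (0 : ℝ) T, ℝ) := ⟨fun t => ρ t, hρ.domRestrict⟩
  set I : ℝ → ℝ := fun t => ∫ s in (0 : ℝ)..t, IccExtend hT.le ρ' s with hI
  have hId : ∀ t ∈ Icc 0 T, HasDerivWithinAt I (ρ t) (Icc 0 T) t := fun t ht => by
    have := (hasDerivAt_integral_IccExtend hT.le ρ' t).hasDerivWithinAt (s := Icc 0 T)
    rwa [IccExtend_of_mem hT.le _ ht] at this
  have hIc : ContinuousOn I (Icc 0 T) := fun t ht => (hId t ht).continuousWithinAt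
  -- With `I` a primitive of `ρ`, the claim is that `q = p - I` is constant. The constant can only
  -- be its mean `m`.
  set q : ℝ → ℝ := fun t => p t - I t with hq
  have hqc : ContinuousOn q (Icc 0 T) := hp.sub hIc
  have ii : ∀ {g : ℝ → ℝ}, ContinuousOn g (Icc 0 T) → IntervalIntegrable g volume 0 T :=
    fun hg => (uIcc_of_le hT.le ▸ hg).intervalIntegrable
  set m := (∫ t in (0 : ℝ)..T, q t) / T with hm
  have hz := eq_zero_of_integral_contDiff_mul_eq_zero hT (g := fun t => q t - m)
    (hqc.sub continuousOn_const) fun φ hφ _ _ => by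
      set mφ := (∫ t in (0 : ℝ)..T, φ t) / T with hmφ
      -- Subtracting the mean of `φ` makes its primitive vanish at `T` as well, so `ψ` is an
      -- admissible variation for an arbitrary smooth `φ`.
      set ψ : ℝ → ℝ := fun t => ∫ s in (0 : ℝ)..t, (φ s - mφ) with hψ
      have hη : ContDiff ℝ ∞ fun s => φ s - mφ := hφ.sub contDiff_const
      have hψs : ContDiff ℝ ∞ ψ := contDiff_integral hη
      have hψd : ∀ t, HasDerivAt ψ (φ t - mφ) t := fun t =>
        integral_hasDerivAt_right (hη.continuous.intervalIntegrable _ _)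
          (hη.continuous.stronglyMeasurableAtFilter _ _) hη.continuous.continuousAt
      have hψ0 : ψ 0 = 0 := by simp [hψ]
      have hψT : ψ T = 0 := by
        simp only [hψ]
        rw [integral_sub (hφ.continuous.intervalIntegrable _ _) (by simp)]
        simp [hmφ]
        field_simp
        simp
      have h1 := h ψ hψs hψ0 hψT
      -- Integration by parts: the integrand is the derivative of `ψ I`, which vanishes at both
      -- ends. It trades the term in `ρ` for one in `I`.
      have h2 : ∫ t in (0 : ℝ)..T, ((φ t - mφ) * I t + ψ t * ρ t) = 0 := by
        rw [integral_eq_sub_of_hasDerivWithinAt_Icc hT.le (g := fun t => ψ t * I t)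
          (fun t ht => (hψd t).hasDerivWithinAt.mul (hId t ht))
          (((hη.continuous.continuousOn).mul hIc).add (hψs.continuous.continuousOn.mul hρ))]
        simp [hψ0, hψT]
      have h3 : ∫ t in (0 : ℝ)..T, (φ t - mφ) * q t = 0 := by
        have hc1 : ContinuousOn (fun t => ψ t * ρ t + deriv ψ t * p t) (Icc 0 T) := by
          rw [show deriv ψ = fun t => φ t - mφ from funext fun t => (hψd t).deriv]
          exact (hψs.continuous.continuousOn.mul hρ).add (hη.continuous.continuousOn.mul hp)
        have hc2 : ContinuousOn (fun t => (φ t - mφ) * I t + ψ t * ρ t) (Icc 0 T) :=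
          (hη.continuous.continuousOn.mul hIc).add (hψs.continuous.continuousOn.mul hρ)
        have hsub := intervalIntegral.integral_sub (ii hc1) (ii hc2)
        rw [h1, h2, sub_zero] at hsub
        refine Eq.trans (integral_congr fun t _ => ?_) hsub
        simp only [(hψd t).deriv, hq]
        ring
      have e1 : ∫ t in (0 : ℝ)..T, φ t * q t = mφ * ∫ t in (0 : ℝ)..T, q t := by
        have : ∫ t in (0 : ℝ)..T, (φ t - mφ) * q t
            = (∫ t in (0 : ℝ)..T, φ t * q t) - mφ * ∫ t in (0 : ℝ)..T, q t := by
          simp only [sub_mul]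
          rw [intervalIntegral.integral_sub (f := fun t => φ t * q t) (g := fun t => mφ * q t)
            (ii (hφ.continuous.continuousOn.mul hqc))
            (ii (continuousOn_const.mul hqc)), intervalIntegral.integral_const_mul]
        linarith
      simp only [mul_sub]
      rw [intervalIntegral.integral_sub (f := fun t => φ t * q t) (g := fun t => φ t * m)
        (ii (hφ.continuous.continuousOn.mul hqc)) (ii (hφ.continuous.continuousOn.mul continuousOn_const)),
        intervalIntegral.integral_mul_const, e1, hm, hmφ]
      ring
  intro t ht
  have hpe : ∀ t ∈ Icc 0 T, p t = m + I t := fun t ht => by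
    have := hz t ht
    simp only [hq] at this
    linarith
  exact ((hId t ht).const_add m).congr hpe (hpe t ht)

variable {W : Type*} [NormedAddCommGroup W] [NormedSpace ℝ W] [FiniteDimensional ℝ W]

/-- Differentiability of a curve of functionals can be checked on a basis. -/
theorem hasDerivWithinAt_functional_of_basis {ι : Type*} [Fintype ι] (b : Module.Basis ι ℝ W)
    {P : ℝ → W →L[ℝ] ℝ} {P' : W →L[ℝ] ℝ} {s : Set ℝ} {t : ℝ}
    (h : ∀ i, HasDerivWithinAt (fun t => P t (b i)) (P' (b i)) s t) :
    HasDerivWithinAt P P' s t := by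
  have hrepr : ∀ φ : W →L[ℝ] ℝ, φ = ∑ i, φ (b i) • LinearMap.toContinuousLinearMap (b.coord i) :=
    fun φ => by
      ext w
      conv_lhs => rw [← b.sum_repr w, map_sum]
      simp [-Module.Basis.sum_repr, mul_comm]
  rw [hrepr P', show P = fun t => ∑ i, P t (b i) • LinearMap.toContinuousLinearMap (b.coord i)
    from funext fun t => hrepr (P t)]
  exact HasDerivWithinAt.fun_sum fun i _ => 
    HasDerivWithinAt.smul_const (F := W →L[ℝ] ℝ) (h i) _

theorem fderiv_curry_left {X Y W : Type*} [NormedAddCommGroup X] [NormedSpace ℝ X]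
    [NormedAddCommGroup Y] [NormedSpace ℝ Y] [NormedAddCommGroup W] [NormedSpace ℝ W]
    {g : X × Y → W} {a : X} {b : Y} (hg : DifferentiableAt ℝ g (a, b)) :
    fderiv ℝ (fun z => g (z, b)) a = fderiv ℝ g (a, b) ∘L ContinuousLinearMap.inl ℝ X Y :=
  (hg.hasFDerivAt.comp a (hasFDerivAt_prodMk_left a b)).fderiv

theorem fderiv_curry_right {X Y W : Type*} [NormedAddCommGroup X] [NormedSpace ℝ X]
    [NormedAddCommGroup Y] [NormedSpace ℝ Y] [NormedAddCommGroup W] [NormedSpace ℝ W]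
    {g : X × Y → W} {a : X} {b : Y} (hg : DifferentiableAt ℝ g (a, b)) :
    fderiv ℝ (fun z => g (a, z)) b = fderiv ℝ g (a, b) ∘L ContinuousLinearMap.inr ℝ X Y :=
  (hg.hasFDerivAt.comp b (hasFDerivAt_prodMk_right a b)).fderiv

variable {Λ : W → W → ℝ} {Ω : Set (W × W)} {w : ℝ → W}

/-- The first variation of the action. -/
theorem hasDerivAt_action (hT : 0 < T) (hΩ : IsOpen Ω)
    (hΛ : ContDiffOn ℝ ∞ (fun p : W × W => Λ p.1 p.2) Ω) (hw : ContDiffOn ℝ 1 w (Icc 0 T))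
    (hmem : ∀ t ∈ Icc 0 T, (w t, derivWithin w (Icc 0 T) t) ∈ Ω) {δ : ℝ → W}
    (hδ : ContDiff ℝ ∞ δ) :
    HasDerivAt (fun s : ℝ => ∫ t in (0 : ℝ)..T,
      Λ (w t + s • δ t) (derivWithin (fun τ => w τ + s • δ τ) (Icc 0 T) t))
      (∫ t in (0 : ℝ)..T, fderiv ℝ (fun p : W × W => Λ p.1 p.2)
        (w t, derivWithin w (Icc 0 T) t) (δ t, deriv δ t)) 0 := by
  have hUD := uniqueDiffOn_Icc hT
  have hw' : ContinuousOn (fun t => derivWithin w (Icc 0 T) t) (Icc 0 T) :=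
    hw.continuousOn_derivWithin hUD le_rfl
  have hδ' : Continuous (deriv δ) := hδ.continuous_deriv (by simp)
  let c : C(Icc (0 : ℝ) T, W × W) :=
    ⟨fun t => (w t, derivWithin w (Icc 0 T) t), (hw.continuousOn.prodMk hw').domRestrict⟩
  let η : C(Icc (0 : ℝ) T, W × W) :=
    ⟨fun t => (δ t, deriv δ t), (hδ.continuous.prodMk hδ').comp continuous_subtype_val⟩
  -- `Λ` is smooth only on `Ω`, while the superposition operator needs a globally defined integrand.
  -- The curve has compact range, so `Λ` may be replaced by a global smooth function near it.
  obtain ⟨g, hg, ε, hε, hsub, hgeq⟩ := exists_contDiff_eq_on_thickening hΩ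
    (isCompact_range c.continuous) (by rintro _ ⟨t, rfl⟩; exact hmem t t.2) hΛ
  have hg1 : ContDiff ℝ 1 g := hg.of_le (by simp)
  have hline : HasDerivAt (fun s : ℝ => c + s • η) η 0 := by
    simpa using ((hasDerivAt_id (0 : ℝ)).smul_const η).const_add c
  have hsup := (hasStrictFDerivAt_superposition hg1 c).hasFDerivAt
  rw [show c = c + (0 : ℝ) • η by simp] at hsup
  have hd := (integralCLM hT.le).hasFDerivAt.comp_hasDerivAt (0 : ℝ)
    (HasFDerivAt.comp_hasDerivAt (0 : ℝ) hsup hline)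
  have hval : ∀ t ∈ Icc 0 T, fderiv ℝ (fun p : W × W => Λ p.1 p.2)
      (w t, derivWithin w (Icc 0 T) t) = fderiv ℝ g (w t, derivWithin w (Icc 0 T) t) := by
    intro t ht
    refine (EventuallyEq.fderiv_eq ?_).symm
    filter_upwards [Metric.isOpen_thickening.mem_nhds
      (Metric.self_subset_thickening hε _ (mem_range_self (f := c) ⟨t, ht⟩))] with p hp
    exact hgeq p hp
  refine (hd.congr_of_eventuallyEq ?_).congr_deriv ?_
  -- For small `s` the varied curve, with its velocity, stays where `g` and `Λ` agree. A derivative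
  -- at `s = 0` sees nothing else.
  · have hev : ∀ᶠ s : ℝ in 𝓝 0, ‖s • η‖ < ε := by
      have : Tendsto (fun s : ℝ => ‖s • η‖) (𝓝 0) (𝓝 ‖(0 : ℝ) • η‖) :=
        Continuous.tendsto (by fun_prop) 0
      exact this.eventually (gt_mem_nhds (by simpa using hε))
    filter_upwards [hev] with s hs
    refine (integralCLM_eq hT.le _ fun t => ?_).symm
    have hdw : derivWithin (fun τ => w τ + s • δ τ) (Icc 0 T) t
        = derivWithin w (Icc 0 T) t + s • deriv δ t := by
      have h1 := ((hw.differentiableOn one_ne_zero) t t.2).hasDerivWithinAt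
      have h2 := ((hδ.differentiable (by simp)) (t : ℝ)).hasDerivAt.hasDerivWithinAt
        (s := Icc 0 T)
      exact (h1.add (h2.const_smul s)).derivWithin (hUD t t.2)
    rw [hdw]
    change g ((c + s • η) t) = _
    rw [hgeq]
    · rfl
    · refine Metric.mem_thickening_iff.mpr ⟨c t, mem_range_self t, ?_⟩
      rw [dist_eq_norm]
      simpa using ((s • η).norm_coe_le_norm t).trans_lt hs
  · refine integralCLM_eq hT.le _ fun t => ?_
    rw [hval t t.2]
    change fderiv ℝ g ((c + (0 : ℝ) • η) t) (δ t, deriv δ t) = _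
    rw [zero_smul, add_zero]
    rfl

/-- For a smooth Lagrangian and a `C^1` curve, the Euler-Lagrange equations express the
stationarity of the action. -/
theorem eulerLagrange_iff_isStationary (hT : 0 < T) (hΩ : IsOpen Ω)
    (hΛ : ContDiffOn ℝ ∞ (fun p : W × W => Λ p.1 p.2) Ω) (hw : ContDiffOn ℝ 1 w (Icc 0 T))
    (hmem : ∀ t ∈ Icc 0 T, (w t, derivWithin w (Icc 0 T) t) ∈ Ω) :
    EulerLagrange Λ T w ↔ IsStationary Λ T w := by
  set D : ℝ → W × W →L[ℝ] ℝ := fun t =>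
    fderiv ℝ (fun p : W × W => Λ p.1 p.2) (w t, derivWithin w (Icc 0 T) t) with hD
  have hdiff : ∀ t ∈ Icc 0 T, DifferentiableAt ℝ (fun p : W × W => Λ p.1 p.2)
      (w t, derivWithin w (Icc 0 T) t) := fun t ht =>
    (hΛ.contDiffAt (hΩ.mem_nhds (hmem t ht))).differentiableAt (by simp)
  have hDc : ContinuousOn D (Icc 0 T) :=
    (hΛ.continuousOn_fderiv_of_isOpen hΩ (by simp)).comp
      (hw.continuousOn.prodMk (hw.continuousOn_derivWithin (uniqueDiffOn_Icc hT) le_rfl)) hmem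
  have hEL : EulerLagrange Λ T w ↔ ∀ t ∈ Icc 0 T, HasDerivWithinAt
      (fun s => D s ∘L ContinuousLinearMap.inr ℝ W W) (D t ∘L ContinuousLinearMap.inl ℝ W W)
      (Icc 0 T) t := by
    refine forall₂_congr fun t ht => ?_
    rw [fderiv_curry_left (g := fun p : W × W => Λ p.1 p.2) (hdiff t ht)]
    have : ∀ s ∈ Icc 0 T, fderiv ℝ (fun v => Λ (w s) v) (derivWithin w (Icc 0 T) s)
        = D s ∘L ContinuousLinearMap.inr ℝ W W := fun s hs =>
      fderiv_curry_right (g := fun p : W × W => Λ p.1 p.2) (hdiff s hs)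
    exact ⟨fun h => h.congr (fun s hs => (this s hs).symm) (this t ht).symm,
      fun h => h.congr this (this t ht)⟩
  have hS : IsStationary Λ T w ↔ ∀ δ : ℝ → W, ContDiff ℝ ∞ δ → δ 0 = 0 → δ T = 0 →
      ∫ t in (0 : ℝ)..T, D t (δ t, deriv δ t) = 0 := by
    refine forall₂_congr fun δ hδ => forall₂_congr fun _ _ => ?_
    have := hasDerivAt_action hT hΩ hΛ hw hmem hδ
    exact ⟨fun h => this.unique h, fun h => this.congr_deriv h⟩
  rw [hEL, hS]
  constructor
  · intro h δ hδ h0 h1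
    have hδ' : Continuous (deriv δ) := hδ.continuous_deriv (by simp)
    -- By the Euler-Lagrange equations the integrand of the first variation is the derivative of the
    -- momentum paired with `δ`.
    rw [integral_eq_sub_of_hasDerivWithinAt_Icc hT.le (g := fun t => D t (0, δ t))]
    · simp only [h0, h1, Prod.mk_zero_zero, map_zero, sub_zero]
    · intro t ht
      have := (h t ht).clm_apply
        ((hδ.differentiable (by simp)) t).hasDerivAt.hasDerivWithinAt
      refine this.congr_deriv ?_
      simp only [ContinuousLinearMap.comp_apply, ContinuousLinearMap.inl_apply,
        ContinuousLinearMap.inr_apply]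
      rw [← map_add]
      simp
    · exact hDc.clm_apply (hδ.continuous.prodMk hδ').continuousOn
  · intro h t ht
    refine hasDerivWithinAt_functional_of_basis (Module.finBasis ℝ W) fun i => ?_
    set e := Module.finBasis ℝ W i
    -- Variations `ψ • e` in a fixed direction reduce to the scalar lemma. It also supplies the
    -- differentiability of the momentum, which a `C^1` curve does not provide by itself.
    refine hasDerivWithinAt_of_integral_eq_zero hT (p := fun t => D t (0, e))
      (ρ := fun t => D t (e, 0)) (hDc.clm_apply continuousOn_const)
      (hDc.clm_apply continuousOn_const) (fun ψ hψ h0 h1 => ?_) t ht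
    refine Eq.trans ?_ (h (fun t => ψ t • e) (hψ.smul contDiff_const) (by simp [h0])
      (by simp [h1]))
    refine integral_congr fun t _ => ?_
    have hd : deriv (fun t => ψ t • e) t = deriv ψ t • e :=
      (((hψ.differentiable (by simp)) t).hasDerivAt.smul_const e).deriv
    simp only [hd]
    rw [show (ψ t • e, deriv ψ t • e) = ψ t • (e, (0 : W)) + deriv ψ t • ((0 : W), e) by simp,
      map_add, map_smul, map_smul, smul_eq_mul, smul_eq_mul]

end EulerLagrange

/-! ### Multipliers for optimal control problems with fixed end points -/

section MaximumPrinciple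

open Filter Topology MeasureTheory intervalIntegral

variable {T : ℝ} {Z U : Type*} [NormedAddCommGroup Z] [NormedSpace ℝ Z] [FiniteDimensional ℝ Z]
  [NormedAddCommGroup U] [NormedSpace ℝ U]

/-- The inclusion of state curves into curves of pairs (state, control). -/
def stateInclusion (T : ℝ) (Z U : Type*) [NormedAddCommGroup Z] [NormedSpace ℝ Z]
    [NormedAddCommGroup U] [NormedSpace ℝ U] :
    C(Icc (0 : ℝ) T, Z) →L[ℝ] C(Icc (0 : ℝ) T, Z × U) :=
  pointwiseCLM (ContinuousMap.const _ (ContinuousLinearMap.inl ℝ Z U))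

/-- The inclusion of control curves into curves of pairs (state, control). -/
def controlInclusion (T : ℝ) (Z U : Type*) [NormedAddCommGroup Z] [NormedSpace ℝ Z]
    [NormedAddCommGroup U] [NormedSpace ℝ U] :
    C(Icc (0 : ℝ) T, U) →L[ℝ] C(Icc (0 : ℝ) T, Z × U) :=
  pointwiseCLM (ContinuousMap.const _ (ContinuousLinearMap.inr ℝ Z U))

theorem stateInclusion_add_controlInclusion_apply {T : ℝ} {Z U : Type*} [NormedAddCommGroup Z]
    [NormedSpace ℝ Z] [NormedAddCommGroup U] [NormedSpace ℝ U] (z : C(Icc (0 : ℝ) T, Z))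
    (u : C(Icc (0 : ℝ) T, U)) (t : Icc (0 : ℝ) T) :
    (stateInclusion T Z U z + controlInclusion T Z U u) t = (z t, u t) := by
  simp [stateInclusion, controlInclusion]

/-- The linearised control system is uniquely solvable: every control variation `v` has a
response `h` with `h = ∫ A (h, v)`. -/
theorem exists_response (hT : 0 ≤ T) (A : C(Icc (0 : ℝ) T, Z × U →L[ℝ] Z)) :
    ∃ (R : C(Icc (0 : ℝ) T, U) →L[ℝ] C(Icc (0 : ℝ) T, Z)),
      (∀ v, R v = primitiveCLM hT (pointwiseCLM A
        (stateInclusion T Z U (R v) + controlInclusion T Z U v))) ∧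
      ∀ g, ∃ h, h - primitiveCLM hT (pointwiseCLM A (stateInclusion T Z U h)) = g := by
  let A₁ : C(Icc (0 : ℝ) T, Z →L[ℝ] Z) :=
    ⟨fun t => A t ∘L ContinuousLinearMap.inl ℝ Z U, A.continuous.clm_comp continuous_const⟩
  obtain ⟨w, hw⟩ := isUnit_one_sub_volterra hT A₁
  have hinv : ∀ g : C(Icc (0 : ℝ) T, Z),
      (↑w⁻¹ : C(Icc (0 : ℝ) T, Z) →L[ℝ] C(Icc (0 : ℝ) T, Z)) g -
        primitiveCLM hT (pointwiseCLM A (stateInclusion T Z U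
          ((↑w⁻¹ : C(Icc (0 : ℝ) T, Z) →L[ℝ] C(Icc (0 : ℝ) T, Z)) g))) = g := by
    intro g
    change (1 - primitiveCLM hT ∘L pointwiseCLM A₁) _ = g
    rw [← hw]
    change ((w : C(Icc (0 : ℝ) T, Z) →L[ℝ] C(Icc (0 : ℝ) T, Z)) * ↑w⁻¹) g = g
    simp
  -- The response to `v` solves `(1 - ∫A₁) h = ∫A(0, v)`, where `A₁` is the state part of `A`.
  refine ⟨(↑w⁻¹ : C(Icc (0 : ℝ) T, Z) →L[ℝ] C(Icc (0 : ℝ) T, Z)) ∘L primitiveCLM hT ∘L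
    pointwiseCLM A ∘L controlInclusion T Z U, fun v => ?_, fun g => ⟨_, hinv g⟩⟩
  have := hinv (primitiveCLM hT (pointwiseCLM A (controlInclusion T Z U v)))
  rw [map_add, map_add, ← sub_eq_iff_eq_add']
  exact this

/-- If the linearised end point and cost map is onto already on a space `M` of control variations,
then nearby solutions with the same end points, with controls varied within `M`, realise all
nearby costs. -/
theorem eventually_exists_solution_cost_eq (hT : 0 ≤ T) {f : Z × U → Z} {ℓ : Z × U → ℝ}
    (hf : ContDiff ℝ 1 f) (hℓ : ContDiff ℝ 1 ℓ) (z : C(Icc (0 : ℝ) T, Z))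
    (u : C(Icc (0 : ℝ) T, U)) (z₀ : Z)
    (hz : z = ContinuousMap.const _ z₀ + primitiveCLM hT
      ((⟨f, hf.continuous⟩ : C(Z × U, Z)).comp
        (stateInclusion T Z U z + controlInclusion T Z U u)))
    (R : C(Icc (0 : ℝ) T, U) →L[ℝ] C(Icc (0 : ℝ) T, Z))
    (A : C(Icc (0 : ℝ) T, Z × U →L[ℝ] Z)) (hA : ∀ t, A t = fderiv ℝ f (z t, u t))
    (a : C(Icc (0 : ℝ) T, Z × U →L[ℝ] ℝ)) (ha : ∀ t, a t = fderiv ℝ ℓ (z t, u t))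
    (hR : ∀ v, R v = primitiveCLM hT (pointwiseCLM A
      (stateInclusion T Z U (R v) + controlInclusion T Z U v)))
    (hsolve : ∀ g, ∃ h, h - primitiveCLM hT (pointwiseCLM A (stateInclusion T Z U h)) = g)
    (M : Submodule ℝ C(Icc (0 : ℝ) T, U))
    (hM : ∀ k : Z × ℝ, ∃ v ∈ M, (R v ⟨T, hT, le_rfl⟩, integralCLM hT (pointwiseCLM a
      (stateInclusion T Z U (R v) + controlInclusion T Z U v))) = k) {ε : ℝ} (hε : 0 < ε) :
    ∀ᶠ j in 𝓝 (integralCLM hT ((⟨ℓ, hℓ.continuous⟩ : C(Z × U, ℝ)).comp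
        (stateInclusion T Z U z + controlInclusion T Z U u))),
      ∃ z' : C(Icc (0 : ℝ) T, Z), ∃ v ∈ M, ‖z' - z‖ < ε ∧ ‖v‖ < ε ∧
        z' = ContinuousMap.const _ z₀ + primitiveCLM hT
          ((⟨f, hf.continuous⟩ : C(Z × U, Z)).comp
            (stateInclusion T Z U z' + controlInclusion T Z U (u + v))) ∧
        z' ⟨T, hT, le_rfl⟩ = z ⟨T, hT, le_rfl⟩ ∧
        integralCLM hT ((⟨ℓ, hℓ.continuous⟩ : C(Z × U, ℝ)).comp
          (stateInclusion T Z U z' + controlInclusion T Z U (u + v))) = j := by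
  -- The open mapping step needs a complete domain, and `M` need not be complete. Since the target
  -- `Z × ℝ` is finite-dimensional, finitely many elements of `M` with images forming a basis
  -- suffice as control directions.
  let b := Module.finBasis ℝ (Z × ℝ)
  choose v hvM hv using fun i => hM (b i)
  let d := Module.finrank ℝ (Z × ℝ)
  let S : (Fin d → ℝ) →L[ℝ] C(Icc (0 : ℝ) T, U) :=
    ∑ i, (ContinuousLinearMap.proj (R := ℝ) (φ := fun _ : Fin d => ℝ) i).smulRight (v i)
  have hS : ∀ σ, S σ = ∑ i, σ i • v i := fun σ => by simp [S]
  have hSM : ∀ σ, S σ ∈ M := fun σ => by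
    rw [hS]
    exact M.sum_mem fun i _ => M.smul_mem _ (hvM i)
  let iZ := stateInclusion T Z U
  let iU := controlInclusion T Z U
  let evT : C(Icc (0 : ℝ) T, Z) →L[ℝ] Z := ContinuousMap.evalCLM ℝ ⟨T, hT, le_rfl⟩
  let G : C(Icc (0 : ℝ) T, Z) × (Fin d → ℝ) → C(Icc (0 : ℝ) T, Z × U) :=
    fun p => iZ p.1 + iU (u + S p.2)
  let G' : C(Icc (0 : ℝ) T, Z) × (Fin d → ℝ) →L[ℝ] C(Icc (0 : ℝ) T, Z × U) :=
    iZ ∘L ContinuousLinearMap.fst ℝ _ _ + iU ∘L S ∘L ContinuousLinearMap.snd ℝ _ _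
  have hG : HasStrictFDerivAt G G' (z, 0) := by
    have : G = fun p => G' p + iU u := by
      funext p
      simp only [G, G', map_add]
      simp only [add_apply, ContinuousLinearMap.comp_apply,
        ContinuousLinearMap.coe_fst', ContinuousLinearMap.coe_snd']
      abel
    rw [this]
    exact G'.hasStrictFDerivAt.add_const _
  have hG0 : G (z, 0) = iZ z + iU u := by simp [G]
  have hG0t : ∀ t, G (z, 0) t = (z t, u t) := fun t => by
    rw [hG0]; exact stateInclusion_add_controlInclusion_apply z u t
  have hF : HasStrictFDerivAt (fun p => (⟨f, hf.continuous⟩ : C(Z × U, Z)).comp (G p))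
      (pointwiseCLM A ∘L G') (z, 0) := by
    have hAG : A = ⟨fun t => fderiv ℝ f (G (z, 0) t),
        (hf.continuous_fderiv one_ne_zero).comp (G (z, 0)).continuous⟩ := by
      ext1 t
      rw [hA t, ← hG0t t]
      rfl
    rw [hAG]
    exact (hasStrictFDerivAt_superposition hf (G (z, 0))).comp (z, 0) hG
  have hL : HasStrictFDerivAt (fun p => (⟨ℓ, hℓ.continuous⟩ : C(Z × U, ℝ)).comp (G p))
      (pointwiseCLM a ∘L G') (z, 0) := by
    have hAG : a = ⟨fun t => fderiv ℝ ℓ (G (z, 0) t),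
        (hℓ.continuous_fderiv one_ne_zero).comp (G (z, 0)).continuous⟩ := by
      ext1 t
      rw [ha t, ← hG0t t]
      rfl
    rw [hAG]
    exact (hasStrictFDerivAt_superposition hℓ (G (z, 0))).comp (z, 0) hG
  -- The first component is the defect in the integral equation and vanishes exactly on trajectories
  -- starting at `z₀`. The other two record the final state and the cost.
  let Θ : C(Icc (0 : ℝ) T, Z) × (Fin d → ℝ) → C(Icc (0 : ℝ) T, Z) × (Z × ℝ) := fun p =>
    (p.1 - ContinuousMap.const _ z₀ -
        primitiveCLM hT ((⟨f, hf.continuous⟩ : C(Z × U, Z)).comp (G p)),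
      (evT p.1, integralCLM hT ((⟨ℓ, hℓ.continuous⟩ : C(Z × U, ℝ)).comp (G p))))
  let Θ' : C(Icc (0 : ℝ) T, Z) × (Fin d → ℝ) →L[ℝ] C(Icc (0 : ℝ) T, Z) × (Z × ℝ) :=
    (ContinuousLinearMap.fst ℝ _ _ - primitiveCLM hT ∘L pointwiseCLM A ∘L G').prod
      ((evT ∘L ContinuousLinearMap.fst ℝ _ _).prod (integralCLM hT ∘L pointwiseCLM a ∘L G'))
  have hΘ : HasStrictFDerivAt Θ Θ' (z, 0) := by
    refine HasStrictFDerivAt.prodMk ?_ (HasStrictFDerivAt.prodMk ?_ ?_)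
    · exact (hasStrictFDerivAt_fst.sub_const _).sub
        ((primitiveCLM hT).hasStrictFDerivAt.comp (z, 0) hF)
    · exact evT.hasStrictFDerivAt.comp (z, 0) hasStrictFDerivAt_fst
    · exact (integralCLM hT).hasStrictFDerivAt.comp (z, 0) hL
  -- A state variation `h` alone attains the prescribed defect `g`. The error left in final state
  -- and cost is then corrected along responses `(R (S σ), σ)`, whose linearised defect is zero.
  have hsurj : Θ'.range = ⊤ := by
    refine LinearMap.range_eq_top.mpr ?_
    rintro ⟨g, k⟩
    obtain ⟨h, hh⟩ := hsolve g
    let k₀ : Z × ℝ := (Θ' (h, 0)).2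
    have h₀ : Θ' (h, 0) = (g, k₀) := by
      refine Prod.ext ?_ rfl
      rw [← hh]
      simp [Θ', G', iZ]
    let σ : Fin d → ℝ := b.repr (k - k₀)
    have hσ : (R (S σ) ⟨T, hT, le_rfl⟩, integralCLM hT (pointwiseCLM a
        (iZ (R (S σ)) + iU (S σ)))) = k - k₀ := by
      let Λ : C(Icc (0 : ℝ) T, U) →L[ℝ] Z × ℝ := (evT ∘L R).prod
        (integralCLM hT ∘L pointwiseCLM a ∘L (iZ ∘L R + iU))
      change Λ (S σ) = _
      rw [hS, map_sum]
      simp only [map_smul]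
      have : ∀ i, Λ (v i) = b i := hv
      simp only [this, σ]
      exact b.sum_repr (k - k₀)
    refine ⟨(h, 0) + (R (S σ), σ), ?_⟩
    change Θ' _ = _
    rw [map_add, h₀]
    have h₁ : Θ' (R (S σ), σ) = (0, k - k₀) := by
      refine Prod.ext ?_ hσ
      exact sub_eq_zero.mpr (hR (S σ))
    rw [h₁]
    simp
  -- Local openness: images of neighbourhoods of `(z, 0)` fill a neighbourhood of the value. Only
  -- points with zero defect, unchanged final state and varying cost are used.
  have hmap := hΘ.map_nhds_eq_of_surj hsurj
  have hΘ0 : Θ (z, 0) = (0, (z ⟨T, hT, le_rfl⟩, integralCLM hT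
      ((⟨ℓ, hℓ.continuous⟩ : C(Z × U, ℝ)).comp (iZ z + iU u)))) := by
    refine Prod.ext ?_ (Prod.ext rfl ?_)
    · simp only [Θ, hG0]
      rw [sub_sub, sub_eq_zero]
      exact hz
    · simp only [Θ, hG0]
  have hnear : ∀ᶠ p : C(Icc (0 : ℝ) T, Z) × (Fin d → ℝ) in 𝓝 (z, 0),
      ‖p.1 - z‖ < ε ∧ ‖S p.2‖ < ε := by
    have h1 : Tendsto (fun p : C(Icc (0 : ℝ) T, Z) × (Fin d → ℝ) => ‖p.1 - z‖) (𝓝 (z, 0))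
        (𝓝 ‖z - z‖) := Continuous.tendsto (by fun_prop) (z, 0)
    have h2 : Tendsto (fun p : C(Icc (0 : ℝ) T, Z) × (Fin d → ℝ) => ‖S p.2‖) (𝓝 (z, 0))
        (𝓝 ‖S 0‖) := Continuous.tendsto (by fun_prop) (z, (0 : Fin d → ℝ))
    exact (h1.eventually (gt_mem_nhds (by simpa using hε))).and
      (h2.eventually (gt_mem_nhds (by simpa using hε)))
  have himg := image_mem_map (m := Θ) hnear
  rw [hmap, hΘ0] at himg
  have hcont : Tendsto (fun j : ℝ => ((0 : C(Icc (0 : ℝ) T, Z)), (z ⟨T, hT, le_rfl⟩, j)))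
      (𝓝 (integralCLM hT ((⟨ℓ, hℓ.continuous⟩ : C(Z × U, ℝ)).comp (iZ z + iU u)))) (𝓝 _) :=
    Continuous.tendsto (by fun_prop) _
  filter_upwards [hcont himg] with j hj
  obtain ⟨⟨z', σ⟩, ⟨hz1, hz2⟩, hΘj⟩ := hj
  have e1 := congrArg Prod.fst hΘj
  have e2 := congrArg (fun p => p.2.1) hΘj
  have e3 := congrArg (fun p => p.2.2) hΘj
  refine ⟨z', S σ, hSM σ, hz1, hz2, ?_, e2, e3⟩
  simp only [Θ] at e1
  rwa [sub_sub, sub_eq_zero] at e1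

/-- If the linearised end point and cost map, restricted to smooth control variations, is
annihilated by `(p, p₀)`, then `p` is the final value of an adjoint curve. -/
theorem exists_adjoint_curve {T : ℝ} {Z U : Type*} [NormedAddCommGroup Z] [NormedSpace ℝ Z]
    [NormedAddCommGroup U] [NormedSpace ℝ U] (hT : 0 < T) {A : ℝ → Z × U →L[ℝ] Z} {a : ℝ → Z × U →L[ℝ] ℝ}
    (hA : ContinuousOn A (Icc 0 T)) (ha : ContinuousOn a (Icc 0 T)) (p : Z →L[ℝ] ℝ) (p₀ : ℝ)
    (h : ∀ v : ℝ → U, ContDiff ℝ ∞ v → ∃ ζ : ℝ → Z, ζ 0 = 0 ∧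
      (∀ t ∈ Icc 0 T, HasDerivWithinAt ζ (A t (ζ t, v t)) (Icc 0 T) t) ∧
      p (ζ T) + p₀ * ∫ t in (0 : ℝ)..T, a t (ζ t, v t) = 0) :
    ∃ ξ : ℝ → Z →L[ℝ] ℝ, ξ T = p ∧
      (∀ t ∈ Icc 0 T, HasDerivWithinAt ξ
        (-((ξ t ∘L A t + p₀ • a t) ∘L ContinuousLinearMap.inl ℝ Z U)) (Icc 0 T) t) ∧
      ∀ t ∈ Icc 0 T, (ξ t ∘L A t + p₀ • a t) ∘L ContinuousLinearMap.inr ℝ Z U = 0 := by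
  -- The adjoint equation carries a final condition at `T`; reversing time turns it into an initial
  -- value problem.
  have hrev : MapsTo (fun t => T - t) (Icc 0 T) (Icc 0 T) := fun t ht =>
    ⟨by linarith [ht.2], by linarith [ht.1]⟩
  have hrevc : ContinuousOn (fun t => T - t) (Icc 0 T) := by fun_prop
  obtain ⟨w, hw0, hw⟩ := exists_linear_ode_solution hT.le
    (A := fun t => (ContinuousLinearMap.compL ℝ Z Z ℝ).flip
      (A (T - t) ∘L ContinuousLinearMap.inl ℝ Z U))
    (b := fun t => p₀ • (a (T - t) ∘L ContinuousLinearMap.inl ℝ Z U))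
    ((ContinuousLinearMap.continuous _).comp_continuousOn
      ((hA.comp hrevc hrev).clm_comp continuousOn_const))
    (((ha.comp hrevc hrev).clm_comp continuousOn_const).const_smul p₀) p
  have hξ : ∀ t ∈ Icc 0 T, HasDerivWithinAt (fun t => w (T - t))
      (-((w (T - t) ∘L A t + p₀ • a t) ∘L ContinuousLinearMap.inl ℝ Z U)) (Icc 0 T) t := by
    intro t ht
    have h1 := (hw (T - t) (hrev ht)).scomp t
      ((hasDerivAt_id t).const_sub T).hasDerivWithinAt hrev
    refine h1.congr_deriv ?_
    ext ζ
    simp [add_comm]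
  have hξc : ContinuousOn (fun t => w (T - t)) (Icc 0 T) :=
    fun t ht => (hξ t ht).continuousWithinAt
  refine ⟨fun t => w (T - t), by simp [hw0], hξ, ?_⟩
  set H : ℝ → Z × U →L[ℝ] ℝ := fun t => w (T - t) ∘L A t + p₀ • a t with hH
  have hHc : ContinuousOn H (Icc 0 T) := (hξc.clm_comp hA).add (ha.const_smul p₀)
  intro t ht
  ext e
  refine eq_zero_of_integral_contDiff_mul_eq_zero hT (g := fun t => H t (0, e))
    (hHc.clm_apply continuousOn_const) (fun ψ hψ _ _ => ?_) t ht
  obtain ⟨ζ, hζ0, hζ, hann⟩ := h (fun t => ψ t • e) (hψ.smul contDiff_const)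
  have hζc : ContinuousOn ζ (Icc 0 T) := fun t ht => (hζ t ht).continuousWithinAt
  have hve : ContinuousOn (fun t => ψ t • e) (Icc 0 T) :=
    (hψ.continuous.smul continuous_const).continuousOn
  have ii : ∀ {g : ℝ → ℝ}, ContinuousOn g (Icc 0 T) → IntervalIntegrable g volume 0 T :=
    fun hg => (uIcc_of_le hT.le ▸ hg).intervalIntegrable
  have hac : ContinuousOn (fun t => a t (ζ t, ψ t • e)) (Icc 0 T) :=
    ha.clm_apply (hζc.prodMk hve)
  have hHe : ContinuousOn (fun t => H t (0, ψ t • e)) (Icc 0 T) :=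
    hHc.clm_apply (continuousOn_const.prodMk hve)
  -- Along a response `ζ` to `v`, the derivative of `ξ(ζ)` is `H(0, v) - p₀ a(ζ, v)`: the state part
  -- of `H` cancels by the adjoint equation. Annihilation by `(p, p₀)` then gives `∫ H(0, v) = 0`.
  have hftc := integral_eq_sub_of_hasDerivWithinAt_Icc hT.le
    (g := fun t => w (T - t) (ζ t))
    (g' := fun t => H t (0, ψ t • e) - p₀ * a t (ζ t, ψ t • e)) (fun t ht => by
      refine ((hξ t ht).clm_apply (hζ t ht)).congr_deriv ?_
      have e1 : H t (ζ t, ψ t • e) = H t (ζ t, 0) + H t (0, ψ t • e) := by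
        rw [← map_add]; simp
      have e2 : H t (ζ t, ψ t • e) =
          w (T - t) (A t (ζ t, ψ t • e)) + p₀ * a t (ζ t, ψ t • e) := rfl
      have e3 : (-(H t ∘L ContinuousLinearMap.inl ℝ Z U)) (ζ t) = - H t (ζ t, 0) := rfl
      change (-(H t ∘L ContinuousLinearMap.inl ℝ Z U)) (ζ t) + _ = _
      rw [e3]
      linarith) (hHe.sub (continuousOn_const.mul hac))
  rw [intervalIntegral.integral_sub (g := fun t => p₀ * a t (ζ t, ψ t • e)) (ii hHe)
    (ii (continuousOn_const.mul hac)),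
    intervalIntegral.integral_const_mul] at hftc
  simp only [sub_self, hw0, hζ0, map_zero, sub_zero] at hftc
  have hgoal : ∫ t in (0 : ℝ)..T, H t (0, ψ t • e) = 0 := by linarith
  refine Eq.trans (integral_congr fun t _ => ?_) hgoal
  rw [show ((0 : Z), ψ t • e) = ψ t • ((0 : Z), e) by simp, map_smul, smul_eq_mul]

/-- Necessary conditions for a smooth optimal control problem with fixed end points, in Lagrange
form: a local extremum (a minimum for `σ > 0`, a maximum for `σ < 0`), with respect to smooth
control variations, has a nontrivial multiplier. -/
theorem exists_multiplier_of_locally_optimal [FiniteDimensional ℝ U] (hT : 0 < T) {Ω : Set (Z × U)} (hΩ : IsOpen Ω)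
    {f : Z × U → Z} {ℓ : Z × U → ℝ} (hf : ContDiffOn ℝ ∞ f Ω) (hℓ : ContDiffOn ℝ ∞ ℓ Ω)
    {z : ℝ → Z} {u : ℝ → U} (hu : ContinuousOn u (Icc 0 T))
    (hmem : ∀ t ∈ Icc 0 T, (z t, u t) ∈ Ω)
    (hz : ∀ t ∈ Icc 0 T, HasDerivWithinAt z (f (z t, u t)) (Icc 0 T) t)
    {σ : ℝ} (hσ : σ ≠ 0) {ε : ℝ} (hε : 0 < ε)
    (hopt : ∀ (z' : ℝ → Z) (v : ℝ → U), ContDiff ℝ ∞ v →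
      (∀ t ∈ Icc 0 T, (z' t, u t + v t) ∈ Ω) →
      (∀ t ∈ Icc 0 T, HasDerivWithinAt z' (f (z' t, u t + v t)) (Icc 0 T) t) →
      z' 0 = z 0 → z' T = z T → (∀ t ∈ Icc 0 T, ‖z' t - z t‖ < ε ∧ ‖v t‖ < ε) →
      σ * ∫ t in (0 : ℝ)..T, ℓ (z t, u t) ≤ σ * ∫ t in (0 : ℝ)..T, ℓ (z' t, u t + v t)) :
    ∃ (p₀ : ℝ) (ξ : ℝ → Z →L[ℝ] ℝ), (p₀ ≠ 0 ∨ ξ T ≠ 0) ∧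
      (∀ t ∈ Icc 0 T, HasDerivWithinAt ξ
        (-((ξ t ∘L fderiv ℝ f (z t, u t) + p₀ • fderiv ℝ ℓ (z t, u t)) ∘L
          ContinuousLinearMap.inl ℝ Z U)) (Icc 0 T) t) ∧
      ∀ t ∈ Icc 0 T, (ξ t ∘L fderiv ℝ f (z t, u t) + p₀ • fderiv ℝ ℓ (z t, u t)) ∘L
          ContinuousLinearMap.inr ℝ Z U = 0 := by
  have hzc : ContinuousOn z (Icc 0 T) := fun t ht => (hz t ht).continuousWithinAt
  have hcurve : ContinuousOn (fun t => (z t, u t)) (Icc 0 T) := hzc.prodMk hu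
  let zc : C(Icc (0 : ℝ) T, Z) := ⟨fun t => z t, hzc.domRestrict⟩
  let uc : C(Icc (0 : ℝ) T, U) := ⟨fun t => u t, hu.domRestrict⟩
  have hsubΩ : (fun t => (z t, u t)) '' Icc 0 T ⊆ Ω := by
    rintro _ ⟨t, ht, rfl⟩; exact hmem t ht
  obtain ⟨fl, hfl, ε₁, hε₁, hth, hfleq⟩ := exists_contDiff_eq_on_thickening hΩ
    (isCompact_Icc.image_of_continuousOn hcurve) hsubΩ (hf.prodMk hℓ)
  have hf1 : ContDiff ℝ 1 (fun x => (fl x).1) := (contDiff_fst.comp hfl).of_le (by simp)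
  have hℓ1 : ContDiff ℝ 1 (fun x => (fl x).2) := (contDiff_snd.comp hfl).of_le (by simp)
  have hnhds : ∀ t ∈ Icc 0 T, ∀ᶠ x in 𝓝 (z t, u t), fl x = (f x, ℓ x) := fun t ht => by
    filter_upwards [Metric.isOpen_thickening.mem_nhds
      (Metric.self_subset_thickening hε₁ _
        (mem_image_of_mem (fun t => (z t, u t)) ht))] with x hx
    exact hfleq x hx
  have hdf : ∀ t ∈ Icc 0 T, fderiv ℝ (fun x => (fl x).1) (z t, u t) = fderiv ℝ f (z t, u t) :=
    fun t ht => EventuallyEq.fderiv_eq ((hnhds t ht).mono fun x hx => by simp [hx])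
  have hdℓ : ∀ t ∈ Icc 0 T, fderiv ℝ (fun x => (fl x).2) (z t, u t) = fderiv ℝ ℓ (z t, u t) :=
    fun t ht => EventuallyEq.fderiv_eq ((hnhds t ht).mono fun x hx => by simp [hx])
  have hA : ContinuousOn (fun t => fderiv ℝ f (z t, u t)) (Icc 0 T) :=
    (hf.continuousOn_fderiv_of_isOpen hΩ (by simp)).comp hcurve hmem
  have ha : ContinuousOn (fun t => fderiv ℝ ℓ (z t, u t)) (Icc 0 T) :=
    (hℓ.continuousOn_fderiv_of_isOpen hΩ (by simp)).comp hcurve hmem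
  let A : C(Icc (0 : ℝ) T, Z × U →L[ℝ] Z) := ⟨fun t => fderiv ℝ f (z t, u t), hA.domRestrict⟩
  let a : C(Icc (0 : ℝ) T, Z × U →L[ℝ] ℝ) := ⟨fun t => fderiv ℝ ℓ (z t, u t), ha.domRestrict⟩
  obtain ⟨R, hR, hsolve⟩ := exists_response hT.le A
  -- Varying the control only by smooth functions keeps its regularity, so the perturbed
  -- trajectories remain eligible when competitors must be of class `C^N`.
  let M : Submodule ℝ C(Icc (0 : ℝ) T, U) :=
    { carrier := {v | ∃ v' : ℝ → U, ContDiff ℝ ∞ v' ∧ ∀ t : Icc (0 : ℝ) T, v t = v' t}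
      add_mem' := by
        rintro v w ⟨v', hv', hv⟩ ⟨w', hw', hw⟩
        exact ⟨fun t => v' t + w' t, hv'.add hw', fun t => by simp [hv, hw]⟩
      zero_mem' := ⟨fun _ => 0, contDiff_const, fun t => rfl⟩
      smul_mem' := by
        rintro c v ⟨v', hv', hv⟩
        exact ⟨fun t => c • v' t, hv'.const_smul c, fun t => by simp [hv]⟩ }
  let Λ : C(Icc (0 : ℝ) T, U) →L[ℝ] Z × ℝ :=
    (ContinuousMap.evalCLM ℝ (⟨T, hT.le, le_rfl⟩ : Icc (0 : ℝ) T) ∘L R).prod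
      (integralCLM hT.le ∘L pointwiseCLM a ∘L (stateInclusion T Z U ∘L R + controlInclusion T Z U))
  -- Either the linearised end point and cost map is onto on smooth variations, which contradicts
  -- optimality, or a nonzero functional kills its image.
  by_cases htop : M.map Λ.toLinearMap = ⊤
  · exfalso
    have hJ : ∀ (z' : ℝ → Z) (v : ℝ → U) (zc' : C(Icc (0 : ℝ) T, Z)) (uc' : C(Icc (0 : ℝ) T, U)),
        (∀ t : Icc (0 : ℝ) T, zc' t = z' t) → (∀ t : Icc (0 : ℝ) T, uc' t = u t + v t) →
        (∀ t ∈ Icc 0 T, ‖z' t - z t‖ < ε₁ ∧ ‖v t‖ < ε₁) →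
        (∀ t ∈ Icc 0 T, (z' t, u t + v t) ∈ Ω ∧
          fl (z' t, u t + v t) = (f (z' t, u t + v t), ℓ (z' t, u t + v t))) ∧
        integralCLM hT.le ((⟨fun x => (fl x).2, hℓ1.continuous⟩ : C(Z × U, ℝ)).comp
          (stateInclusion T Z U zc' + controlInclusion T Z U uc'))
          = ∫ t in (0 : ℝ)..T, ℓ (z' t, u t + v t) := by
      intro z' v zc' uc' h1 h2 h3
      have h4 : ∀ t ∈ Icc 0 T, (z' t, u t + v t) ∈
          Metric.thickening ε₁ ((fun t => (z t, u t)) '' Icc 0 T) := fun t ht => by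
        refine Metric.mem_thickening_iff.mpr ⟨_, mem_image_of_mem _ ht, ?_⟩
        rw [dist_eq_norm]
        simpa [Prod.norm_def] using h3 t ht
      refine ⟨fun t ht => ⟨hth (h4 t ht), hfleq _ (h4 t ht)⟩, integralCLM_eq hT.le _ fun t => ?_⟩
      change (fl ((stateInclusion T Z U zc' + controlInclusion T Z U uc') t)).2 = _
      rw [stateInclusion_add_controlInclusion_apply, h1, h2, hfleq _ (h4 t t.2)]
    have hval := (hJ z (fun _ => 0) zc uc (fun t => rfl) (fun t => (add_zero (u t)).symm)
      (fun t _ => by simpa using hε₁)).2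
    simp only [add_zero] at hval
    have hzc0 : zc = ContinuousMap.const _ (z 0) + primitiveCLM hT.le
        ((⟨fun x => (fl x).1, hf1.continuous⟩ : C(Z × U, Z)).comp
          (stateInclusion T Z U zc + controlInclusion T Z U uc)) := by
      ext1 t
      set F : C(Icc (0 : ℝ) T, Z) := (⟨fun x => (fl x).1, hf1.continuous⟩ : C(Z × U, Z)).comp
          (stateInclusion T Z U zc + controlInclusion T Z U uc) with hF
      have hFt : ∀ s ∈ Icc 0 T, IccExtend hT.le F s = f (z s, u s) := fun s hs => by
        rw [IccExtend_of_mem hT.le _ hs, hF]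
        change (fl ((stateInclusion T Z U zc + controlInclusion T Z U uc) ⟨s, hs⟩)).1 = _
        rw [stateInclusion_add_controlInclusion_apply]
        change (fl (z s, u s)).1 = _
        rw [(hnhds s hs).self_of_nhds]
      change z t = z 0 + ∫ s in (0 : ℝ)..t, IccExtend hT.le F s
      have := integral_eq_sub_of_hasDerivAt_of_le t.2.1
        (hzc.mono (Icc_subset_Icc_right t.2.2))
        (fun s hs => by
          have hs' : s ∈ Icc 0 T := ⟨hs.1.le, hs.2.le.trans t.2.2⟩
          rw [hFt s hs']
          exact (hz s hs').hasDerivAt (Icc_mem_nhds hs.1 (hs.2.trans_le t.2.2)))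
        (F.continuous.Icc_extend' (h := hT.le) |>.intervalIntegrable _ _)
      rw [this]
      abel
    have hev := eventually_exists_solution_cost_eq hT.le hf1 hℓ1 zc uc (z 0) hzc0 R A
      (fun t => (hdf t t.2).symm) a (fun t => (hdℓ t t.2).symm) hR hsolve M
      (fun k => by
        have hk : k ∈ M.map Λ.toLinearMap := htop ▸ Submodule.mem_top
        obtain ⟨v, hv, hvk⟩ := hk
        exact ⟨v, hv, hvk⟩) (lt_min hε hε₁)
    rw [hval] at hev
    set J := ∫ t in (0 : ℝ)..T, ℓ (z t, u t)
    -- The cost `J - σ η` with `η > 0` is strictly better for either sign of `σ`, because `σ (J - σ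
    -- η) = σ J - σ² η`.
    have htend : Tendsto (fun η : ℝ => J - σ * η) (𝓝[>] 0) (𝓝 J) := by
      have : Tendsto (fun η : ℝ => J - σ * η) (𝓝 0) (𝓝 (J - σ * 0)) :=
        Continuous.tendsto (by fun_prop) 0
      rw [mul_zero, sub_zero] at this
      exact this.mono_left nhdsWithin_le_nhds
    obtain ⟨η, ⟨z', v, ⟨v', hv', hvv⟩, hz1, hv1, hz'eq, hzT, hcost⟩, hη⟩ :=
      ((htend.eventually hev).and self_mem_nhdsWithin).exists
    have hclose : ∀ t ∈ Icc 0 T, ‖IccExtend hT.le z' t - z t‖ < min ε ε₁ ∧ ‖v' t‖ < min ε ε₁ := by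
      intro t ht
      rw [IccExtend_of_mem hT.le _ ht]
      refine ⟨((z' - zc).norm_coe_le_norm ⟨t, ht⟩).trans_lt hz1, ?_⟩
      rw [← hvv ⟨t, ht⟩]
      exact (v.norm_coe_le_norm _).trans_lt hv1
    obtain ⟨hgood, hcost'⟩ := hJ (IccExtend hT.le z') v' z' (uc + v)
      (fun t => (IccExtend_val hT.le _ t).symm) (fun t => congrArg (u t + ·) (hvv t))
      (fun t ht => ⟨(hclose t ht).1.trans_le (min_le_right _ _),
        (hclose t ht).2.trans_le (min_le_right _ _)⟩)
    set F : C(Icc (0 : ℝ) T, Z) := (⟨fun x => (fl x).1, hf1.continuous⟩ : C(Z × U, Z)).comp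
      (stateInclusion T Z U z' + controlInclusion T Z U (uc + v)) with hF
    have hzval : ∀ t ∈ Icc 0 T, IccExtend hT.le z' t =
        z 0 + ∫ s in (0 : ℝ)..t, IccExtend hT.le F s := fun t ht => by
      rw [IccExtend_of_mem hT.le _ ht]
      nth_rewrite 1 [hz'eq]
      rfl
    have hderiv : ∀ t ∈ Icc 0 T, HasDerivWithinAt (IccExtend hT.le z')
        (f (IccExtend hT.le z' t, u t + v' t)) (Icc 0 T) t := by
      intro t ht
      have hd := ((hasDerivAt_integral_IccExtend hT.le F t).const_add
        (z 0)).hasDerivWithinAt (s := Icc 0 T)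
      refine (hd.congr hzval (hzval t ht)).congr_deriv ?_
      rw [IccExtend_of_mem hT.le F ht, hF]
      change (fl ((stateInclusion T Z U z' + controlInclusion T Z U (uc + v)) ⟨t, ht⟩)).1 = _
      rw [stateInclusion_add_controlInclusion_apply]
      have e1 : (uc + v) ⟨t, ht⟩ = u t + v' t :=
        congrArg (u t + ·) (hvv ⟨t, ht⟩)
      rw [e1, ← IccExtend_of_mem hT.le z' ht, (hgood t ht).2]
    have hle := hopt (IccExtend hT.le z') v' hv' (fun t ht => (hgood t ht).1) hderiv
      ((hzval 0 ⟨le_rfl, hT.le⟩).trans (by rw [integral_same, add_zero]))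
      ((IccExtend_of_mem hT.le z' ⟨hT.le, le_rfl⟩).trans hzT)
      (fun t ht => ⟨(hclose t ht).1.trans_le (min_le_left _ _),
        (hclose t ht).2.trans_le (min_le_left _ _)⟩)
    rw [← hcost', hcost] at hle
    have hη' : (0 : ℝ) < η := hη
    have : 0 < σ * σ * η := mul_pos (mul_self_pos.mpr hσ) hη'
    nlinarith
  · obtain ⟨φ, hφ, hφM⟩ := Submodule.exists_le_ker_of_lt_top _ (lt_top_iff_ne_top.mpr htop)
    let φc : Z × ℝ →L[ℝ] ℝ := LinearMap.toContinuousLinearMap φ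
    let p : Z →L[ℝ] ℝ := φc ∘L ContinuousLinearMap.inl ℝ Z ℝ
    let p₀ : ℝ := φ (0, 1)
    have hsplit : ∀ (k : Z) (j : ℝ), φ (k, j) = p k + p₀ * j := fun k j => by
      have : (k, j) = (k, (0 : ℝ)) + j • ((0 : Z), (1 : ℝ)) := by simp
      rw [this, map_add, map_smul, smul_eq_mul, mul_comm]
      rfl
    obtain ⟨ξ, hξT, hξ, hξ'⟩ := exists_adjoint_curve hT hA ha p p₀ fun v hv => by
      let vc : C(Icc (0 : ℝ) T, U) := ⟨fun t => v t, hv.continuous.comp continuous_subtype_val⟩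
      have hvM : vc ∈ M := ⟨v, hv, fun t => rfl⟩
      have hzero : φ (Λ vc) = 0 := hφM (Submodule.mem_map_of_mem hvM)
      set F : C(Icc (0 : ℝ) T, Z) := pointwiseCLM A
        (stateInclusion T Z U (R vc) + controlInclusion T Z U vc) with hF
      have hζ : ∀ t ∈ Icc 0 T, IccExtend hT.le (R vc) t =
          ∫ s in (0 : ℝ)..t, IccExtend hT.le F s := fun t ht => by
        rw [IccExtend_of_mem hT.le _ ht]
        nth_rewrite 1 [hR vc]
        rfl
      refine ⟨IccExtend hT.le (R vc), (hζ 0 ⟨le_rfl, hT.le⟩).trans integral_same,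
        fun t ht => ?_, ?_⟩
      · have hd := (hasDerivAt_integral_IccExtend hT.le F t).hasDerivWithinAt
          (s := Icc 0 T)
        refine (hd.congr hζ (hζ t ht)).congr_deriv ?_
        rw [IccExtend_of_mem hT.le F ht, hF, pointwiseCLM_apply,
          stateInclusion_add_controlInclusion_apply, IccExtend_of_mem hT.le _ ht]
        rfl
      · refine Eq.trans ?_ hzero
        change _ = φ (R vc ⟨T, hT.le, le_rfl⟩, integralCLM hT.le (pointwiseCLM a
          (stateInclusion T Z U (R vc) + controlInclusion T Z U vc)))
        rw [hsplit, IccExtend_of_mem hT.le _ ⟨hT.le, le_rfl⟩]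
        congr 2
        refine (integralCLM_eq hT.le _ fun t => ?_).symm
        rw [pointwiseCLM_apply, stateInclusion_add_controlInclusion_apply, IccExtend_val]
        rfl
    refine ⟨p₀, ξ, ?_, hξ, hξ'⟩
    -- If `p₀` and `ξ T = p` both vanished, the annihilating functional `φ` would be zero.
    by_contra! hcon
    refine hφ (LinearMap.ext fun kj => ?_)
    rw [← Prod.mk.eta (p := kj), hsplit, hcon.1, ← hξT, hcon.2]
    simp

end MaximumPrinciple

/-! ### Smoothness of the coordinate expressions -/

section LocalSmoothness

open Filter Topology

variable {n : ℕ} {Q : Type*} [TopologicalSpace Q] [ChartedSpace (EuclideanSpace ℝ (Fin n)) Q]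
  [IsManifold (𝓡 n) ∞ Q]
  {F : Type*} [NormedAddCommGroup F] [NormedSpace ℝ F]
  {E : Q → Type*} [TopologicalSpace (TotalSpace F E)] [∀ q, TopologicalSpace (E q)]
  [FiberBundle F E] [∀ q, AddCommGroup (E q)] [∀ q, Module ℝ (E q)] [VectorBundle ℝ F E]
  {𝒜 : LieAlgebroid n F E}

/-- The function is the fibre component of the tangent map of `f` composed with the smooth section
`ρ(X)` of the tangent bundle. -/
theorem LieAlgebroid.contMDiff_lieDeriv (𝒜 : LieAlgebroid n F E) {f : Q → ℝ}
    (hf : ContMDiff (𝓡 n) 𝓘(ℝ, ℝ) ∞ f) (X : Cₛ^∞⟮𝓡 n; F, E⟯) :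
    ContMDiff (𝓡 n) 𝓘(ℝ, ℝ) ∞ (fun q => 𝒜.lieDeriv f q (X q)) := by
  have : IsManifold (𝓡 n) 1 Q := IsManifold.of_le (n := ∞) (by simp)
  have h1 := (hf.contMDiff_tangentMap (m := ∞) (by simp)).comp (𝒜.anchor_smooth X)
  exact (contMDiff_snd_tangentBundle_modelSpace ℝ 𝓘(ℝ, ℝ)).comp h1

/-- A smooth function on the manifold is smooth in a chart. -/
theorem contDiffOn_comp_chart_symm {n : ℕ} {Q : Type*} [TopologicalSpace Q]
    [ChartedSpace (EuclideanSpace ℝ (Fin n)) Q]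
    {c : OpenPartialHomeomorph Q (EuclideanSpace ℝ (Fin n))}
    (hc : c ∈ IsManifold.maximalAtlas (𝓡 n) ∞ Q) {W : Type*} [NormedAddCommGroup W]
    [NormedSpace ℝ W] {f : Q → W}
    (hf : ContMDiffOn (𝓡 n) 𝓘(ℝ, W) ∞ f c.source) :
    ContDiffOn ℝ ∞ (fun x => f (c.symm x)) c.target := by
  have h := hf.comp (contMDiffOn_symm_of_mem_maximalAtlas hc) c.mapsTo_symm
  exact contMDiffOn_iff_contDiffOn.mp h

namespace NonholonomicSystem

variable {m : ℕ} (S : NonholonomicSystem 𝒜 m)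

/-- The metric does not see the orthogonal projection when paired with an element of `D`. -/
theorem G_proj (q : Q) {v : E q} (hv : v ∈ S.D q) (w : E q) :
    S.G q v (S.proj q w) = S.G q v w := by
  have hmem : w - S.proj q w ∈ (S.G q).orthogonal (S.D q) := by
    refine (Submodule.projectionOnto_apply_eq_zero_iff (S.orthogonal_decomposition q)).mp ?_
    rw [map_sub, sub_eq_zero]
    exact (Submodule.projectionOnto_apply_left (S.orthogonal_decomposition q) (S.proj q w)).symm
  have h0 : S.G q v (w - S.proj q w) = 0 := hmem v hv
  rw [map_sub, sub_eq_zero] at h0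
  exact h0.symm

/-- Smoothness of the projector is not needed. In the Koszul formula the projected brackets occur
only paired with sections of `D`, where `G_proj` removes the projection and leaves brackets of
smooth sections. -/
theorem contMDiff_koszul {X Y Z : Cₛ^∞⟮𝓡 n; F, E⟯} (hX : ∀ q, X q ∈ S.D q)
    (hY : ∀ q, Y q ∈ S.D q) (hZ : ∀ q, Z q ∈ S.D q) :
    ContMDiff (𝓡 n) 𝓘(ℝ, ℝ) ∞ (S.koszul X Y Z) := by
  have h : S.koszul X Y Z = fun q =>
      𝒜.lieDeriv (fun p => S.G p (Y p) (Z p)) q (X q)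
        + 𝒜.lieDeriv (fun p => S.G p (X p) (Z p)) q (Y q)
        - 𝒜.lieDeriv (fun p => S.G p (X p) (Y p)) q (Z q)
        + S.G q (X q) (𝒜.bracket Z Y q)
        + S.G q (Y q) (𝒜.bracket Z X q)
        - S.G q (Z q) (𝒜.bracket Y X q) := by
    funext q
    simp only [koszul, bracketD]
    rw [S.G_proj q (hX q), S.G_proj q (hY q), S.G_proj q (hZ q)]
  rw [h]
  exact (((((𝒜.contMDiff_lieDeriv (S.G_smooth Y Z) X).add
    (𝒜.contMDiff_lieDeriv (S.G_smooth X Z) Y)).sub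
    (𝒜.contMDiff_lieDeriv (S.G_smooth X Y) Z)).add (S.G_smooth X _)).add (S.G_smooth Y _)).sub
    (S.G_smooth Z _)

end NonholonomicSystem

namespace AdaptedFrame

variable {m : ℕ} {S : NonholonomicSystem 𝒜 m}
  {Dc : ∀ q : Q, Submodule ℝ (E q)} {k r : ℕ} (fr : AdaptedFrame S Dc k r)

/-- A null vector of the Gram matrix gives an element of `D` orthogonal to `D`, hence zero since `D`
meets its orthogonal trivially. The metric may be indefinite, so this uses the decomposition and not
positivity. -/
theorem gram_det_ne_zero {q : Q} (hq : q ∈ fr.chart.source) : (fr.gram q).det ≠ 0 := by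
  intro hdet
  obtain ⟨v, hv, hv0⟩ := Matrix.exists_mulVec_eq_zero_iff.mpr hdet
  set d : E q := ∑ B, v B • fr.e B q with hd
  have hdD : d ∈ S.D q := Submodule.sum_mem _ fun B _ => Submodule.smul_mem _ _ (fr.e_mem B q)
  have hdo : d ∈ (S.G q).orthogonal (S.D q) := by
    intro w hw
    rw [← fr.span_eq q hq] at hw
    refine Submodule.span_induction (p := fun w _ => S.G q w d = 0) ?_ (by simp) ?_ ?_ hw
    · rintro _ ⟨A, rfl⟩
      have := congrFun hv0 A
      simpa [Matrix.mulVec, dotProduct, gram, hd, mul_comm] using this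
    · intro a b _ _ ha hb
      simp [ha, hb]
    · intro c a _ ha
      simp [ha]
  have hd0 : d = 0 := Submodule.disjoint_def.mp (S.orthogonal_decomposition q).disjoint d hdD hdo
  exact hv (funext fun B =>
    Fintype.linearIndependent_iff.mp (fr.linearIndependent q hq) v hd0 B)

theorem contDiffOn_gram (A B : Fin k ⊕ Fin r) :
    ContDiffOn ℝ ∞ (fun x => fr.gram (fr.chart.symm x) A B) fr.chart.target :=
  contDiffOn_comp_chart_symm fr.chart_mem (S.G_smooth (fr.e A) (fr.e B)).contMDiffOn

/-- The entries of the inverse of a smooth invertible matrix are smooth. -/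
theorem contDiffOn_matrix_inv {V ι : Type*} [NormedAddCommGroup V] [NormedSpace ℝ V] [Fintype ι]
    [DecidableEq ι] {M : V → Matrix ι ι ℝ} {s : Set V}
    (hM : ∀ i j, ContDiffOn ℝ ∞ (fun x => M x i j) s) (hdet : ∀ x ∈ s, (M x).det ≠ 0) (i j : ι) :
    ContDiffOn ℝ ∞ (fun x => (M x)⁻¹ i j) s := by
  have hd : ∀ M' : V → Matrix ι ι ℝ, (∀ i j, ContDiffOn ℝ ∞ (fun x => M' x i j) s) →
      ContDiffOn ℝ ∞ (fun x => (M' x).det) s := fun M' hM' => by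
    simp only [Matrix.det_apply']
    exact ContDiffOn.sum fun σ _ => contDiffOn_const.mul (contDiffOn_prod fun l _ => hM' _ _)
  have h : ∀ x, (M x)⁻¹ i j = (M x).det⁻¹ * (M x).adjugate i j := fun x => by
    rw [Matrix.inv_def, Ring.inverse_eq_inv', Matrix.smul_apply, smul_eq_mul]
  simp only [h]
  refine ((hd M hM).inv hdet).mul ?_
  simp only [Matrix.adjugate_apply]
  refine hd _ fun a b => ?_
  by_cases ha : a = j
  · subst ha; simpa using contDiffOn_const
  · simpa [Matrix.updateRow_ne ha] using hM a b

theorem contDiffOn_gram_inv (A B : Fin k ⊕ Fin r) :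
    ContDiffOn ℝ ∞ (fun x => (fr.gram (fr.chart.symm x))⁻¹ A B) fr.chart.target :=
  contDiffOn_matrix_inv fr.contDiffOn_gram
    (fun _ hx => fr.gram_det_ne_zero (fr.chart.map_target hx)) A B

theorem contDiffOn_christoffel (C A B : Fin k ⊕ Fin r) :
    ContDiffOn ℝ ∞ (fun x => fr.christoffel (fr.chart.symm x) C A B) fr.chart.target := by
  refine ContDiffOn.sum fun K _ => (fr.contDiffOn_gram_inv C K).mul (ContDiffOn.div_const ?_ 2)
  exact contDiffOn_comp_chart_symm fr.chart_mem
    (S.contMDiff_koszul (fr.e_mem A) (fr.e_mem B) (fr.e_mem K)).contMDiffOn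

theorem contDiffOn_gradV (C : Fin k ⊕ Fin r) :
    ContDiffOn ℝ ∞ (fun x => fr.gradV (fr.chart.symm x) C) fr.chart.target := by
  refine ContDiffOn.sum fun B _ => (fr.contDiffOn_gram_inv C B).mul ?_
  exact contDiffOn_comp_chart_symm fr.chart_mem
    (𝒜.contMDiff_lieDeriv S.V_smooth (fr.e B)).contMDiffOn

/-- The anchor components are read off from the tangent map of the chart, which is smooth on the
chart domain, applied to the smooth vector field `ρ(e_A)`. -/
theorem contDiffOn_rho (i : Fin n) (A : Fin k ⊕ Fin r) :
    ContDiffOn ℝ ∞ (fun x => fr.rho x i A) fr.chart.target := by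
  have : IsManifold (𝓡 n) 1 Q := IsManifold.of_le (n := ∞) (by simp)
  have hs : UniqueMDiffOn (𝓡 n) fr.chart.source := fr.chart.open_source.uniqueMDiffOn
  have h1 := ((contMDiffOn_of_mem_maximalAtlas fr.chart_mem).contMDiffOn_tangentMapWithin
    (m := ∞) (by simp) hs).comp (𝒜.anchor_smooth (fr.e A)).contMDiffOn (s := fr.chart.source)
    fun q hq => hq
  have h2 := (contMDiff_snd_tangentBundle_modelSpace (EuclideanSpace ℝ (Fin n))
    (𝓡 n)).comp_contMDiffOn h1
  have h3 : ContMDiffOn (𝓡 n) 𝓘(ℝ, EuclideanSpace ℝ (Fin n)) ∞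
      (fun q => fr.anchorCoord q (fr.e A q)) fr.chart.source := by
    refine h2.congr fun q hq => ?_
    simp only [Function.comp, tangentMapWithin, anchorCoord]
    rw [mfderivWithin_of_isOpen fr.chart.open_source hq]
  have h4 := contDiffOn_comp_chart_symm fr.chart_mem h3
  exact (contDiffOn_euclidean.mp h4) i

theorem anchorCoord_vec (x : EuclideanSpace ℝ (Fin n)) (y : Fin k ⊕ Fin r → ℝ) (i : Fin n) :
    fr.anchorCoord (fr.chart.symm x) (fr.vec (fr.chart.symm x) y) i
      = ∑ A, fr.rho x i A * y A := by
  have : (fr.vec (fr.chart.symm x) y : E (fr.chart.symm x))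
      = ∑ A, y A • fr.e A (fr.chart.symm x) := by
    simp [vec]
  rw [this]
  let φ : E (fr.chart.symm x) →ₗ[ℝ] ℝ := (EuclideanSpace.proj i).toLinearMap ∘ₗ
    (mfderiv (𝓡 n) (𝓡 n) fr.chart (fr.chart.symm x) :
      TangentSpace (𝓡 n) (fr.chart.symm x) →L[ℝ] EuclideanSpace ℝ (Fin n)).toLinearMap ∘ₗ
    𝒜.anchor (fr.chart.symm x)
  change φ _ = ∑ A, φ (fr.e A (fr.chart.symm x)) * y A
  simp only [map_sum, map_smul, smul_eq_mul, mul_comm]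

end AdaptedFrame

end LocalSmoothness

/-! ### Partial derivatives, regularity of trajectories, coordinates of functionals -/

section PartialDerivatives

variable {X Y Z W : Type*} [NormedAddCommGroup X] [NormedSpace ℝ X] [NormedAddCommGroup Y]
  [NormedSpace ℝ Y] [NormedAddCommGroup Z] [NormedSpace ℝ Z] [NormedAddCommGroup W]
  [NormedSpace ℝ W]

theorem fderiv_prod_left {g : X × Y → W} {x : X} {y : Y} (hg : DifferentiableAt ℝ g (x, y))
    (e : X) : fderiv ℝ g (x, y) (e, 0) = fderiv ℝ (fun x' => g (x', y)) x e := by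
  rw [fderiv_curry_left hg]
  simp

theorem fderiv_prod_right {g : X × Y → W} {x : X} {y : Y} (hg : DifferentiableAt ℝ g (x, y))
    (e : Y) : fderiv ℝ g (x, y) (0, e) = fderiv ℝ (fun y' => g (x, y')) y e := by
  rw [fderiv_curry_right hg]
  simp

theorem fderiv_prod_middle {g : X × Y × Z → W} {x : X} {y : Y} {z : Z}
    (hg : DifferentiableAt ℝ g (x, y, z)) (e : Y) :
    fderiv ℝ g (x, y, z) (0, e, 0) = fderiv ℝ (fun y' => g (x, y', z)) y e := by
  have h2 : DifferentiableAt ℝ (fun p : Y × Z => g (x, p)) (y, z) :=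
    hg.comp (y, z) (hasFDerivAt_prodMk_right x (y, z)).differentiableAt
  rw [fderiv_prod_right hg, fderiv_prod_left h2]

theorem fderiv_prod_last {g : X × Y × Z → W} {x : X} {y : Y} {z : Z}
    (hg : DifferentiableAt ℝ g (x, y, z)) (e : Z) :
    fderiv ℝ g (x, y, z) (0, 0, e) = fderiv ℝ (fun z' => g (x, y, z')) z e := by
  have h2 : DifferentiableAt ℝ (fun p : Y × Z => g (x, p)) (y, z) :=
    hg.comp (y, z) (hasFDerivAt_prodMk_right x (y, z)).differentiableAt
  rw [fderiv_prod_right hg, fderiv_prod_right h2]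

theorem fderiv_prod_split {g : X × Y → W} {x : X} {y : Y} (hg : DifferentiableAt ℝ g (x, y))
    (a : X) (b : Y) :
    fderiv ℝ g (x, y) (a, b) =
      fderiv ℝ (fun x' => g (x', y)) x a + fderiv ℝ (fun y' => g (x, y')) y b := by
  rw [← fderiv_prod_left hg, ← fderiv_prod_right hg, ← map_add]
  simp

theorem fderiv_comp_prodAssoc {g : X × Y × Z → W} {x : X} {y : Y} {u : Z}
    (hg : DifferentiableAt ℝ g (x, y, u)) (a : X) (b : Y) (c : Z) :
    fderiv ℝ (fun p : (X × Y) × Z => g (p.1.1, p.1.2, p.2)) ((x, y), u) ((a, b), c) =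
      fderiv ℝ g (x, y, u) (a, b, c) := by
  have hin : HasFDerivAt (fun p : (X × Y) × Z => (p.1.1, p.1.2, p.2))
      ((ContinuousLinearMap.fst ℝ X Y ∘L ContinuousLinearMap.fst ℝ (X × Y) Z).prod
        ((ContinuousLinearMap.snd ℝ X Y ∘L ContinuousLinearMap.fst ℝ (X × Y) Z).prod
          (ContinuousLinearMap.snd ℝ (X × Y) Z))) ((x, y), u) :=
    hasFDerivAt_fst.fst.prodMk (hasFDerivAt_fst.snd.prodMk hasFDerivAt_snd)
  exact congrArg (fun φ => φ ((a, b), c)) (hg.hasFDerivAt.comp ((x, y), u) hin).fderiv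

end PartialDerivatives

/-- Regularity of solutions of a smooth control system with a control of class `C^(N-1)`. -/
theorem contDiffOn_of_hasDerivWithinAt_control {Z U : Type*} [NormedAddCommGroup Z]
    [NormedSpace ℝ Z] [NormedAddCommGroup U] [NormedSpace ℝ U] {T : ℝ} (hT : 0 < T)
    {Ω : Set (Z × U)} {f : Z × U → Z} (hf : ContDiffOn ℝ ∞ f Ω) {z : ℝ → Z} {u : ℝ → U} {N : ℕ∞}
    (hu : ∀ j : ℕ, ((j + 1 : ℕ) : ℕ∞) ≤ N → ContDiffOn ℝ j u (Icc 0 T))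
    (hmem : ∀ t ∈ Icc 0 T, (z t, u t) ∈ Ω)
    (hz : ∀ t ∈ Icc 0 T, HasDerivWithinAt z (f (z t, u t)) (Icc 0 T) t) :
    ContDiffOn ℝ N z (Icc 0 T) := by
  -- Bootstrap: if `z` and `u` are `C^j`, the right-hand side `f(z, u)` is `C^j`, so `z` is
  -- `C^(j+1)`.
  have hnat : ∀ j : ℕ, (j : ℕ∞) ≤ N → ContDiffOn ℝ j z (Icc 0 T) := by
    intro j
    induction j with
    | zero =>
      intro _
      rw [Nat.cast_zero, contDiffOn_zero]
      exact fun t ht => (hz t ht).continuousWithinAt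
    | succ j ih =>
      intro hj
      have hzj := ih (le_trans (by exact_mod_cast j.le_succ) hj)
      rw [Nat.cast_add, Nat.cast_one, contDiffOn_succ_iff_derivWithin (uniqueDiffOn_Icc hT)]
      refine ⟨fun t ht => (hz t ht).differentiableWithinAt, by simp, ?_⟩
      have hcomp : ContDiffOn ℝ j (fun t => f (z t, u t)) (Icc 0 T) :=
        (hf.of_le (by exact_mod_cast le_top)).comp (hzj.prodMk (hu j hj)) hmem
      exact hcomp.congr fun t ht => (hz t ht).derivWithin (uniqueDiffOn_Icc hT t ht)
  induction N with
  | top => exact contDiffOn_infty.mpr fun j => hnat j le_top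
  | coe N => exact hnat N le_rfl

theorem functional_apply_eq_sum {n : ℕ} {ι : Type*} [Fintype ι] [DecidableEq ι]
    (ξ : EuclideanSpace ℝ (Fin n) × (ι → ℝ) →L[ℝ] ℝ) (a : EuclideanSpace ℝ (Fin n)) (b : ι → ℝ) :
    ξ (a, b) = ∑ i, ξ (EuclideanSpace.single i 1, 0) * a i + ∑ C, ξ (0, Pi.single C 1) * b C := by
  have ha : ∑ i, a i • EuclideanSpace.single i (1 : ℝ) = a := by
    simpa using (EuclideanSpace.basisFun (Fin n) ℝ).sum_repr a
  have hb : ∑ C, b C • (Pi.single C 1 : ι → ℝ) = b := by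
    simpa using (Pi.basisFun ℝ ι).sum_repr b
  have h1 : ξ (a, 0) = ∑ i, ξ (EuclideanSpace.single i 1, 0) * a i := by
    change (ξ ∘L ContinuousLinearMap.inl ℝ _ _) a = _
    conv_lhs => rw [← ha]
    simp only [map_sum, map_smul, smul_eq_mul]
    exact Finset.sum_congr rfl fun i _ => mul_comm _ _
  have h2 : ξ (0, b) = ∑ C, ξ (0, Pi.single C 1) * b C := by
    change (ξ ∘L ContinuousLinearMap.inr ℝ _ _) b = _
    conv_lhs => rw [← hb]
    simp only [map_sum, map_smul, smul_eq_mul]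
    exact Finset.sum_congr rfl fun i _ => mul_comm _ _
  rw [← h1, ← h2, ← map_add]
  simp

/-! ### Forces and Lagrangians in adapted coordinates -/

namespace AdaptedFrame

open Filter Topology

variable {n : ℕ} {Q : Type*} [TopologicalSpace Q] [ChartedSpace (EuclideanSpace ℝ (Fin n)) Q]
  [IsManifold (𝓡 n) ∞ Q]
  {F : Type*} [NormedAddCommGroup F] [NormedSpace ℝ F]
  {E : Q → Type*} [TopologicalSpace (TotalSpace F E)] [∀ q, TopologicalSpace (E q)]
  [FiberBundle F E] [∀ q, AddCommGroup (E q)] [∀ q, Module ℝ (E q)] [VectorBundle ℝ F E]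
  {𝒜 : LieAlgebroid n F E} {m : ℕ} {S : NonholonomicSystem 𝒜 m}
  {Dc : ∀ q : Q, Submodule ℝ (E q)} {k r : ℕ} (fr : AdaptedFrame S Dc k r)
  {𝒰 : Set (Fin k → ℝ)} {cost : (q : Q) → S.D q → (Fin k → ℝ) → ℝ} {T : ℝ}

/-- The velocity enters additively with coefficient one. This permits solving for `ẏ` to obtain a
control system, and makes the derivatives of the force in `q` and `y` independent of `ẏ`. -/
theorem force_eq_add (x : EuclideanSpace ℝ (Fin n)) (y yd : Fin k ⊕ Fin r → ℝ)
    (C : Fin k ⊕ Fin r) : fr.force x y yd C = yd C + fr.force x y 0 C := by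
  simp [force, add_assoc]

theorem contDiffOn_force (C : Fin k ⊕ Fin r) :
    ContDiffOn ℝ ∞ (fun p : EuclideanSpace ℝ (Fin n) × (Fin k ⊕ Fin r → ℝ) ×
      (Fin k ⊕ Fin r → ℝ) => fr.force p.1 p.2.1 p.2.2 C) (fr.chart.target ×ˢ univ) := by
  have hx : ∀ {g : EuclideanSpace ℝ (Fin n) → ℝ}, ContDiffOn ℝ ∞ g fr.chart.target →
      ContDiffOn ℝ ∞ (fun p : EuclideanSpace ℝ (Fin n) × (Fin k ⊕ Fin r → ℝ) ×
        (Fin k ⊕ Fin r → ℝ) => g p.1) (fr.chart.target ×ˢ univ) := fun hg =>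
    hg.comp contDiff_fst.contDiffOn fun p hp => hp.1
  have hy : ∀ A, ContDiffOn ℝ ∞ (fun p : EuclideanSpace ℝ (Fin n) × (Fin k ⊕ Fin r → ℝ) ×
      (Fin k ⊕ Fin r → ℝ) => p.2.1 A) (fr.chart.target ×ˢ univ) := fun A =>
    ((contDiff_apply ℝ ℝ A).comp (contDiff_fst.comp contDiff_snd)).contDiffOn
  refine ContDiffOn.add (ContDiffOn.add ?_ ?_) (hx (fr.contDiffOn_gradV C))
  · exact ((contDiff_apply ℝ ℝ C).comp (contDiff_snd.comp contDiff_snd)).contDiffOn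
  · exact ContDiffOn.sum fun A _ => ContDiffOn.sum fun B _ =>
      ((hx (fr.contDiffOn_christoffel C A B)).mul (hy A)).mul (hy B)

theorem differentiableAt_force {x : EuclideanSpace ℝ (Fin n)} (hx : x ∈ fr.chart.target)
    (y yd : Fin k ⊕ Fin r → ℝ) (C : Fin k ⊕ Fin r) :
    DifferentiableAt ℝ (fun p : EuclideanSpace ℝ (Fin n) × (Fin k ⊕ Fin r → ℝ) ×
      (Fin k ⊕ Fin r → ℝ) => fr.force p.1 p.2.1 p.2.2 C) (x, y, yd) :=
  ((fr.contDiffOn_force C).contDiffAt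
    ((fr.chart.open_target.prod isOpen_univ).mem_nhds ⟨hx, mem_univ _⟩)).differentiableAt (by simp)

theorem differentiableAt_rho {x : EuclideanSpace ℝ (Fin n)} (hx : x ∈ fr.chart.target)
    (i : Fin n) (A : Fin k ⊕ Fin r) : DifferentiableAt ℝ (fun z => fr.rho z i A) x :=
  ((fr.contDiffOn_rho i A).contDiffAt (fr.chart.open_target.mem_nhds hx)).differentiableAt
    (by simp)

theorem fderiv_force_base (x : EuclideanSpace ℝ (Fin n)) (y yd : Fin k ⊕ Fin r → ℝ)
    (C : Fin k ⊕ Fin r) :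
    fderiv ℝ (fun z => fr.force z y yd C) x = fderiv ℝ (fun z => fr.force z y 0 C) x := by
  rw [show (fun z => fr.force z y yd C) = fun z => yd C + fr.force z y 0 C from
    funext fun z => fr.force_eq_add z y yd C, fderiv_const_add]

theorem hasFDerivAt_force_velocity (x : EuclideanSpace ℝ (Fin n)) (y yd : Fin k ⊕ Fin r → ℝ)
    (C : Fin k ⊕ Fin r) :
    HasFDerivAt (fun v => fr.force x y v C)
      (ContinuousLinearMap.proj (R := ℝ) (φ := fun _ : Fin k ⊕ Fin r => ℝ) C) yd := by
  rw [show (fun v => fr.force x y v C) = fun v => v C + fr.force x y 0 C from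
    funext fun v => fr.force_eq_add x y v C]
  exact (hasFDerivAt_apply C yd).add_const _

theorem fderiv_force_fibre (x : EuclideanSpace ℝ (Fin n)) (y yd : Fin k ⊕ Fin r → ℝ)
    (C A : Fin k ⊕ Fin r) :
    fderiv ℝ (fun w => fr.force x w yd C) y (Pi.single A 1) =
      ∑ B, (fr.christoffel (fr.chart.symm x) C A B
        + fr.christoffel (fr.chart.symm x) C B A) * y B := by
  have h : HasFDerivAt (fun w => fr.force x w yd C) (∑ A, ∑ B,
      ((fr.christoffel (fr.chart.symm x) C A B * y A) •
        ContinuousLinearMap.proj (R := ℝ) (φ := fun _ : Fin k ⊕ Fin r => ℝ) B +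
      y B • fr.christoffel (fr.chart.symm x) C A B •
        ContinuousLinearMap.proj (R := ℝ) (φ := fun _ : Fin k ⊕ Fin r => ℝ) A)) y := by
    refine HasFDerivAt.add_const _ (HasFDerivAt.const_add _ ?_)
    exact HasFDerivAt.fun_sum fun A _ => HasFDerivAt.fun_sum fun B _ =>
      ((hasFDerivAt_apply A y).const_mul _).mul (hasFDerivAt_apply B y)
  rw [h.fderiv]
  simp only [sum_apply, add_apply,
    smul_apply, ContinuousLinearMap.proj_apply, smul_eq_mul, Pi.single_apply,
    mul_ite, mul_one, mul_zero, Finset.sum_add_distrib, Finset.sum_ite_eq', Finset.mem_univ,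
    if_true, add_mul]
  rw [Finset.sum_comm (f := fun A' B => if A' = A then _ else _)]
  simp only [Finset.sum_ite_eq', Finset.mem_univ, if_true]
  rw [add_comm]
  congr 1
  exact Finset.sum_congr rfl fun B _ => mul_comm _ _

/-- The domain of the Lagrangian: states in the chart domain whose controls lie in `𝒰`. -/
def lagrangianDomain (𝒰 : Set (Fin k → ℝ)) : Set (EuclideanSpace ℝ (Fin n) ×
    (Fin k ⊕ Fin r → ℝ) × (Fin k ⊕ Fin r → ℝ)) :=
  (fr.chart.target ×ˢ univ) ∩
    (fun p => fun c : Fin k => fr.force p.1 p.2.1 p.2.2 (Sum.inl c)) ⁻¹' 𝒰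

theorem contDiffOn_actuatedForce :
    ContDiffOn ℝ ∞ (fun p : EuclideanSpace ℝ (Fin n) × (Fin k ⊕ Fin r → ℝ) ×
      (Fin k ⊕ Fin r → ℝ) => fun c : Fin k => fr.force p.1 p.2.1 p.2.2 (Sum.inl c))
      (fr.chart.target ×ˢ univ) :=
  contDiffOn_pi.mpr fun c => fr.contDiffOn_force (Sum.inl c)

theorem isOpen_lagrangianDomain (h𝒰 : IsOpen 𝒰) : IsOpen (fr.lagrangianDomain 𝒰) :=
  fr.contDiffOn_actuatedForce.continuousOn.isOpen_inter_preimage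
    (fr.chart.open_target.prod isOpen_univ) h𝒰

theorem contDiffOn_lagrangian (hcost : fr.SmoothCost 𝒰 cost) :
    ContDiffOn ℝ ∞ (fun p : EuclideanSpace ℝ (Fin n) × (Fin k ⊕ Fin r → ℝ) ×
      (Fin k ⊕ Fin r → ℝ) => fr.lagrangian cost p.1 p.2.1 p.2.2) (fr.lagrangianDomain 𝒰) :=
  ContDiffOn.comp hcost (t := fr.chart.target ×ˢ univ ×ˢ 𝒰)
    (contDiff_fst.contDiffOn.prodMk ((contDiff_fst.comp contDiff_snd).contDiffOn.prodMk
      (fr.contDiffOn_actuatedForce.mono inter_subset_left)))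
    fun _ hp => ⟨hp.1.1, mem_univ _, hp.2⟩

/-- The domain of the extended Lagrangian. -/
def extendedDomain (𝒰 : Set (Fin k → ℝ)) :
    Set ((EuclideanSpace ℝ (Fin n) × (Fin k ⊕ Fin r → ℝ) × (Fin n → ℝ) × (Fin r → ℝ)) ×
      (EuclideanSpace ℝ (Fin n) × (Fin k ⊕ Fin r → ℝ) × (Fin n → ℝ) × (Fin r → ℝ))) :=
  (fun p => (p.1.1, p.1.2.1, p.2.2.1)) ⁻¹' fr.lagrangianDomain 𝒰

theorem isOpen_extendedDomain (h𝒰 : IsOpen 𝒰) : IsOpen (fr.extendedDomain 𝒰) :=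
  (fr.isOpen_lagrangianDomain h𝒰).preimage (by fun_prop)

theorem contDiffOn_extendedLagrangian (hcost : fr.SmoothCost 𝒰 cost) :
    ContDiffOn ℝ ∞ (fun p : (EuclideanSpace ℝ (Fin n) × (Fin k ⊕ Fin r → ℝ) × (Fin n → ℝ) ×
        (Fin r → ℝ)) × (EuclideanSpace ℝ (Fin n) × (Fin k ⊕ Fin r → ℝ) × (Fin n → ℝ) ×
        (Fin r → ℝ)) => fr.extendedLagrangian cost p.1 p.2) (fr.extendedDomain 𝒰) := by
  have hproj : ContDiff ℝ ∞ (fun p : (EuclideanSpace ℝ (Fin n) × (Fin k ⊕ Fin r → ℝ) ×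
      (Fin n → ℝ) × (Fin r → ℝ)) × (EuclideanSpace ℝ (Fin n) × (Fin k ⊕ Fin r → ℝ) ×
      (Fin n → ℝ) × (Fin r → ℝ)) => (p.1.1, p.1.2.1, p.2.2.1)) := by fun_prop
  refine ContDiffOn.add (ContDiffOn.add ?_ ?_) ?_
  · exact (fr.contDiffOn_lagrangian hcost).comp hproj.contDiffOn fun p hp => hp
  · refine ContDiffOn.sum fun i _ => ContDiffOn.mul (by fun_prop) (ContDiffOn.sub (by fun_prop) ?_)
    refine ContDiffOn.sum fun A _ => ContDiffOn.mul ?_ (by fun_prop)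
    exact (fr.contDiffOn_rho i A).comp (contDiff_fst.comp contDiff_fst).contDiffOn
      fun p hp => hp.1.1
  · refine ContDiffOn.sum fun α _ => ContDiffOn.mul (by fun_prop) ?_
    exact (fr.contDiffOn_force (Sum.inr α)).comp hproj.contDiffOn fun p hp => hp.1

section PointwiseDerivatives

variable {x xd : EuclideanSpace ℝ (Fin n)} {y yd : Fin k ⊕ Fin r → ℝ} {l ld : Fin n → ℝ}
  {lb lbd : Fin r → ℝ}

theorem differentiableAt_lagrangian (h𝒰 : IsOpen 𝒰) (hcost : fr.SmoothCost 𝒰 cost)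
    (h : (x, y, yd) ∈ fr.lagrangianDomain 𝒰) :
    DifferentiableAt ℝ (fun p : EuclideanSpace ℝ (Fin n) × (Fin k ⊕ Fin r → ℝ) ×
      (Fin k ⊕ Fin r → ℝ) => fr.lagrangian cost p.1 p.2.1 p.2.2) (x, y, yd) :=
  ((fr.contDiffOn_lagrangian hcost).contDiffAt
    ((fr.isOpen_lagrangianDomain h𝒰).mem_nhds h)).differentiableAt (by simp)

/-- The momenta conjugate to the multipliers vanish, as `c` and `d` are absent on the right; the
momentum of `q` is `λ`, and `λ̄_α` is added to the momentum of `y^α` only. -/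
theorem fderiv_extendedLagrangian_velocity (h𝒰 : IsOpen 𝒰) (hcost : fr.SmoothCost 𝒰 cost)
    (h : (x, y, yd) ∈ fr.lagrangianDomain 𝒰) (a : EuclideanSpace ℝ (Fin n))
    (b : Fin k ⊕ Fin r → ℝ) (c : Fin n → ℝ) (d : Fin r → ℝ) :
    fderiv ℝ (fun v => fr.extendedLagrangian cost (x, y, l, lb) v) (xd, yd, ld, lbd) (a, b, c, d)
      = fderiv ℝ (fun v => fr.lagrangian cost x y v) yd b + ∑ i, l i * a i
        + ∑ α, lb α * b (Sum.inr α) := by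
  have hL : DifferentiableAt ℝ (fun v => fr.lagrangian cost x y v) yd :=
    (fr.differentiableAt_lagrangian h𝒰 hcost h).comp (f := fun v => (x, y, v)) yd (by fun_prop)
  have h1 : HasFDerivAt (fun v : EuclideanSpace ℝ (Fin n) × (Fin k ⊕ Fin r → ℝ) × (Fin n → ℝ) ×
      (Fin r → ℝ) => v.2.1) (ContinuousLinearMap.fst ℝ _ _ ∘L ContinuousLinearMap.snd ℝ _ _)
      (xd, yd, ld, lbd) := hasFDerivAt_snd.fst
  have h2 : ∀ i, HasFDerivAt (fun v : EuclideanSpace ℝ (Fin n) × (Fin k ⊕ Fin r → ℝ) ×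
      (Fin n → ℝ) × (Fin r → ℝ) => v.1 i)
      (EuclideanSpace.proj i ∘L ContinuousLinearMap.fst ℝ _ _) (xd, yd, ld, lbd) := fun i =>
    (EuclideanSpace.proj (𝕜 := ℝ) i).hasFDerivAt.comp (xd, yd, ld, lbd) hasFDerivAt_fst
  have hF := ((hL.hasFDerivAt.comp (xd, yd, ld, lbd) h1).add
    (HasFDerivAt.fun_sum fun i (_ : i ∈ Finset.univ) =>
      ((h2 i).sub_const (∑ A, fr.rho x i A * y A)).const_mul (l i))).add
    (HasFDerivAt.fun_sum fun α (_ : α ∈ Finset.univ) =>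
      (((fr.hasFDerivAt_force_velocity x y yd (Sum.inr α)).comp (xd, yd, ld, lbd) h1).const_mul
        (lb α)))
  refine (congrArg (fun φ => φ (a, b, c, d)) (HasFDerivAt.fderiv hF)).trans ?_
  simp

theorem fderiv_extendedLagrangian_position (h𝒰 : IsOpen 𝒰) (hcost : fr.SmoothCost 𝒰 cost)
    (h : (x, y, yd) ∈ fr.lagrangianDomain 𝒰) (a : EuclideanSpace ℝ (Fin n))
    (b : Fin k ⊕ Fin r → ℝ) (c : Fin n → ℝ) (d : Fin r → ℝ) :
    fderiv ℝ (fun z => fr.extendedLagrangian cost z (xd, yd, ld, lbd)) (x, y, l, lb) (a, b, c, d)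
      = fderiv ℝ (fun z => fr.lagrangian cost z y yd) x a
        + fderiv ℝ (fun w => fr.lagrangian cost x w yd) y b
        + ∑ i, ((xd i - ∑ A, fr.rho x i A * y A) * c i
          - l i * ∑ A, (fr.rho x i A * b A + y A * fderiv ℝ (fun z => fr.rho z i A) x a))
        + ∑ α, (fr.Phi α x y yd * d α
          + lb α * (fderiv ℝ (fun z => fr.Phi α z y yd) x a
            + fderiv ℝ (fun w => fr.Phi α x w yd) y b)) := by
  have hx : x ∈ fr.chart.target := h.1.1
  have hL : DifferentiableAt ℝ (fun p : EuclideanSpace ℝ (Fin n) × (Fin k ⊕ Fin r → ℝ) =>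
      fr.lagrangian cost p.1 p.2 yd) (x, y) :=
    (fr.differentiableAt_lagrangian h𝒰 hcost h).comp (f := fun p => (p.1, p.2, yd)) (x, y)
      (by fun_prop)
  have hΦ : ∀ α, DifferentiableAt ℝ (fun p : EuclideanSpace ℝ (Fin n) × (Fin k ⊕ Fin r → ℝ) =>
      fr.Phi α p.1 p.2 yd) (x, y) := fun α =>
    (fr.differentiableAt_force hx y yd (Sum.inr α)).comp (f := fun p => (p.1, p.2, yd)) (x, y)
      (by fun_prop)
  rw [← fderiv_prod_split hL]
  simp only [← fderiv_prod_split (hΦ _)]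
  have h0 : HasFDerivAt (fun z : EuclideanSpace ℝ (Fin n) × (Fin k ⊕ Fin r → ℝ) × (Fin n → ℝ) ×
      (Fin r → ℝ) => z.1) (ContinuousLinearMap.fst ℝ _ _)
      (x, y, l, lb) := hasFDerivAt_fst
  have h1 : HasFDerivAt (fun z : EuclideanSpace ℝ (Fin n) × (Fin k ⊕ Fin r → ℝ) × (Fin n → ℝ) ×
      (Fin r → ℝ) => (z.1, z.2.1)) ((ContinuousLinearMap.fst ℝ _ _).prod
        (ContinuousLinearMap.fst ℝ _ _ ∘L ContinuousLinearMap.snd ℝ _ _))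
      (x, y, l, lb) := hasFDerivAt_fst.prodMk hasFDerivAt_snd.fst
  have h2 : ∀ A, HasFDerivAt (fun z : EuclideanSpace ℝ (Fin n) × (Fin k ⊕ Fin r → ℝ) ×
      (Fin n → ℝ) × (Fin r → ℝ) => z.2.1 A)
      (ContinuousLinearMap.proj (R := ℝ) (φ := fun _ : Fin k ⊕ Fin r => ℝ) A ∘L
        ContinuousLinearMap.fst ℝ _ _ ∘L ContinuousLinearMap.snd ℝ _ _) (x, y, l, lb) := fun A =>
    HasFDerivAt.comp (g := fun v : Fin k ⊕ Fin r → ℝ => v A)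
      (f := fun z : EuclideanSpace ℝ (Fin n) × (Fin k ⊕ Fin r → ℝ) ×
      (Fin n → ℝ) × (Fin r → ℝ) => z.2.1) (x, y, l, lb)
      (hasFDerivAt_apply A y) hasFDerivAt_snd.fst
  have h3 : ∀ i, HasFDerivAt (fun z : EuclideanSpace ℝ (Fin n) × (Fin k ⊕ Fin r → ℝ) ×
      (Fin n → ℝ) × (Fin r → ℝ) => z.2.2.1 i)
      (ContinuousLinearMap.proj (R := ℝ) (φ := fun _ : Fin n => ℝ) i ∘L
        ContinuousLinearMap.fst ℝ _ _ ∘L ContinuousLinearMap.snd ℝ _ _ ∘L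
        ContinuousLinearMap.snd ℝ _ _) (x, y, l, lb) := fun i =>
    HasFDerivAt.comp (g := fun v : Fin n → ℝ => v i)
      (f := fun z : EuclideanSpace ℝ (Fin n) × (Fin k ⊕ Fin r → ℝ) ×
      (Fin n → ℝ) × (Fin r → ℝ) => z.2.2.1) (x, y, l, lb)
      (hasFDerivAt_apply i l) hasFDerivAt_snd.snd.fst
  have h4 : ∀ α, HasFDerivAt (fun z : EuclideanSpace ℝ (Fin n) × (Fin k ⊕ Fin r → ℝ) ×
      (Fin n → ℝ) × (Fin r → ℝ) => z.2.2.2 α)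
      (ContinuousLinearMap.proj (R := ℝ) (φ := fun _ : Fin r => ℝ) α ∘L
        ContinuousLinearMap.snd ℝ _ _ ∘L ContinuousLinearMap.snd ℝ _ _ ∘L
        ContinuousLinearMap.snd ℝ _ _) (x, y, l, lb) := fun α =>
    HasFDerivAt.comp (g := fun v : Fin r → ℝ => v α)
      (f := fun z : EuclideanSpace ℝ (Fin n) × (Fin k ⊕ Fin r → ℝ) ×
      (Fin n → ℝ) × (Fin r → ℝ) => z.2.2.2) (x, y, l, lb)
      (hasFDerivAt_apply α lb) hasFDerivAt_snd.snd.snd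
  have hF := ((hL.hasFDerivAt.comp (x, y, l, lb) h1).add
    (HasFDerivAt.fun_sum fun i (_ : i ∈ Finset.univ) =>
      (h3 i).mul ((HasFDerivAt.fun_sum fun A (_ : A ∈ Finset.univ) =>
        ((fr.differentiableAt_rho hx i A).hasFDerivAt.comp (x, y, l, lb) h0).mul
          (h2 A)).const_sub (xd i)))).add
    (HasFDerivAt.fun_sum fun α (_ : α ∈ Finset.univ) =>
      (h4 α).mul ((hΦ α).hasFDerivAt.comp (x, y, l, lb) h1))
  refine (congrArg (fun φ => φ (a, b, c, d)) (HasFDerivAt.fderiv hF)).trans ?_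
  simp only [add_apply, sum_apply, smul_apply, neg_apply, ContinuousLinearMap.comp_apply,
    ContinuousLinearMap.prod_apply, ContinuousLinearMap.coe_fst', ContinuousLinearMap.coe_snd',
    ContinuousLinearMap.proj_apply, smul_eq_mul, Function.comp_apply, Pi.mul_apply]
  congr 1
  · congr 1
    exact Finset.sum_congr rfl fun i _ => by ring
  · exact Finset.sum_congr rfl fun i _ => by ring

end PointwiseDerivatives

/-! ### The necessary conditions as Euler-Lagrange equations -/

section Equations

variable {x : ℝ → EuclideanSpace ℝ (Fin n)} {y : ℝ → Fin k ⊕ Fin r → ℝ}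
  {lam : ℝ → Fin n → ℝ} {lamBar : ℝ → Fin r → ℝ}

theorem derivWithin_extended (hT : 0 < T) (hx : ContDiffOn ℝ 1 x (Icc 0 T))
    (hy : ContDiffOn ℝ 1 y (Icc 0 T)) (hl : ContDiffOn ℝ 1 lam (Icc 0 T))
    (hlb : ContDiffOn ℝ 1 lamBar (Icc 0 T)) {t : ℝ} (ht : t ∈ Icc 0 T) :
    derivWithin (fun t => (x t, y t, lam t, lamBar t)) (Icc 0 T) t =
      (derivWithin x (Icc 0 T) t, derivWithin y (Icc 0 T) t, derivWithin lam (Icc 0 T) t,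
        derivWithin lamBar (Icc 0 T) t) :=
  ((hx.differentiableOn one_ne_zero t ht).hasDerivWithinAt.prodMk
    ((hy.differentiableOn one_ne_zero t ht).hasDerivWithinAt.prodMk
      ((hl.differentiableOn one_ne_zero t ht).hasDerivWithinAt.prodMk
        (hlb.differentiableOn one_ne_zero t ht).hasDerivWithinAt))).derivWithin
    (uniqueDiffOn_Icc hT t ht)

/-- The Euler-Lagrange equations of the extended Lagrangian in coordinates. -/
theorem eulerLagrange_extended_iff (h𝒰 : IsOpen 𝒰) (hcost : fr.SmoothCost 𝒰 cost) (hT : 0 < T)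
    (hx : ContDiffOn ℝ 1 x (Icc 0 T)) (hy : ContDiffOn ℝ 1 y (Icc 0 T))
    (hl : ContDiffOn ℝ 1 lam (Icc 0 T)) (hlb : ContDiffOn ℝ 1 lamBar (Icc 0 T))
    (hdom : ∀ t ∈ Icc 0 T, (x t, y t, derivWithin y (Icc 0 T) t) ∈ fr.lagrangianDomain 𝒰) :
    EulerLagrange (fr.extendedLagrangian cost) T (fun t => (x t, y t, lam t, lamBar t)) ↔
      ∀ t ∈ Icc 0 T,
        (∀ i, HasDerivWithinAt (fun s => lam s i)
          (fderiv ℝ (fun z => fr.lagrangian cost z (y t) (derivWithin y (Icc 0 T) t)) (x t)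
              (EuclideanSpace.single i 1)
            - ∑ j, ∑ A, lam t j
                * fderiv ℝ (fun z => fr.rho z j A) (x t) (EuclideanSpace.single i 1) * y t A
            + ∑ α, lamBar t α
                * fderiv ℝ (fun z => fr.Phi α z (y t) (derivWithin y (Icc 0 T) t)) (x t)
                    (EuclideanSpace.single i 1)) (Icc 0 T) t) ∧
        (∀ A, HasDerivWithinAt
          (fun s => fderiv ℝ (fun v => fr.lagrangian cost (x s) (y s) v)
            (derivWithin y (Icc 0 T) s) (Pi.single A 1)
            + ∑ α, lamBar s α * (Pi.single A 1 : Fin k ⊕ Fin r → ℝ) (Sum.inr α))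
          (fderiv ℝ (fun w => fr.lagrangian cost (x t) w (derivWithin y (Icc 0 T) t)) (y t)
              (Pi.single A 1)
            - ∑ i, lam t i * fr.rho (x t) i A
            + ∑ α, lamBar t α * ∑ B,
                (fr.christoffel (fr.chart.symm (x t)) (Sum.inr α) A B
                  + fr.christoffel (fr.chart.symm (x t)) (Sum.inr α) B A) * y t B)
          (Icc 0 T) t) ∧
        (∀ i, 0 = derivWithin x (Icc 0 T) t i - ∑ A, fr.rho (x t) i A * y t A) ∧
        (∀ α, 0 = fr.Phi α (x t) (y t) (derivWithin y (Icc 0 T) t)) := by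
  refine forall₂_congr fun t ht => ?_
  rw [derivWithin_extended hT hx hy hl hlb ht]
  have hP : ∀ s ∈ Icc 0 T, ∀ a b c d,
      fderiv ℝ (fun v => fr.extendedLagrangian cost (x s, y s, lam s, lamBar s) v)
        (derivWithin (fun t => (x t, y t, lam t, lamBar t)) (Icc 0 T) s) (a, b, c, d)
      = fderiv ℝ (fun v => fr.lagrangian cost (x s) (y s) v) (derivWithin y (Icc 0 T) s) b
        + ∑ i, lam s i * a i + ∑ α, lamBar s α * b (Sum.inr α) := fun s hs a b c d => by
    rw [derivWithin_extended hT hx hy hl hlb hs]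
    exact fr.fderiv_extendedLagrangian_velocity h𝒰 hcost (hdom s hs) a b c d
  have hR := fr.fderiv_extendedLagrangian_position (xd := derivWithin x (Icc 0 T) t) (l := lam t)
    (lb := lamBar t) (ld := derivWithin lam (Icc 0 T) t) (lbd := derivWithin lamBar (Icc 0 T) t)
    h𝒰 hcost (hdom t ht)
  set P : ℝ → (EuclideanSpace ℝ (Fin n) × (Fin k ⊕ Fin r → ℝ) × (Fin n → ℝ) ×
      (Fin r → ℝ)) →L[ℝ] ℝ :=
    fun s => fderiv ℝ (fun v => fr.extendedLagrangian cost (x s, y s, lam s, lamBar s) v)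
      (derivWithin (fun t => (x t, y t, lam t, lamBar t)) (Icc 0 T) s) with hPdef
  set R := fderiv ℝ (fun z => fr.extendedLagrangian cost z (derivWithin x (Icc 0 T) t,
    derivWithin y (Icc 0 T) t, derivWithin lam (Icc 0 T) t, derivWithin lamBar (Icc 0 T) t))
    (x t, y t, lam t, lamBar t) with hRdef
  have hbasis : HasDerivWithinAt P R (Icc 0 T) t ↔
      (∀ i, HasDerivWithinAt (fun s => P s (EuclideanSpace.single i 1, 0, 0, 0))
        (R (EuclideanSpace.single i 1, 0, 0, 0)) (Icc 0 T) t) ∧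
      (∀ A, HasDerivWithinAt (fun s => P s (0, Pi.single A 1, 0, 0))
        (R (0, Pi.single A 1, 0, 0)) (Icc 0 T) t) ∧
      (∀ i, HasDerivWithinAt (fun s => P s (0, 0, Pi.single i 1, 0))
        (R (0, 0, Pi.single i 1, 0)) (Icc 0 T) t) ∧
      (∀ α, HasDerivWithinAt (fun s => P s (0, 0, 0, Pi.single α 1))
        (R (0, 0, 0, Pi.single α 1)) (Icc 0 T) t) := by
    constructor
    · intro h
      have h' : ∀ e, HasDerivWithinAt (fun s => P s e) (R e) (Icc 0 T) t := fun e => by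
        simpa using h.clm_apply (hasDerivWithinAt_const t (Icc 0 T) e)
      exact ⟨fun i => h' _, fun A => h' _, fun i => h' _, fun α => h' _⟩
    · rintro ⟨h1, h2, h3, h4⟩
      refine hasDerivWithinAt_functional_of_basis
        ((EuclideanSpace.basisFun (Fin n) ℝ).toBasis.prod
          ((Pi.basisFun ℝ (Fin k ⊕ Fin r)).prod
            ((Pi.basisFun ℝ (Fin n)).prod (Pi.basisFun ℝ (Fin r))))) ?_
      rintro (i | A | i | α) <;>
      simp only [Module.Basis.prod_apply, Sum.elim_inl, Sum.elim_inr, Function.comp_apply,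
        LinearMap.inl_apply, LinearMap.inr_apply, Pi.basisFun_apply,
        OrthonormalBasis.coe_toBasis, EuclideanSpace.basisFun_apply]
      · exact h1 i
      · exact h2 A
      · exact h3 i
      · exact h4 α
  have hcongr : ∀ {e} {p : ℝ → ℝ} {ρ : ℝ}, (∀ s ∈ Icc 0 T, P s e = p s) → R e = ρ →
      (HasDerivWithinAt (fun s => P s e) (R e) (Icc 0 T) t ↔
        HasDerivWithinAt p ρ (Icc 0 T) t) := fun {e p ρ} h1 h2 => by
    rw [h2]
    exact ⟨fun h => h.congr (fun s hs => (h1 s hs).symm) (h1 t ht).symm,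
      fun h => h.congr h1 (h1 t ht)⟩
  -- In the multiplier directions the momentum is identically zero, so the Euler-Lagrange equation
  -- there is the constraint itself.
  have hconst : ∀ ρ : ℝ, HasDerivWithinAt (fun _ : ℝ => (0 : ℝ)) ρ (Icc 0 T) t ↔ 0 = ρ :=
    fun ρ => ⟨fun h => (uniqueDiffOn_Icc hT t ht).eq_deriv _ (hasDerivWithinAt_const _ _ _) h,
      fun h => h ▸ hasDerivWithinAt_const _ _ _⟩
  change HasDerivWithinAt P R (Icc 0 T) t ↔ _
  rw [hbasis]
  refine and_congr (forall_congr' fun i => hcongr (fun s hs => ?_) ?_)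
    (and_congr (forall_congr' fun A => hcongr (fun s hs => ?_) ?_)
      (and_congr (forall_congr' fun i => ?_) (forall_congr' fun α => ?_)))
  · rw [hP s hs]; simp
  · rw [hR]
    simp only [map_zero, add_zero, mul_zero, zero_sub, Pi.zero_apply, zero_add,
      Finset.sum_neg_distrib, Finset.mul_sum]
    rw [← sub_eq_add_neg]
    congr 2
    exact Finset.sum_congr rfl fun j _ => Finset.sum_congr rfl fun A _ => by ring
  · rw [hP s hs]; simp
  · rw [hR]
    simp only [map_zero, add_zero, mul_zero, zero_sub, Pi.zero_apply, zero_add,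
      Finset.sum_neg_distrib]
    rw [← sub_eq_add_neg]
    congr 1
    · congr 1
      simp [Pi.single_apply]
    · exact Finset.sum_congr rfl fun α _ => congrArg _
        (fr.fderiv_force_fibre (x t) (y t) _ (Sum.inr α) A)
  · rw [hcongr (p := fun _ => 0) (ρ := derivWithin x (Icc 0 T) t i
      - ∑ A, fr.rho (x t) i A * y t A) (fun s hs => ?_) ?_, hconst]
    · rw [hR]; simp [Pi.single_apply]
    · rw [hP s hs]; simp
  · rw [hcongr (p := fun _ => 0) (ρ := fr.Phi α (x t) (y t) (derivWithin y (Icc 0 T) t))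
      (fun s hs => ?_) ?_, hconst]
    · rw [hR]; simp [Pi.single_apply]
    · rw [hP s hs]; simp

/-- The necessary conditions are the Euler-Lagrange equations of the extended Lagrangian. -/
theorem necessaryConditions_iff_eulerLagrange (h𝒰 : IsOpen 𝒰) (hcost : fr.SmoothCost 𝒰 cost)
    (hT : 0 < T)
    (hx : ContDiffOn ℝ 1 x (Icc 0 T)) (hy : ContDiffOn ℝ 1 y (Icc 0 T))
    (hl : ContDiffOn ℝ 1 lam (Icc 0 T)) (hlb : ContDiffOn ℝ 1 lamBar (Icc 0 T))
    (hdom : ∀ t ∈ Icc 0 T, (x t, y t, derivWithin y (Icc 0 T) t) ∈ fr.lagrangianDomain 𝒰) :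
    fr.NecessaryConditions (fr.lagrangian cost) T x y lam lamBar ↔
      EulerLagrange (fr.extendedLagrangian cost) T (fun t => (x t, y t, lam t, lamBar t)) := by
  rw [fr.eulerLagrange_extended_iff h𝒰 hcost hT hx hy hl hlb hdom]
  have hld : ∀ t ∈ Icc 0 T, ∀ i, HasDerivWithinAt (fun s => lam s i)
      (derivWithin (fun s => lam s i) (Icc 0 T) t) (Icc 0 T) t := fun t ht i =>
    ((contDiffOn_pi.mp hl i).differentiableOn one_ne_zero t ht).hasDerivWithinAt
  have hlbd : ∀ t ∈ Icc 0 T, ∀ α, HasDerivWithinAt (fun s => lamBar s α)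
      (derivWithin (fun s => lamBar s α) (Icc 0 T) t) (Icc 0 T) t := fun t ht α =>
    ((contDiffOn_pi.mp hlb α).differentiableOn one_ne_zero t ht).hasDerivWithinAt
  have hUD := uniqueDiffOn_Icc hT
  constructor
  · intro h t ht
    refine ⟨fun i => (hld t ht i).congr_deriv (by linarith [h.base_eq t ht i]), ?_,
      h.admissible t ht, h.constraint t ht⟩
    rintro (a | α)
    · have h1 := (h.momentum_regular (Sum.inl a) t ht).hasDerivWithinAt
      have h2 := h.actuated_eq t ht a
      have h3 : ∑ i, lam t i * fr.rho (x t) i (Sum.inl a)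
          = ∑ i, fr.rho (x t) i (Sum.inl a) * lam t i :=
        Finset.sum_congr rfl fun i _ => mul_comm _ _
      simp only [Pi.single_apply, reduceCtorEq, if_false, mul_zero, Finset.sum_const_zero,
        add_zero]
      exact h1.congr_deriv (by linarith)
    · have h1 := (h.momentum_regular (Sum.inr α) t ht).hasDerivWithinAt
      have h2 := h.unactuated_eq t ht α
      simp only [Pi.single_apply, Sum.inr.injEq, mul_ite, mul_one, mul_zero, Finset.sum_ite_eq',
        Finset.mem_univ, if_true]
      exact (h1.add (hlbd t ht α)).congr_deriv (by linarith)
  · intro h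
    have hinl : ∀ t ∈ Icc 0 T, ∀ a : Fin k, _ := fun t ht a => (h t ht).2.1 (Sum.inl a)
    -- The Euler-Lagrange equation differentiates only the sum of `∂𝓛/∂ẏ^α` and `λ̄_α`. Since `λ̄`
    -- is `C^1`, subtracting it makes the first term differentiable on its own, as the system
    -- requires.
    have hinr : ∀ t ∈ Icc 0 T, ∀ α : Fin r, _ := fun t ht α =>
      ((h t ht).2.1 (Sum.inr α)).sub (hlbd t ht α)
    simp only [Pi.single_apply, reduceCtorEq, if_false, mul_zero, Finset.sum_const_zero,
      add_zero] at hinl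
    have hmom : ∀ α : Fin r, ((fun s => fderiv ℝ (fun v => fr.lagrangian cost (x s) (y s) v)
            (derivWithin y (Icc 0 T) s) (Pi.single (Sum.inr α) 1)
            + ∑ β, lamBar s β * (Pi.single (Sum.inr α) 1 : Fin k ⊕ Fin r → ℝ) (Sum.inr β))
          - fun s => lamBar s α) = fun s => fderiv ℝ (fun v => fr.lagrangian cost (x s) (y s) v)
            (derivWithin y (Icc 0 T) s) (Pi.single (Sum.inr α) 1) := fun α => by
      funext s
      simp [Pi.single_apply]
    simp only [hmom] at hinr
    refine ⟨hl, hlb, ?_, fun t ht i => ?_, fun t ht a => ?_, fun t ht α => ?_,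
      fun t ht => (h t ht).2.2.1, fun t ht => (h t ht).2.2.2⟩
    · rintro (a | α) t ht
      · exact (hinl t ht a).differentiableWithinAt
      · exact (hinr t ht α).differentiableWithinAt
    · rw [((h t ht).1 i).derivWithin (hUD t ht)]
      ring
    · rw [(hinl t ht a).derivWithin (hUD t ht)]
      have h3 : ∑ i, lam t i * fr.rho (x t) i (Sum.inl a)
          = ∑ i, fr.rho (x t) i (Sum.inl a) * lam t i :=
        Finset.sum_congr rfl fun i _ => mul_comm _ _
      rw [h3]
      ring
    · rw [(hinr t ht α).derivWithin (hUD t ht)]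
      ring

end Equations

/-! ### The control system in coordinates and its derivatives -/

/-- The control system `q̇ = ρ(q) y`, `ẏ^a = u^a - …`, `ẏ^α = - …` in coordinates. -/
def controlField (p : (EuclideanSpace ℝ (Fin n) × (Fin k ⊕ Fin r → ℝ)) × (Fin k → ℝ)) :
    EuclideanSpace ℝ (Fin n) × (Fin k ⊕ Fin r → ℝ) :=
  (WithLp.toLp 2 fun i => ∑ A, fr.rho p.1.1 i A * p.1.2 A,
    fun C => Sum.elim p.2 0 C - fr.force p.1.1 p.1.2 0 C)

theorem contDiffOn_controlField :
    ContDiffOn ℝ ∞ fr.controlField ((fr.chart.target ×ˢ univ) ×ˢ univ) := by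
  have hfst : ContDiff ℝ ∞ (fun p : (EuclideanSpace ℝ (Fin n) × (Fin k ⊕ Fin r → ℝ)) ×
      (Fin k → ℝ) => p.1.1) := contDiff_fst.comp contDiff_fst
  have hsnd : ContDiff ℝ ∞ (fun p : (EuclideanSpace ℝ (Fin n) × (Fin k ⊕ Fin r → ℝ)) ×
      (Fin k → ℝ) => p.1.2) := contDiff_snd.comp contDiff_fst
  refine ContDiffOn.prodMk (contDiffOn_euclidean.mpr fun i => ?_) (contDiffOn_pi.mpr fun C => ?_)
  · change ContDiffOn ℝ ∞ (fun p : (EuclideanSpace ℝ (Fin n) × (Fin k ⊕ Fin r → ℝ)) ×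
      (Fin k → ℝ) => ∑ A, fr.rho p.1.1 i A * p.1.2 A) _
    exact ContDiffOn.sum fun A _ => ContDiffOn.mul
      ((fr.contDiffOn_rho i A).comp hfst.contDiffOn fun p hp => hp.1.1)
      ((contDiff_apply ℝ ℝ A).comp hsnd).contDiffOn
  · refine ContDiffOn.sub ?_ ?_
    · rcases C with c | α
      · exact ((contDiff_apply ℝ ℝ c).comp contDiff_snd).contDiffOn
      · exact contDiffOn_const
    · exact (fr.contDiffOn_force C).comp
        (hfst.prodMk (hsnd.prodMk (contDiff_const (c := (0 : Fin k ⊕ Fin r → ℝ))))).contDiffOn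
        fun p hp => ⟨hp.1.1, mem_univ _⟩

section PointwiseDerivatives

variable {x : EuclideanSpace ℝ (Fin n)} {y yd : Fin k ⊕ Fin r → ℝ} {u : Fin k → ℝ}

theorem differentiableAt_controlField (hx : x ∈ fr.chart.target) :
    DifferentiableAt ℝ fr.controlField ((x, y), u) :=
  (fr.contDiffOn_controlField.contDiffAt
    (((fr.chart.open_target.prod isOpen_univ).prod isOpen_univ).mem_nhds
      ⟨⟨hx, mem_univ _⟩, mem_univ _⟩)).differentiableAt (by simp)

theorem fderiv_controlField_base (hx : x ∈ fr.chart.target) (a : EuclideanSpace ℝ (Fin n))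
    (b : Fin k ⊕ Fin r → ℝ) (c : Fin k → ℝ) (i : Fin n) :
    (fderiv ℝ fr.controlField ((x, y), u) ((a, b), c)).1 i
      = ∑ A, (fr.rho x i A * b A + y A * fderiv ℝ (fun z => fr.rho z i A) x a) := by
  have h1 := (EuclideanSpace.proj (𝕜 := ℝ) i ∘L ContinuousLinearMap.fst ℝ
    (EuclideanSpace ℝ (Fin n)) (Fin k ⊕ Fin r → ℝ)).hasFDerivAt.comp ((x, y), u)
    (fr.differentiableAt_controlField (y := y) (u := u) hx).hasFDerivAt
  have hp : HasFDerivAt (fun p : (EuclideanSpace ℝ (Fin n) × (Fin k ⊕ Fin r → ℝ)) ×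
      (Fin k → ℝ) => p.1.1) (ContinuousLinearMap.fst ℝ _ _ ∘L ContinuousLinearMap.fst ℝ _ _)
      ((x, y), u) := hasFDerivAt_fst.fst
  have hq : ∀ A, HasFDerivAt (fun p : (EuclideanSpace ℝ (Fin n) × (Fin k ⊕ Fin r → ℝ)) ×
      (Fin k → ℝ) => p.1.2 A)
      (ContinuousLinearMap.proj (R := ℝ) (φ := fun _ : Fin k ⊕ Fin r => ℝ) A ∘L
        ContinuousLinearMap.snd ℝ _ _ ∘L ContinuousLinearMap.fst ℝ _ _) ((x, y), u) := fun A =>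
    HasFDerivAt.comp (g := fun v : Fin k ⊕ Fin r → ℝ => v A)
      (f := fun p : (EuclideanSpace ℝ (Fin n) × (Fin k ⊕ Fin r → ℝ)) × (Fin k → ℝ) => p.1.2)
      ((x, y), u) (hasFDerivAt_apply A y) hasFDerivAt_fst.snd
  have h2 := HasFDerivAt.fun_sum fun A (_ : A ∈ Finset.univ) =>
    ((fr.differentiableAt_rho hx i A).hasFDerivAt.comp ((x, y), u) hp).mul (hq A)
  have h3 := congrArg (fun φ => φ ((a, b), c)) (h1.unique h2)
  refine Eq.trans h3 ?_
  simp

theorem fderiv_controlField_fibre (hx : x ∈ fr.chart.target) (a : EuclideanSpace ℝ (Fin n))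
    (b : Fin k ⊕ Fin r → ℝ) (c : Fin k → ℝ) (C : Fin k ⊕ Fin r) :
    (fderiv ℝ fr.controlField ((x, y), u) ((a, b), c)).2 C
      = Sum.elim c 0 C - (fderiv ℝ (fun z => fr.force z y 0 C) x a
        + fderiv ℝ (fun w => fr.force x w 0 C) y b) := by
  have hF : DifferentiableAt ℝ (fun p : EuclideanSpace ℝ (Fin n) × (Fin k ⊕ Fin r → ℝ) =>
      fr.force p.1 p.2 0 C) (x, y) :=
    (fr.differentiableAt_force hx y 0 C).comp (f := fun p => (p.1, p.2, 0)) (x, y)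
      (by fun_prop)
  rw [← fderiv_prod_split hF]
  have h1 := (ContinuousLinearMap.proj (R := ℝ) (φ := fun _ : Fin k ⊕ Fin r => ℝ) C ∘L
    ContinuousLinearMap.snd ℝ (EuclideanSpace ℝ (Fin n)) (Fin k ⊕ Fin r → ℝ)).hasFDerivAt.comp
    ((x, y), u) (fr.differentiableAt_controlField (y := y) (u := u) hx).hasFDerivAt
  have hFd := hF.hasFDerivAt.comp (f := fun p : (EuclideanSpace ℝ (Fin n) ×
    (Fin k ⊕ Fin r → ℝ)) × (Fin k → ℝ) => p.1) ((x, y), u) hasFDerivAt_fst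
  rcases C with d | α
  · have hc : HasFDerivAt (fun p : (EuclideanSpace ℝ (Fin n) × (Fin k ⊕ Fin r → ℝ)) ×
        (Fin k → ℝ) => p.2 d) (ContinuousLinearMap.proj (R := ℝ) (φ := fun _ : Fin k => ℝ) d ∘L
        ContinuousLinearMap.snd ℝ _ _) ((x, y), u) :=
      HasFDerivAt.comp (g := fun v : Fin k → ℝ => v d)
      (f := fun p : (EuclideanSpace ℝ (Fin n) × (Fin k ⊕ Fin r → ℝ)) × (Fin k → ℝ) => p.2)
      ((x, y), u) (hasFDerivAt_apply d u) hasFDerivAt_snd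
    exact congrArg (fun φ => φ ((a, b), c)) (h1.unique (hc.sub hFd))
  · have hc : HasFDerivAt (fun _ : (EuclideanSpace ℝ (Fin n) × (Fin k ⊕ Fin r → ℝ)) ×
      (Fin k → ℝ) => (0 : ℝ)) (0 : _ →L[ℝ] ℝ) ((x, y), u) := hasFDerivAt_const _ _
    exact congrArg (fun φ => φ ((a, b), c)) (h1.unique (hc.sub hFd))

theorem differentiableAt_localCost (h𝒰 : IsOpen 𝒰) (hcost : fr.SmoothCost 𝒰 cost)
    (hx : x ∈ fr.chart.target) (hu : u ∈ 𝒰) :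
    DifferentiableAt ℝ (fun p : EuclideanSpace ℝ (Fin n) × (Fin k ⊕ Fin r → ℝ) × (Fin k → ℝ) =>
      fr.localCost cost p.1 p.2.1 p.2.2) (x, y, u) :=
  (ContDiffOn.contDiffAt hcost ((fr.chart.open_target.prod (isOpen_univ.prod h𝒰)).mem_nhds
    (show (x, y, u) ∈ fr.chart.target ×ˢ univ ×ˢ 𝒰 from
      ⟨hx, mem_univ _, hu⟩))).differentiableAt (by simp)

/-- The derivative of the Lagrangian by the chain rule. -/
theorem fderiv_lagrangian (h𝒰 : IsOpen 𝒰) (hcost : fr.SmoothCost 𝒰 cost)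
    (h : (x, y, yd) ∈ fr.lagrangianDomain 𝒰) (a : EuclideanSpace ℝ (Fin n))
    (b v : Fin k ⊕ Fin r → ℝ) :
    fderiv ℝ (fun p : EuclideanSpace ℝ (Fin n) × (Fin k ⊕ Fin r → ℝ) × (Fin k ⊕ Fin r → ℝ) =>
        fr.lagrangian cost p.1 p.2.1 p.2.2) (x, y, yd) (a, b, v)
      = fderiv ℝ (fun p : EuclideanSpace ℝ (Fin n) × (Fin k ⊕ Fin r → ℝ) × (Fin k → ℝ) =>
          fr.localCost cost p.1 p.2.1 p.2.2)
          (x, y, fun c => fr.force x y yd (Sum.inl c)) (a, b, fun c =>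
            fderiv ℝ (fun z => fr.force z y 0 (Sum.inl c)) x a
            + fderiv ℝ (fun w => fr.force x w 0 (Sum.inl c)) y b + v (Sum.inl c)) := by
  have hx : x ∈ fr.chart.target := h.1.1
  have hC : DifferentiableAt ℝ (fun p : EuclideanSpace ℝ (Fin n) × (Fin k ⊕ Fin r → ℝ) ×
      (Fin k → ℝ) => fr.localCost cost p.1 p.2.1 p.2.2)
      (x, y, fun c => fr.force x y yd (Sum.inl c)) :=
    fr.differentiableAt_localCost h𝒰 hcost hx h.2
  have hF : ∀ c : Fin k, HasFDerivAt (fun p : EuclideanSpace ℝ (Fin n) ×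
      (Fin k ⊕ Fin r → ℝ) × (Fin k ⊕ Fin r → ℝ) => fr.force p.1 p.2.1 p.2.2 (Sum.inl c)) _
      (x, y, yd) := fun c => (fr.differentiableAt_force hx y yd (Sum.inl c)).hasFDerivAt
  have hin : HasFDerivAt (fun p : EuclideanSpace ℝ (Fin n) ×
      (Fin k ⊕ Fin r → ℝ) × (Fin k ⊕ Fin r → ℝ) =>
        (p.1, p.2.1, fun c : Fin k => fr.force p.1 p.2.1 p.2.2 (Sum.inl c))) _ (x, y, yd) :=
    hasFDerivAt_fst.prodMk (hasFDerivAt_snd.fst.prodMk (hasFDerivAt_pi.mpr hF))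
  refine (congrArg (fun φ => φ (a, b, v)) (hC.hasFDerivAt.comp (x, y, yd) hin).fderiv).trans ?_
  refine congrArg (fderiv ℝ _ _) (Prod.ext rfl (Prod.ext rfl (funext fun c => ?_)))
  have hd := fr.differentiableAt_force hx y yd (Sum.inl c)
  change fderiv ℝ (fun p : EuclideanSpace ℝ (Fin n) × (Fin k ⊕ Fin r → ℝ) ×
    (Fin k ⊕ Fin r → ℝ) => fr.force p.1 p.2.1 p.2.2 (Sum.inl c)) (x, y, yd) (a, b, v) = _
  rw [show (a, b, v) = (a, 0, 0) + ((0, b, 0) + (0, 0, v)) by simp, map_add, map_add,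
    fderiv_prod_middle hd, fderiv_prod_last hd]
  rw [Prod.mk_zero_zero, fderiv_prod_left hd a, fr.fderiv_force_base x y yd,
    (fr.hasFDerivAt_force_velocity x y yd _).fderiv]
  change _ = fderiv ℝ (fun z => fr.force z y 0 (Sum.inl c)) x a
    + fderiv ℝ (fun w => fr.force x w 0 (Sum.inl c)) y b + v (Sum.inl c)
  rw [add_assoc]
  congr 2
  rw [show (fun w => fr.force x w yd (Sum.inl c)) = fun w => yd (Sum.inl c) +
    fr.force x w 0 (Sum.inl c) from funext fun w => fr.force_eq_add x w yd _, fderiv_const_add]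

end PointwiseDerivatives

/-- The running cost as a function of state and control. -/
def runningCost (cost : (q : Q) → S.D q → (Fin k → ℝ) → ℝ)
    (p : (EuclideanSpace ℝ (Fin n) × (Fin k ⊕ Fin r → ℝ)) × (Fin k → ℝ)) : ℝ :=
  fr.localCost cost p.1.1 p.1.2 p.2

theorem contDiffOn_runningCost (hcost : fr.SmoothCost 𝒰 cost) :
    ContDiffOn ℝ ∞ (fr.runningCost cost) ((fr.chart.target ×ˢ univ) ×ˢ 𝒰) :=
  ContDiffOn.comp hcost (t := fr.chart.target ×ˢ univ ×ˢ 𝒰)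
    ((contDiff_fst.comp contDiff_fst).prodMk
      ((contDiff_snd.comp contDiff_fst).prodMk contDiff_snd)).contDiffOn
    fun _ hp => ⟨hp.1.1, mem_univ _, hp.2⟩

/-! ### From the adjoint variable to the momenta of the Lagrangian -/

section Adjoint

variable {x : EuclideanSpace ℝ (Fin n)} {y yd : Fin k ⊕ Fin r → ℝ} {u : Fin k → ℝ}
  {ξ : EuclideanSpace ℝ (Fin n) × (Fin k ⊕ Fin r → ℝ) →L[ℝ] ℝ}

theorem fderiv_controlField (hx : x ∈ fr.chart.target) (a : EuclideanSpace ℝ (Fin n))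
    (b : Fin k ⊕ Fin r → ℝ) (c : Fin k → ℝ) :
    fderiv ℝ fr.controlField ((x, y), u) ((a, b), c) =
      (WithLp.toLp 2 fun i =>
        ∑ A, (fr.rho x i A * b A + y A * fderiv ℝ (fun z => fr.rho z i A) x a),
      fun C => Sum.elim c 0 C - (fderiv ℝ (fun z => fr.force z y 0 C) x a
        + fderiv ℝ (fun w => fr.force x w 0 C) y b)) := by
  refine Prod.ext (PiLp.ext fun i => ?_) (funext fun C => ?_)
  · exact fr.fderiv_controlField_base hx a b c i
  · exact fr.fderiv_controlField_fibre hx a b c C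

/-- The stationarity of the control Hamiltonian determines the actuated components of the
adjoint variable. -/
theorem adjoint_actuated (h𝒰 : IsOpen 𝒰) (hcost : fr.SmoothCost 𝒰 cost)
    (hx : x ∈ fr.chart.target) (hu : u ∈ 𝒰)
    (hξ : (ξ ∘L fderiv ℝ fr.controlField ((x, y), u) - fderiv ℝ (fr.runningCost cost) ((x, y), u))
      ∘L ContinuousLinearMap.inr ℝ _ _ = 0) (b : Fin k ⊕ Fin r → ℝ) :
    ξ (0, b) = fderiv ℝ (fun p : EuclideanSpace ℝ (Fin n) × (Fin k ⊕ Fin r → ℝ) × (Fin k → ℝ) =>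
        fr.localCost cost p.1 p.2.1 p.2.2) (x, y, u) (0, 0, fun c => b (Sum.inl c))
      + ∑ α, ξ (0, Pi.single (Sum.inr α) 1) * b (Sum.inr α) := by
  -- The control enters the field by plain inclusion into the actuated components, so stationarity
  -- in `u` identifies `ξ_a` with `∂C/∂u^a`.
  have h0 : ∀ w : Fin k → ℝ, ξ (0, Sum.elim w 0) =
      fderiv ℝ (fun p : EuclideanSpace ℝ (Fin n) × (Fin k ⊕ Fin r → ℝ) × (Fin k → ℝ) =>
        fr.localCost cost p.1 p.2.1 p.2.2) (x, y, u) (0, 0, w) := fun w => by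
    have h := congrArg (fun φ => φ w) hξ
    have hd : fderiv ℝ (fr.runningCost cost) ((x, y), u) ((0, 0), w) = _ :=
      fderiv_comp_prodAssoc (fr.differentiableAt_localCost (y := y) h𝒰 hcost hx hu) 0 0 w
    have hf : fderiv ℝ fr.controlField ((x, y), u) ((0, 0), w) = (0, Sum.elim w 0) := by
      rw [fr.fderiv_controlField hx]
      refine Prod.ext (PiLp.ext fun i => ?_) (funext fun C => ?_) <;> simp
    change ξ (fderiv ℝ fr.controlField ((x, y), u) ((0, 0), w))
      - fderiv ℝ (fr.runningCost cost) ((x, y), u) ((0, 0), w) = 0 at h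
    rw [hf, hd] at h
    exact sub_eq_zero.mp h
  have hr := functional_apply_eq_sum ξ 0 (Sum.elim 0 fun α => b (Sum.inr α))
  simp only [Fintype.sum_sum_type, Sum.elim_inl, Sum.elim_inr, Pi.zero_apply, mul_zero,
    Finset.sum_const_zero, zero_add, PiLp.zero_apply] at hr
  rw [← h0, ← hr, ← map_add]
  congr 1
  refine Prod.ext (by simp) (funext ?_)
  rintro (c | α) <;> simp

/-- The momentum of the Lagrangian, completed by the unactuated multipliers, is the fibre part of
the adjoint variable. -/
theorem adjoint_fibre (h𝒰 : IsOpen 𝒰) (hcost : fr.SmoothCost 𝒰 cost)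
    (hx : x ∈ fr.chart.target) (hu : (fun c => fr.force x y yd (Sum.inl c)) = u) (hu' : u ∈ 𝒰)
    (hξ : (ξ ∘L fderiv ℝ fr.controlField ((x, y), u) - fderiv ℝ (fr.runningCost cost) ((x, y), u))
      ∘L ContinuousLinearMap.inr ℝ _ _ = 0) (b : Fin k ⊕ Fin r → ℝ) :
    fderiv ℝ (fun v => fr.lagrangian cost x y v) yd b
      + ∑ α, ξ (0, Pi.single (Sum.inr α) 1) * b (Sum.inr α) = ξ (0, b) := by
  have hdom : (x, y, yd) ∈ fr.lagrangianDomain 𝒰 := ⟨⟨hx, mem_univ _⟩, by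
    change (fun c => fr.force x y yd (Sum.inl c)) ∈ 𝒰
    rwa [hu]⟩
  rw [fr.adjoint_actuated h𝒰 hcost hx hu' hξ b,
    ← fderiv_prod_last (fr.differentiableAt_lagrangian h𝒰 hcost hdom),
    fr.fderiv_lagrangian h𝒰 hcost hdom, hu]
  simp

/-- The adjoint equation in terms of the Lagrangian. -/
theorem adjoint_equation (h𝒰 : IsOpen 𝒰) (hcost : fr.SmoothCost 𝒰 cost)
    (hx : x ∈ fr.chart.target) (hu : (fun c => fr.force x y yd (Sum.inl c)) = u) (hu' : u ∈ 𝒰)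
    (hξ : (ξ ∘L fderiv ℝ fr.controlField ((x, y), u) - fderiv ℝ (fr.runningCost cost) ((x, y), u))
      ∘L ContinuousLinearMap.inr ℝ _ _ = 0) (a : EuclideanSpace ℝ (Fin n))
    (b : Fin k ⊕ Fin r → ℝ) :
    (-((ξ ∘L fderiv ℝ fr.controlField ((x, y), u) - fderiv ℝ (fr.runningCost cost) ((x, y), u))
        ∘L ContinuousLinearMap.inl ℝ _ _)) (a, b) =
      fderiv ℝ (fun z => fr.lagrangian cost z y yd) x a
        + fderiv ℝ (fun w => fr.lagrangian cost x w yd) y b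
        - ∑ i, ξ (EuclideanSpace.single i 1, 0)
          * ∑ A, (fr.rho x i A * b A + y A * fderiv ℝ (fun z => fr.rho z i A) x a)
        + ∑ α, ξ (0, Pi.single (Sum.inr α) 1)
          * (fderiv ℝ (fun z => fr.Phi α z y yd) x a
            + fderiv ℝ (fun w => fr.Phi α x w yd) y b) := by
  have hdom : (x, y, yd) ∈ fr.lagrangianDomain 𝒰 := ⟨⟨hx, mem_univ _⟩, by
    change (fun c => fr.force x y yd (Sum.inl c)) ∈ 𝒰
    rwa [hu]⟩
  have hL := fr.differentiableAt_lagrangian h𝒰 hcost hdom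
  have hd : fderiv ℝ (fr.runningCost cost) ((x, y), u) ((a, b), 0) = _ :=
    fderiv_comp_prodAssoc (fr.differentiableAt_localCost (y := y) h𝒰 hcost hx hu') a b 0
  have hΦ : ∀ α, fderiv ℝ (fun w => fr.Phi α x w yd) y
      = fderiv ℝ (fun w => fr.force x w 0 (Sum.inr α)) y := fun α => by
    rw [show (fun w => fr.Phi α x w yd) = fun w => yd (Sum.inr α) + fr.force x w 0 (Sum.inr α) from
      funext fun w => fr.force_eq_add x w yd _, fderiv_const_add]
  have hΦ' : ∀ α, fderiv ℝ (fun z => fr.Phi α z y yd) x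
      = fderiv ℝ (fun z => fr.force z y 0 (Sum.inr α)) x := fun α =>
    fr.fderiv_force_base x y yd (Sum.inr α)
  simp only [hΦ, hΦ']
  rw [← fderiv_prod_left (g := fun p : EuclideanSpace ℝ (Fin n) × (Fin k ⊕ Fin r → ℝ) ×
      (Fin k ⊕ Fin r → ℝ) => fr.lagrangian cost p.1 p.2.1 p.2.2) hL, ← fderiv_prod_middle hL,
    ← map_add, show ((a, 0) : EuclideanSpace ℝ (Fin n) × (Fin k ⊕ Fin r → ℝ) ×
      (Fin k ⊕ Fin r → ℝ)) + (0, b, 0) = (a, b, 0) by simp [Prod.mk_add_mk, ← Prod.mk_zero_zero],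
    fr.fderiv_lagrangian h𝒰 hcost hdom, hu]
  change -(ξ (fderiv ℝ fr.controlField ((x, y), u) ((a, b), 0))
    - fderiv ℝ (fr.runningCost cost) ((x, y), u) ((a, b), 0)) = _
  rw [hd, fr.fderiv_controlField hx]
  set w : Fin k ⊕ Fin r → ℝ := fun C => fderiv ℝ (fun z => fr.force z y 0 C) x a
    + fderiv ℝ (fun w => fr.force x w 0 C) y b with hw
  set v : EuclideanSpace ℝ (Fin n) := WithLp.toLp 2 fun i =>
    ∑ A, (fr.rho x i A * b A + y A * fderiv ℝ (fun z => fr.rho z i A) x a) with hv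
  have hsplit : ((v, fun C => Sum.elim (0 : Fin k → ℝ) 0 C - w C) :
      EuclideanSpace ℝ (Fin n) × (Fin k ⊕ Fin r → ℝ)) = (v, 0) - (0, w) := by
    refine Prod.ext (by simp) (funext ?_)
    rintro (c | α) <;> simp
  have hv' := functional_apply_eq_sum ξ v 0
  simp only [Pi.zero_apply, mul_zero, Finset.sum_const_zero, add_zero] at hv'
  set D := fderiv ℝ (fun p : EuclideanSpace ℝ (Fin n) × (Fin k ⊕ Fin r → ℝ) × (Fin k → ℝ) =>
        fr.localCost cost p.1 p.2.1 p.2.2) (x, y, u) with hD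
  -- The derivative of `𝓛` at fixed `ẏ` is that of the cost plus the contribution through `u^a =
  -- F^a`. By `adjoint_actuated` the latter is the actuated part of `ξ` applied to the variation `w`
  -- of the force, which cancels the actuated terms of the adjoint equation.
  have hDsplit : D (a, b, fun c => w (Sum.inl c) + (0 : Fin k ⊕ Fin r → ℝ) (Sum.inl c)) =
      D (a, b, 0) + D (0, 0, fun c => w (Sum.inl c)) := by
    rw [← map_add]
    simp
  refine Eq.trans ?_ (congrArg (fun s => s - ∑ i, ξ (EuclideanSpace.single i 1, 0) * v i
    + ∑ α, ξ (0, Pi.single (Sum.inr α) 1) * w (Sum.inr α)) hDsplit.symm)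
  rw [hsplit, map_sub, hv', fr.adjoint_actuated h𝒰 hcost hx hu' hξ w]
  ring

end Adjoint

/-! ### Solutions, competitors and the necessary conditions -/

section Solutions

variable {N : ℕ∞} {x : ℝ → EuclideanSpace ℝ (Fin n)} {y : ℝ → Fin k ⊕ Fin r → ℝ}
  {u : ℝ → Fin k → ℝ}

variable {fr} in
-- Linear independence of the frame turns the vector equation of motion into `F^a = u^a` and `Φ^α =
-- 0`.
theorem IsSolution.force_eq (h : fr.IsSolution 𝒰 N T x y u) {t : ℝ} (ht : t ∈ Icc 0 T)
    (C : Fin k ⊕ Fin r) :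
    fr.force (x t) (y t) (derivWithin y (Icc 0 T) t) C = Sum.elim (u t) 0 C := by
  have hli := Fintype.linearIndependent_iff.mp
    (fr.linearIndependent _ (fr.chart.map_target (h.x_mem t ht)))
    (fun C => fr.force (x t) (y t) (derivWithin y (Icc 0 T) t) C - Sum.elim (u t) 0 C) (by
      have hd := h.dynamics t ht
      simp only [sub_smul, Finset.sum_sub_distrib, hd, Fintype.sum_sum_type, Sum.elim_inl,
        Sum.elim_inr, Pi.zero_apply, zero_smul, Finset.sum_const_zero, add_zero, sub_self])
  exact sub_eq_zero.mp (hli C)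

variable {fr} in
theorem IsSolution.mem_lagrangianDomain (h : fr.IsSolution 𝒰 N T x y u) {t : ℝ}
    (ht : t ∈ Icc 0 T) : (x t, y t, derivWithin y (Icc 0 T) t) ∈ fr.lagrangianDomain 𝒰 := by
  refine ⟨⟨h.x_mem t ht, mem_univ _⟩, ?_⟩
  change (fun c => fr.force (x t) (y t) (derivWithin y (Icc 0 T) t) (Sum.inl c)) ∈ 𝒰
  rw [show (fun c => fr.force (x t) (y t) (derivWithin y (Icc 0 T) t) (Sum.inl c)) = u t from
    funext fun c => h.force_eq ht (Sum.inl c)]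
  exact h.u_mem t ht

variable {fr} in
theorem IsSolution.hasDerivWithinAt (h : fr.IsSolution 𝒰 N T x y u) (hN : 1 ≤ N) {t : ℝ}
    (ht : t ∈ Icc 0 T) :
    HasDerivWithinAt (fun s => (x s, y s)) (fr.controlField ((x t, y t), u t)) (Icc 0 T) t := by
  have hN' : (N : WithTop ℕ∞) ≠ 0 := by
    have : N ≠ 0 := (zero_lt_one.trans_le hN).ne'
    exact_mod_cast this
  have h1 := (h.x_regular.differentiableOn hN' t ht).hasDerivWithinAt
  have h2 := (h.y_regular.differentiableOn hN' t ht).hasDerivWithinAt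
  refine (h1.prodMk h2).congr_deriv (Prod.ext ?_ (funext fun C => ?_))
  · refine (h.admissible t ht).trans (PiLp.ext fun i => fr.anchorCoord_vec (x t) (y t) i)
  · have hF := h.force_eq ht C
    rw [fr.force_eq_add] at hF
    exact eq_sub_of_add_eq hF

variable {fr} in
-- The control equals `F^a(q, y, ẏ)`, which costs one derivative. Stating this for finite `j` with
-- `j + 1 ≤ N` treats finite `N` and `N = ∞` alike.
theorem IsSolution.contDiffOn_control (h : fr.IsSolution 𝒰 N T x y u) (hT : 0 < T) {j : ℕ}
    (hj : ((j + 1 : ℕ) : ℕ∞) ≤ N) : ContDiffOn ℝ j u (Icc 0 T) := by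
  have hjN : ((j : WithTop ℕ∞) + 1) ≤ (N : WithTop ℕ∞) := by exact_mod_cast hj
  have hj' : (j : WithTop ℕ∞) ≤ (N : WithTop ℕ∞) := le_self_add.trans hjN
  have hyd : ContDiffOn ℝ j (derivWithin y (Icc 0 T)) (Icc 0 T) :=
    h.y_regular.derivWithin (uniqueDiffOn_Icc hT) hjN
  have hc : ContDiffOn ℝ j (fun t => fun c : Fin k =>
      fr.force (x t) (y t) (derivWithin y (Icc 0 T) t) (Sum.inl c)) (Icc 0 T) :=
    (fr.contDiffOn_actuatedForce.of_le (by exact_mod_cast le_top)).comp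
      ((h.x_regular.of_le hj').prodMk ((h.y_regular.of_le hj').prodMk hyd))
      fun t ht => ⟨h.x_mem t ht, mem_univ _⟩
  exact hc.congr fun t ht => funext fun c => (h.force_eq ht (Sum.inl c)).symm

/-- Solutions of the control system are solutions of the controlled nonholonomic problem. -/
theorem isSolution_of_hasDerivWithinAt (hT : 0 < T)
    {z : ℝ → EuclideanSpace ℝ (Fin n) × (Fin k ⊕ Fin r → ℝ)}
    (hu : ∀ j : ℕ, ((j + 1 : ℕ) : ℕ∞) ≤ N → ContDiffOn ℝ j u (Icc 0 T))
    (hmem : ∀ t ∈ Icc 0 T, (z t, u t) ∈ (fr.chart.target ×ˢ univ) ×ˢ 𝒰)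
    (hz : ∀ t ∈ Icc 0 T, HasDerivWithinAt z (fr.controlField (z t, u t)) (Icc 0 T) t) :
    fr.IsSolution 𝒰 N T (fun t => (z t).1) (fun t => (z t).2) u := by
  have hreg : ContDiffOn ℝ N z (Icc 0 T) :=
    contDiffOn_of_hasDerivWithinAt_control hT fr.contDiffOn_controlField hu
      (fun t ht => ⟨(hmem t ht).1, mem_univ _⟩) hz
  have hUD := uniqueDiffOn_Icc hT
  refine ⟨contDiff_fst.comp_contDiffOn hreg, contDiff_snd.comp_contDiffOn hreg,
    fun t ht => (hmem t ht).1.1, fun t ht => (hmem t ht).2, fun t ht => ?_, fun t ht => ?_⟩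
  · have h1 : HasDerivWithinAt (fun t => (z t).1) (fr.controlField (z t, u t)).1
        (Icc 0 T) t :=
      (ContinuousLinearMap.fst ℝ (EuclideanSpace ℝ (Fin n))
        (Fin k ⊕ Fin r → ℝ)).hasFDerivAt.comp_hasDerivWithinAt t (hz t ht)
    rw [h1.derivWithin (hUD t ht)]
    exact PiLp.ext fun i => (fr.anchorCoord_vec (z t).1 (z t).2 i).symm
  · have h2 : HasDerivWithinAt (fun t => (z t).2) (fr.controlField (z t, u t)).2
        (Icc 0 T) t :=
      (ContinuousLinearMap.snd ℝ (EuclideanSpace ℝ (Fin n))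
        (Fin k ⊕ Fin r → ℝ)).hasFDerivAt.comp_hasDerivWithinAt t (hz t ht)
    rw [h2.derivWithin (hUD t ht)]
    have hF : ∀ C, fr.force (z t).1 (z t).2 (fr.controlField (z t, u t)).2 C
        = Sum.elim (u t) 0 C := fun C => by
      rw [fr.force_eq_add]
      exact sub_add_cancel _ _
    change ∑ C, fr.force (z t).1 (z t).2 (fr.controlField (z t, u t)).2 C • _ = _
    simp [hF]

/-- An adjoint variable along a solution provides multipliers for the necessary conditions. -/
theorem necessaryConditions_of_adjoint (h𝒰 : IsOpen 𝒰) (hcost : fr.SmoothCost 𝒰 cost)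
    (hT : 0 < T) (hN : 1 ≤ N) (h : fr.IsSolution 𝒰 N T x y u)
    {ξ : ℝ → EuclideanSpace ℝ (Fin n) × (Fin k ⊕ Fin r → ℝ) →L[ℝ] ℝ}
    (hξ : ∀ t ∈ Icc 0 T, HasDerivWithinAt ξ (-((ξ t ∘L fderiv ℝ fr.controlField ((x t, y t), u t)
      - fderiv ℝ (fr.runningCost cost) ((x t, y t), u t)) ∘L ContinuousLinearMap.inl ℝ _ _))
      (Icc 0 T) t)
    (hstat : ∀ t ∈ Icc 0 T, (ξ t ∘L fderiv ℝ fr.controlField ((x t, y t), u t)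
      - fderiv ℝ (fr.runningCost cost) ((x t, y t), u t)) ∘L ContinuousLinearMap.inr ℝ _ _ = 0) :
    fr.NecessaryConditions (fr.lagrangian cost) T x y
      (fun t i => ξ t (EuclideanSpace.single i 1, 0))
      (fun t α => ξ t (0, Pi.single (Sum.inr α) 1)) := by
  have hUD := uniqueDiffOn_Icc hT
  have hN' : (1 : WithTop ℕ∞) ≤ N := by exact_mod_cast hN
  have hx := h.x_regular.of_le hN'
  have hy := h.y_regular.of_le hN'
  have hmem : ∀ t ∈ Icc 0 T, ((x t, y t), u t) ∈ (fr.chart.target ×ˢ univ) ×ˢ 𝒰 :=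
    fun t ht => ⟨⟨h.x_mem t ht, mem_univ _⟩, h.u_mem t ht⟩
  have hΩ : IsOpen ((fr.chart.target ×ˢ (univ : Set (Fin k ⊕ Fin r → ℝ))) ×ˢ 𝒰) :=
    (fr.chart.open_target.prod isOpen_univ).prod h𝒰
  have hu : ContinuousOn u (Icc 0 T) :=
    (h.contDiffOn_control (j := 0) hT (by simpa using hN)).continuousOn
  have hzu : ContinuousOn (fun t => ((x t, y t), u t)) (Icc 0 T) :=
    (hx.continuousOn.prodMk hy.continuousOn).prodMk hu
  -- The right-hand side of the adjoint equation is continuous along the solution; this makes the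
  -- multipliers `C^1`.
  have hξc : ContDiffOn ℝ 1 ξ (Icc 0 T) := by
    have hξ0 : ContinuousOn ξ (Icc 0 T) := fun t ht => (hξ t ht).continuousWithinAt
    rw [show (1 : WithTop ℕ∞) = 0 + 1 by simp, contDiffOn_succ_iff_derivWithin hUD]
    refine ⟨fun t ht => (hξ t ht).differentiableWithinAt, by simp, ?_⟩
    rw [contDiffOn_zero]
    have hf := ((fr.contDiffOn_controlField.mono (prod_mono_right (subset_univ 𝒰))
      ).continuousOn_fderiv_of_isOpen hΩ (by simp)).comp hzu hmem
    have hℓ := ((fr.contDiffOn_runningCost hcost).continuousOn_fderiv_of_isOpen hΩ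
      (by simp)).comp hzu hmem
    exact (((hξ0.clm_comp hf).sub hℓ).clm_comp continuousOn_const).neg.congr
      fun t ht => (hξ t ht).derivWithin (hUD t ht)
  have happ : ∀ e, ContDiffOn ℝ 1 (fun t => ξ t e) (Icc 0 T) := fun e =>
    hξc.clm_apply contDiffOn_const
  have hder : ∀ t ∈ Icc 0 T, ∀ e, HasDerivWithinAt (fun s => ξ s e) _ (Icc 0 T) t :=
    fun t ht e => (hξ t ht).clm_apply (hasDerivWithinAt_const t (Icc 0 T) e)
  have hF : ∀ t ∈ Icc 0 T, (fun c => fr.force (x t) (y t) (derivWithin y (Icc 0 T) t)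
      (Sum.inl c)) = u t := fun t ht => funext fun c => h.force_eq ht (Sum.inl c)
  have hl := contDiffOn_pi.mpr fun i : Fin n => happ (EuclideanSpace.single i 1, 0)
  have hlb := contDiffOn_pi.mpr fun α : Fin r => happ (0, Pi.single (Sum.inr α) 1)
  have hdom := fun t (ht : t ∈ Icc 0 T) => h.mem_lagrangianDomain ht
  rw [fr.necessaryConditions_iff_eulerLagrange h𝒰 hcost hT hx hy hl hlb hdom,
    fr.eulerLagrange_extended_iff h𝒰 hcost hT hx hy hl hlb hdom]
  intro t ht
  have hadj := fr.adjoint_equation h𝒰 hcost (h.x_mem t ht) (hF t ht) (h.u_mem t ht) (hstat t ht)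
  refine ⟨fun i => (hder t ht _).congr_deriv ?_, fun A => ?_, fun i => ?_, fun α => ?_⟩
  · rw [map_zero, add_zero, hadj]
    simp only [map_zero, add_zero, mul_zero, zero_add, Pi.zero_apply, Finset.mul_sum]
    congr 2
    exact Finset.sum_congr rfl fun j _ => Finset.sum_congr rfl fun A _ => by ring
  -- The fibre momentum of the extended Lagrangian coincides with a component of `ξ` at every time,
  -- so it inherits differentiability from `ξ` although `ẏ` is only continuous when `N = 1`.
  · have hfib : ∀ s ∈ Icc 0 T, _ := fun s hs => fr.adjoint_fibre h𝒰 hcost (h.x_mem s hs)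
      (hF s hs) (h.u_mem s hs) (hstat s hs) (Pi.single A 1)
    refine ((hder t ht (0, Pi.single A 1)).congr_deriv ?_).congr hfib (hfib t ht)
    rw [map_zero, add_zero, hadj]
    simp only [map_zero, add_zero, mul_zero, zero_add]
    congr 1
    · congr 1
      simp [Pi.single_apply]
    · exact Finset.sum_congr rfl fun α _ => congrArg _
        (fr.fderiv_force_fibre (x t) (y t) _ (Sum.inr α) A)
  · rw [h.admissible t ht, fr.anchorCoord_vec, sub_self]
  · exact (h.force_eq ht (Sum.inr α)).symm

/-- A local optimum that is not abnormal has multipliers satisfying the necessary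
conditions. -/
theorem exists_necessaryConditions_of_isLocallyOptimal (h𝒰 : IsOpen 𝒰)
    (hcost : fr.SmoothCost 𝒰 cost) (hT : 0 < T) (hN : 1 ≤ N)
    (hopt : fr.IsLocallyOptimal 𝒰 cost N T x y u) (habn : ¬ fr.IsAbnormal T x y) :
    ∃ (lam : ℝ → Fin n → ℝ) (lamBar : ℝ → Fin r → ℝ),
      fr.NecessaryConditions (fr.lagrangian cost) T x y lam lamBar := by
  obtain ⟨h, ε, hε, hopt⟩ := hopt
  obtain ⟨σ, hσ, hσopt⟩ : ∃ σ : ℝ, σ ≠ 0 ∧ ∀ x' y' u', fr.IsCompetitor 𝒰 N T ε x y u x' y' u' →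
      σ * fr.totalCost cost T x y u ≤ σ * fr.totalCost cost T x' y' u' := by
    rcases hopt with hmin | hmax
    · exact ⟨1, one_ne_zero, fun x' y' u' hc => by simpa using hmin x' y' u' hc⟩
    · exact ⟨-1, by simp, fun x' y' u' hc => by simpa using hmax x' y' u' hc⟩
  have hmem : ∀ t ∈ Icc 0 T, ((x t, y t), u t) ∈ (fr.chart.target ×ˢ univ) ×ˢ 𝒰 :=
    fun t ht => ⟨⟨h.x_mem t ht, mem_univ _⟩, h.u_mem t ht⟩
  have hΩ : IsOpen ((fr.chart.target ×ˢ (univ : Set (Fin k ⊕ Fin r → ℝ))) ×ˢ 𝒰) :=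
    (fr.chart.open_target.prod isOpen_univ).prod h𝒰
  have hu : ContinuousOn u (Icc 0 T) :=
    (h.contDiffOn_control (j := 0) hT (by simpa using hN)).continuousOn
  obtain ⟨p₀, ξ, hne, hξ, hstat⟩ := exists_multiplier_of_locally_optimal hT hΩ
    (fr.contDiffOn_controlField.mono (prod_mono_right (subset_univ 𝒰)))
    (fr.contDiffOn_runningCost hcost) (z := fun t => (x t, y t)) hu hmem
    (fun t ht => h.hasDerivWithinAt hN ht) hσ hε (by
      intro z' v hv hz'mem hz' h0 h1 hclose
      refine hσopt (fun t => (z' t).1) (fun t => (z' t).2) (fun t => u t + v t)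
        ⟨fr.isSolution_of_hasDerivWithinAt hT (fun j hj => ?_) hz'mem hz',
          congrArg Prod.fst h0, congrArg Prod.snd h0, congrArg Prod.fst h1,
          congrArg Prod.snd h1, fun t ht => ?_⟩
      · exact (h.contDiffOn_control hT hj).add (hv.of_le (by exact_mod_cast le_top)).contDiffOn
      · obtain ⟨hz, hv⟩ := hclose t ht
        refine ⟨(norm_fst_le (z' t - (x t, y t))).trans_lt hz,
          (norm_snd_le (z' t - (x t, y t))).trans_lt hz, ?_⟩
        simpa using hv)
  -- A vanishing cost multiplier leads to abnormality; otherwise `ξ` can be rescaled.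
  by_cases hp : p₀ = 0
  · exfalso
    subst hp
    -- For the zero cost the Lagrangian is zero, so the translation of the adjoint variable yields
    -- precisely the system that defines abnormality.
    have hcost0 : fr.SmoothCost 𝒰 (fun _ _ _ => 0) := contDiffOn_const
    have hrun : fr.runningCost (fun _ _ _ => 0) = fun _ => 0 := rfl
    have hnc := fr.necessaryConditions_of_adjoint h𝒰 hcost0 hT hN h (ξ := ξ)
      (fun t ht => by simpa [hrun] using hξ t ht) (fun t ht => by simpa [hrun] using hstat t ht)
    refine habn ⟨_, _, hnc, T, ⟨hT.le, le_rfl⟩, ?_⟩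
    -- Nontriviality is checked at time `T`. If `λ` and `λ̄` vanish there, stationarity with zero
    -- cost also kills the actuated components, so `ξ T = 0`, contrary to `hne`.
    by_contra! hzero
    have hTmem : T ∈ Icc 0 T := ⟨hT.le, le_rfl⟩
    have hξT : ξ T = 0 := by
      have hact := fr.adjoint_actuated h𝒰 hcost0 (h.x_mem T hTmem) (h.u_mem T hTmem) (ξ := ξ T)
        (y := y T) (by simpa [hrun] using hstat T hTmem)
      have hfib : ∀ b, ξ T (0, b) = 0 := fun b => by
        rw [hact b]
        simp [localCost, fun α => congrFun hzero.2 α]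
      refine ContinuousLinearMap.ext fun e => ?_
      rw [functional_apply_eq_sum (ξ T) e.1 e.2]
      simp [hfib, fun i => congrFun hzero.1 i]
    exact hne.elim (fun h => h rfl) fun h => h hξT
  -- The factor `-p₀⁻¹` normalises the cost multiplier to `-1`, the sign used in
  -- `necessaryConditions_of_adjoint`.
  · refine ⟨_, _, fr.necessaryConditions_of_adjoint h𝒰 hcost hT hN h (ξ := fun t => (-p₀⁻¹) • ξ t)
      (fun t ht => ?_) (fun t ht => ?_)⟩
    · refine ((hξ t ht).const_smul (-p₀⁻¹)).congr_deriv ?_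
      ext e <;> simp <;> field_simp
    · have h1 := congrArg (fun φ => (-p₀⁻¹) • φ) (hstat t ht)
      rw [smul_zero] at h1
      rw [← h1]
      ext e
      simp
      field_simp
      ring

end Solutions

end AdaptedFrame

end NonholonomicControl

end

/-! ### The theorem -/

theorem mainTheorem2 {n k r : ℕ}
    {Q : Type*} [TopologicalSpace Q] [ChartedSpace (EuclideanSpace ℝ (Fin n)) Q]
    [IsManifold (𝓡 n) ∞ Q] [T2Space Q] [SecondCountableTopology Q]
    {F : Type*} [NormedAddCommGroup F] [NormedSpace ℝ F] [FiniteDimensional ℝ F]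
    {E : Q → Type*} [TopologicalSpace (TotalSpace F E)] [∀ q, TopologicalSpace (E q)]
    [FiberBundle F E] [∀ q, AddCommGroup (E q)] [∀ q, Module ℝ (E q)] [VectorBundle ℝ F E]
    [ContMDiffVectorBundle ∞ F E (𝓡 n)]
    (𝒜 : NonholonomicControl.LieAlgebroid n F E)
    (S : NonholonomicControl.NonholonomicSystem 𝒜 (k + r))
    (Dc : ∀ q : Q, Submodule ℝ (E q)) (hDc : NonholonomicControl.IsSubbundle n F Dc k)
    (hk : k < k + r)
    (fr : NonholonomicControl.AdaptedFrame S Dc k r)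
    (𝒰 : Set (Fin k → ℝ)) (h𝒰 : IsOpen 𝒰)
    (cost : (q : Q) → S.D q → (Fin k → ℝ) → ℝ) (hcost : fr.SmoothCost 𝒰 cost)
    (T : ℝ) (hT : 0 < T) :
    -- every local optimum is abnormal or satisfies the system with suitable multipliers
    (∀ (N : ℕ∞), 1 ≤ N →
      ∀ (x : ℝ → EuclideanSpace ℝ (Fin n)) (y : ℝ → Fin k ⊕ Fin r → ℝ) (u : ℝ → Fin k → ℝ),
        fr.IsLocallyOptimal 𝒰 cost N T x y u → ¬ fr.IsAbnormal T x y →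
          ∃ (lam : ℝ → Fin n → ℝ) (lamBar : ℝ → Fin r → ℝ),
            fr.NecessaryConditions (fr.lagrangian cost) T x y lam lamBar) ∧
    -- the system is the Euler-Lagrange system of the constrained variational problem
    (∀ (x : ℝ → EuclideanSpace ℝ (Fin n)) (y : ℝ → Fin k ⊕ Fin r → ℝ)
      (lam : ℝ → Fin n → ℝ) (lamBar : ℝ → Fin r → ℝ),
        ContDiffOn ℝ 1 x (Set.Icc 0 T) → ContDiffOn ℝ 1 y (Set.Icc 0 T) →
        ContDiffOn ℝ 1 lam (Set.Icc 0 T) → ContDiffOn ℝ 1 lamBar (Set.Icc 0 T) →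
        (∀ t ∈ Set.Icc 0 T, x t ∈ fr.chart.target ∧
          (fun c => fr.force (x t) (y t) (derivWithin y (Set.Icc 0 T) t) (Sum.inl c)) ∈ 𝒰) →
        (fr.NecessaryConditions (fr.lagrangian cost) T x y lam lamBar ↔
          NonholonomicControl.EulerLagrange (fr.extendedLagrangian cost) T
            (fun t => (x t, y t, lam t, lamBar t))) ∧
        (fr.NecessaryConditions (fr.lagrangian cost) T x y lam lamBar ↔
          NonholonomicControl.IsStationary (fr.extendedLagrangian cost) T
            (fun t => (x t, y t, lam t, lamBar t)))) := by
  refine ⟨fun N hN x y u hopt habn =>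
    fr.exists_necessaryConditions_of_isLocallyOptimal h𝒰 hcost hT hN hopt habn, ?_⟩
  intro x y lam lamBar hx hy hl hlb hmem
  have hdom : ∀ t ∈ Set.Icc 0 T,
      (x t, y t, derivWithin y (Set.Icc 0 T) t) ∈ fr.lagrangianDomain 𝒰 := fun t ht =>
    ⟨⟨(hmem t ht).1, Set.mem_univ _⟩, (hmem t ht).2⟩
  have hEL := fr.necessaryConditions_iff_eulerLagrange h𝒰 hcost hT hx hy hl hlb hdom
  refine ⟨hEL, hEL.trans (NonholonomicControl.eulerLagrange_iff_isStationary hT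
    (fr.isOpen_extendedDomain h𝒰) (fr.contDiffOn_extendedLagrangian hcost)
    (hx.prodMk (hy.prodMk (hl.prodMk hlb))) fun t ht => ?_)⟩
  rw [NonholonomicControl.AdaptedFrame.derivWithin_extended hT hx hy hl hlb ht]
  exact hdom t ht
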